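/- Let $F=F(X)$ be the free group on a finite set $X$. For $g\in F$ let $|g|$ be the length of its reduced word, and write $u^x=x^{-1}ux$ and $[a,b]=a^{-1}b^{-1}ab$. An input of the Anshel--Anshel--Goldfeld (AAG) problem in $F$ consists of public tuples $(a_1,\dots,a_m)$ and $(b_1,\dots,b_n)$ of words in $X^{\pm1}$, together with the reduced words of $b_1^a,\dots,b_n^a$ and $a_1^b,\dots,a_m^b$, where $a\in\langle a_1,\dots,a_m\rangle$ and $b\in\langle b_1,\dots,b_n\rangle$ are secret elements of the subgroups of $F$ generated by the public words. The problem is to compute from these public data the reduced word of the shared key $[a,b]$. The public data are written as a string, each word being followed by a separator symbol and each of the four tuples by an end symbol; the size $N$ of the input is the length of this string. Algorithms are deterministic multitape (equivalently, multi-stack) Turing machines; they may depend on $X$. A set $S\subseteq F^{m+n}$ is exponentially generic with respect to a size function $s\colon F^{m+n}\to\mathbb N$ if there are constants $C$ and $0<q<1$ such that the ball $B_r=\{T : s(T)\le r\}$ satisfies $\bigl|1-|B_r\cap S|/|B_r|\bigr|\le Cq^r$ for all $r\in\mathbb N$ (in particular $|B_r\cap S|/|B_r|\to1$). The following hold. 1.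 The AAG problem in $F$ is decidable in at most quadratic time in the size of the public data: there are an algorithm and a constant $C$ such that for all $m,n\in\mathbb N$ the algorithm solves every input in at most $C N^2$ steps. 2. The AAG problem in $F$ is decidable in linear time on an exponentially generic set of inputs: for all fixed $m,n\in\mathbb N$ there are a set $S\subseteq F^{m+n}$ that is exponentially generic with respect to both the total length $\sum_i|w_i|$ and the maximal length $\max_i|w_i|$ of a tuple $(w_i)_i$, an algorithm, and a constant $C$, such that the algorithm never returns a wrong key on any input with parameters $m,n$, and, for every input whose tuple of public generators $(a_1,\dots,a_m,b_1,\dots,b_n)$ represents an element of $S$ (and for arbitrary secrets $a,b$ as above), it returns the key in at most $CN$ steps. -/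

import Mathlib

/-! ### Words, and the Anshel-Anshel-Goldfeld (AAG) problem in the free group on `X` -/

/-- A word in the letters `x`, `x⁻¹` with `x ∈ X`: the pair `(x, true)` stands for `x` and
`(x, false)` for `x⁻¹`. -/
abbrev GroupWord (X : Type) : Type := List (X × Bool)

/-- A run of the AAG key exchange in the free group on `X`, with `m` public generators for Alice
and `n` public generators for Bob, given by arbitrary words.  The secret `a` is an element of
Alice's subgroup, the secret `b` an element of Bob's subgroup. -/
structure AAGInstance (X : Type) (m n : ℕ) where
  genA : Fin m → GroupWord X
  genB : Fin n → GroupWord X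
  a : FreeGroup X
  b : FreeGroup X
  a_mem : a ∈ Subgroup.closure (Set.range fun i => FreeGroup.mk (genA i))
  b_mem : b ∈ Subgroup.closure (Set.range fun j => FreeGroup.mk (genB j))

/-- The symbols in which the public data are written. -/
inductive AAGSymbol (X : Type) : Type
  | letter (x : X × Bool) : AAGSymbol X
  | wordEnd : AAGSymbol X
  | tupleEnd : AAGSymbol X

/-- A tuple of words as a string of symbols. -/
def encodeTuple {X : Type} {k : ℕ} (w : Fin k → GroupWord X) : List (AAGSymbol X) :=
  (List.ofFn w).flatMap (fun u => u.map AAGSymbol.letter ++ [AAGSymbol.wordEnd]) ++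
    [AAGSymbol.tupleEnd]

namespace AAGInstance

variable {X : Type} {m n : ℕ}

/-- The public generators of both parties, as a tuple of elements of the free group. -/
def generators (p : AAGInstance X m n) : Fin m ⊕ Fin n → FreeGroup X :=
  Sum.elim (fun i => FreeGroup.mk (p.genA i)) (fun j => FreeGroup.mk (p.genB j))

variable [DecidableEq X]

/-- The normal forms (reduced words) of the conjugates `b_j ^ a = a⁻¹ b_j a`. -/
def conjB (p : AAGInstance X m n) (j : Fin n) : GroupWord X :=
  (p.a⁻¹ * FreeGroup.mk (p.genB j) * p.a).toWord

/-- The normal forms (reduced words) of the conjugates `a_i ^ b = b⁻¹ a_i b`. -/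
def conjA (p : AAGInstance X m n) (i : Fin m) : GroupWord X :=
  (p.b⁻¹ * FreeGroup.mk (p.genA i) * p.b).toWord

/-- The public data: the generators of Alice and of Bob, the conjugates of Bob's generators by
Alice's secret, and the conjugates of Alice's generators by Bob's secret. -/
def publicData (p : AAGInstance X m n) : List (AAGSymbol X) :=
  encodeTuple p.genA ++ encodeTuple p.genB ++ encodeTuple p.conjB ++ encodeTuple p.conjA

/-- The size of the public data. -/
def size (p : AAGInstance X m n) : ℕ := p.publicData.length

/-- The normal form of the shared secret key `[a, b] = a⁻¹ b⁻¹ a b = a⁻¹ a ^ b`. -/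
def key (p : AAGInstance X m n) : GroupWord X :=
  (p.a⁻¹ * p.b⁻¹ * p.a * p.b).toWord

end AAGInstance

/-! ### Turing machines -/

/-- The Turing machine `M` (with finitely many stacks; two stacks are a tape), started on the
string `input`, halts with output `output`. -/
def HaltsWith {Γ₀ Γ₁ : Type} (M : Turing.TM2ComputableAux Γ₀ Γ₁) (input : List Γ₀)
    (output : List Γ₁) : Prop :=
  Nonempty (Turing.TM2Outputs M.tm (input.map M.inputAlphabet.invFun)
    (some (output.map M.outputAlphabet.invFun)))

/-- The Turing machine `M`, started on the string `input`, halts with output `output` after at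
most `t` steps. -/
def HaltsWithin {Γ₀ Γ₁ : Type} (M : Turing.TM2ComputableAux Γ₀ Γ₁) (input : List Γ₀)
    (output : List Γ₁) (t : ℕ) : Prop :=
  Nonempty (Turing.TM2OutputsInTime M.tm (input.map M.inputAlphabet.invFun)
    (some (output.map M.outputAlphabet.invFun)) t)

/-! ### Exponentially generic sets of tuples -/

section Generic

variable {X : Type} [DecidableEq X] {ι : Type} [Fintype ι]

/-- The total length of a tuple of elements of the free group (lengths of reduced words). -/
def totalLength (T : ι → FreeGroup X) : ℕ := ∑ i, (T i).norm

/-- The maximal length of the components of a tuple of elements of the free group. -/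
def maxLength (T : ι → FreeGroup X) : ℕ := Finset.univ.sup fun i => (T i).norm

/-- The frequency of the set `M` in the ball of radius `r` for the size function `s`; for
finite `X` and for `s = totalLength` or `s = maxLength` the balls are finite and non-empty. -/
noncomputable def frequency (s : (ι → FreeGroup X) → ℕ) (M : Set (ι → FreeGroup X)) (r : ℕ) : ℝ :=
  ({T | s T ≤ r} ∩ M).ncard / {T | s T ≤ r}.ncard

/-- `M` has asymptotic density `1` for the size function `s`, with an exponential rate of
convergence. -/
def ExponentiallyGeneric (s : (ι → FreeGroup X) → ℕ) (M : Set (ι → FreeGroup X)) : Prop :=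
  Filter.Tendsto (frequency s M) Filter.atTop (nhds 1) ∧
    ∃ C q : ℝ, 0 < q ∧ q < 1 ∧ ∀ r : ℕ, |1 - frequency s M r| ≤ C * q ^ r

end Generic

/-! An element of a free group is determined by the conjugates it gives to two noncommuting
elements, and it can be read off from them in linear time. In the Cayley tree, let `u`, `v` not
commute. The ends `u v^∞`, `v^∞`, `v^{-∞}` are then distinct, so they have a median, the center of
the pair. The construction is equivariant: the center of `(x⁻¹ux, x⁻¹vx)` is `x⁻¹` times the center
of `(u, v)`, so one center times the inverse of the other is `x` (`isCenter_of_isCyclicallyReduced`,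
`center_mul_inv_center`). The center is a product of longest common prefixes of words with powers of
the core of `v` whose length is linear in that of `u` and `v`.

From each public tuple one keeps a nontrivial element `r₁` and an element `r₂` that does not commute
with it, if there are such, together with their conjugates (`IsSelection`). If both tuples have such
a pair, both secrets are recovered from centers. Otherwise one tuple, say Bob's, generates a
commutative group. The key is `(b^a)⁻¹ b`, so `b` and `b^a` suffice. If some selected element on
Alice's side fails to commute with Bob's `r₁`, then `b`, which fixes `r₁`, is recovered from the
action on this pair. If none does, transitivity of commutation makes the key trivial. In the first
situation `b^a` is still needed although `a` may not be determined: `b` lies in the centralizer of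
`r₁`, and `b` times a high power of the core is an initial segment of the infinite power of that
core; its conjugate is the segment of the same length for the conjugated core (`transport_eq`). The
case of a commutative group on Alice's side is symmetric (`eval_halfCode`, `eval_keyCode`).

Registers are stacks of letters with the beginning of the reduced word on top, so left
multiplication by a letter takes constant time. A fixed program made of these operations, without
further loops, takes linear time (`exists_runsIn_compile`). The selection makes `m + n` rounds of
cost `O(N)`, which gives `O((m + n + 1) N)`. As every word costs a separator, `m + n + 1 < N`, and
the bound is quadratic. For fixed `m`, `n` it is linear on every input, so the generic set may be
taken to be the set of all tuples. -/

/-! ### Reduced words and cancellation -/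

namespace FreeGroup

/-- Letters of the second list, as long as the corresponding letters satisfy `test`. -/
def zipTake {β : Type*} (test : β → β → Bool) : List β → List β → List β
  | a :: l, b :: m => if test a b then b :: zipTake test l m else []
  | _, _ => []

/-- The longest common prefix of two lists. -/
def lcp {β : Type*} [DecidableEq β] (l m : List β) : List β :=
  zipTake (fun a b => decide (a = b)) l m

theorem zipTake_true {β : Type*} (l m : List β) :
    zipTake (fun _ _ => true) l m = m.take l.length := by
  induction l generalizing m with
  | nil => simp [zipTake]
  | cons a l ih => cases m <;> simp [zipTake, ih]

section lcp

variable {β : Type*} [DecidableEq β]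

theorem lcp_append (q l m : List β) : lcp (q ++ l) (q ++ m) = q ++ lcp l m := by
  induction q with
  | nil => rfl
  | cons a q ih => simpa [lcp, zipTake] using ih

theorem lcp_cons_of_ne {a b : β} (h : a ≠ b) (l m : List β) : lcp (a :: l) (b :: m) = [] := by
  simp [lcp, zipTake, h]

theorem lcp_spec (l m : List β) :
    ∃ l' m', l = lcp l m ++ l' ∧ m = lcp l m ++ m' ∧
      (l' = [] ∨ m' = [] ∨ ∃ a b l'' m'', l' = a :: l'' ∧ m' = b :: m'' ∧ a ≠ b) := by
  induction l generalizing m with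
  | nil => exact ⟨[], m, by simp [lcp, zipTake]⟩
  | cons a l ih =>
    cases m with
    | nil => exact ⟨a :: l, [], by simp [lcp, zipTake]⟩
    | cons b m =>
      by_cases h : a = b
      · subst h
        obtain ⟨l', m', h1, h2, h3⟩ := ih m
        have e : lcp (a :: l) (a :: m) = a :: lcp l m := by simp [lcp, zipTake]
        refine ⟨l', m', ?_, ?_, h3⟩
        · rw [e, List.cons_append, ← h1]
        · rw [e, List.cons_append, ← h2]
      · refine ⟨a :: l, b :: m, ?_, ?_, Or.inr (Or.inr ⟨a, b, l, m, rfl, rfl, h⟩)⟩ <;>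
        rw [lcp_cons_of_ne h] <;> rfl

end lcp

variable {α : Type*}

/-- The inverse of a letter. -/
def invLetter (x : α × Bool) : α × Bool := (x.1, !x.2)

@[simp] theorem invLetter_invLetter (x : α × Bool) : invLetter (invLetter x) = x := by
  simp [invLetter]

theorem invRev_eq (L : List (α × Bool)) : invRev L = (L.map invLetter).reverse := rfl

theorem isReduced_append_cons {L M : List (α × Bool)} {x y : α × Bool}
    (h₁ : IsReduced (L ++ [x])) (h₂ : IsReduced (y :: M)) (h : y ≠ invLetter x) :
    IsReduced (L ++ [x] ++ y :: M) := by
  refine List.IsChain.append h₁ h₂ ?_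
  intro a ha b hb
  simp only [List.getLast?_append, List.getLast?_singleton, Option.some_or, Option.mem_def,
    Option.some.injEq, List.head?_cons] at ha hb
  subst ha hb
  intro h1
  by_contra h2
  exact h (Prod.ext h1.symm (by simpa [invLetter] using (Bool.eq_not_of_ne (Ne.symm h2))))

theorem ne_invLetter_of_isReduced {L M : List (α × Bool)} {x y : α × Bool}
    (h : IsReduced (L ++ x :: y :: M)) : y ≠ invLetter x := by
  rintro rfl
  have := h.infix (L₁ := [x, invLetter x]) ⟨L, M, by simp⟩
  simp [IsReduced, invLetter] at this

/-- Cancellation in a product of reduced words takes place only at the junction: strip matching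
pairs there until the two letters that meet are not inverse to each other. -/
theorem exists_cancel_of_isReduced (L₁ L₂ : List (α × Bool)) (h₁ : IsReduced L₁)
    (h₂ : IsReduced L₂) :
    ∃ p k s, L₁ = p ++ k ∧ L₂ = invRev k ++ s ∧ IsReduced (p ++ s) := by
  classical
  induction L₁ using List.reverseRecOn generalizing L₂ with
  | nil => exact ⟨[], [], L₂, rfl, rfl, h₂⟩
  | append_singleton L x ih =>
    cases L₂ with
    | nil => exact ⟨L ++ [x], [], [], by simp, rfl, by simpa using h₁⟩
    | cons y t =>
      by_cases hxy : y = invLetter x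
      · obtain ⟨p, k, s, e1, e2, e3⟩ := ih t (h₁.infix ⟨[], [x], by simp⟩)
          (h₂.infix ⟨[y], [], by simp⟩)
        refine ⟨p, k ++ [x], s, by simp [e1], ?_, e3⟩
        rw [invRev_append, hxy, e2]
        simp [invRev_eq]
      · exact ⟨L ++ [x], [], y :: t, by simp, rfl, isReduced_append_cons h₁ h₂ hxy⟩

theorem mk_append (L M : List (α × Bool)) :
    FreeGroup.mk (L ++ M) = FreeGroup.mk L * FreeGroup.mk M := (mul_mk).symm

theorem mk_invRev (L : List (α × Bool)) : FreeGroup.mk (invRev L) = (FreeGroup.mk L)⁻¹ :=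
  inv_mk.symm

variable [DecidableEq α]

theorem toWord_mk_of_isReduced {L : List (α × Bool)} (h : IsReduced L) :
    (FreeGroup.mk L).toWord = L := h.reduce_eq

theorem isReduced_invRev {L : List (α × Bool)} (h : IsReduced L) : IsReduced (invRev L) := by
  rw [isReduced_iff_reduce_eq, reduce_invRev, h.reduce_eq]

theorem exists_cancel (g h : FreeGroup α) :
    ∃ p k s, g.toWord = p ++ k ∧ h.toWord = invRev k ++ s ∧ (g * h).toWord = p ++ s := by
  obtain ⟨p, k, s, e1, e2, e3⟩ :=
    exists_cancel_of_isReduced g.toWord h.toWord isReduced_toWord isReduced_toWord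
  refine ⟨p, k, s, e1, e2, ?_⟩
  rw [← toWord_mk_of_isReduced e3, ← mk_toWord (x := g), ← mk_toWord (x := h), e1, e2]
  simp only [mk_append, mk_invRev]
  congr 1
  group

/-! ### Medians in the Cayley tree -/

/-- The point `P` lies on the geodesic from `a` to `b`. -/
def Between (a P b : FreeGroup α) : Prop :=
  (a⁻¹ * b).norm = (a⁻¹ * P).norm + (P⁻¹ * b).norm

/-- The point `P` is the median of `a`, `b` and `c`. -/
def IsMedian (P a b c : FreeGroup α) : Prop := Between a P b ∧ Between a P c ∧ Between b P c

theorem Between.mul_left {a P b : FreeGroup α} (h : Between a P b) (x : FreeGroup α) :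
    Between (x * a) (x * P) (x * b) := by
  simpa [Between, mul_assoc] using h

theorem IsMedian.mul_left {P a b c : FreeGroup α} (h : IsMedian P a b c) (x : FreeGroup α) :
    IsMedian (x * P) (x * a) (x * b) (x * c) :=
  ⟨h.1.mul_left x, h.2.1.mul_left x, h.2.2.mul_left x⟩

/-- The geodesics from `1` to `a` and to `b` leave `1` along different edges, so the concatenated
word of `a⁻¹` and `b` is already reduced. -/
theorem norm_inv_mul_of_head_ne {a b : FreeGroup α}
    (h : ∀ x ∈ a.toWord.head?, ∀ y ∈ b.toWord.head?, x ≠ y) :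
    (a⁻¹ * b).norm = a.norm + b.norm := by
  have hr : IsReduced (a⁻¹.toWord ++ b.toWord) := by
    rw [toWord_inv]
    cases ha : a.toWord with
    | nil => simpa using isReduced_toWord
    | cons x l =>
      cases hb : b.toWord with
      | nil => simpa using isReduced_invRev (ha ▸ isReduced_toWord)
      | cons y m =>
        have := isReduced_invRev (ha ▸ isReduced_toWord (x := a))
        rw [invRev_eq, List.map_cons, List.reverse_cons] at this ⊢
        refine isReduced_append_cons this (hb ▸ isReduced_toWord) ?_
        rw [invLetter_invLetter]
        exact (h x (by simp [ha]) y (by simp [hb])).symm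
  have : (a⁻¹ * b).toWord = a⁻¹.toWord ++ b.toWord := by
    rw [toWord_mul, hr.reduce_eq]
  simp [norm, this]

/-- Points reached by words that diverge after the prefix `l` have every point between them
that lies on the first word after `l`. -/
theorem between_of_words {a b P : FreeGroup α} {l u v w : List (α × Bool)}
    (ha : a.toWord = l ++ (u ++ v)) (hb : b.toWord = l ++ w) (hP : P.toWord = l ++ u)
    (h : ∀ x ∈ (u ++ v).head?, ∀ y ∈ w.head?, x ≠ y) : Between a P b := by
  have red : ∀ {g : FreeGroup α} {r : List (α × Bool)}, g.toWord = l ++ r → IsReduced r :=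
    fun e => (e ▸ isReduced_toWord).infix ⟨l, [], by simp⟩
  have hv : IsReduced v := (red ha).infix ⟨u, [], by simp⟩
  have e : ∀ {g : FreeGroup α} {r : List (α × Bool)}, g.toWord = l ++ r →
      g = FreeGroup.mk l * FreeGroup.mk r := fun e => by rw [← mk_append, ← e, mk_toWord]
  have h1 : (a⁻¹ * b).norm = (u ++ v).length + w.length := by
    rw [e ha, e hb]
    have : (FreeGroup.mk l * FreeGroup.mk (u ++ v))⁻¹ * (FreeGroup.mk l * FreeGroup.mk w) =
      (FreeGroup.mk (u ++ v))⁻¹ * FreeGroup.mk w := by group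
    rw [this, norm_inv_mul_of_head_ne]
    · rw [norm, norm, toWord_mk_of_isReduced (red ha), toWord_mk_of_isReduced (red hb)]
    · rwa [toWord_mk_of_isReduced (red ha), toWord_mk_of_isReduced (red hb)]
  have h2 : (a⁻¹ * P).norm = v.length := by
    rw [e ha, e hP, mk_append]
    have : (FreeGroup.mk l * (FreeGroup.mk u * FreeGroup.mk v))⁻¹ *
      (FreeGroup.mk l * FreeGroup.mk u) = (FreeGroup.mk v)⁻¹ := by group
    rw [this, norm_inv_eq, norm, toWord_mk_of_isReduced hv]
  have h3 : (P⁻¹ * b).norm = u.length + w.length := by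
    rw [e hP, e hb]
    have : (FreeGroup.mk l * FreeGroup.mk u)⁻¹ * (FreeGroup.mk l * FreeGroup.mk w) =
      (FreeGroup.mk u)⁻¹ * FreeGroup.mk w := by group
    rw [this, norm_inv_mul_of_head_ne]
    · rw [norm, norm, toWord_mk_of_isReduced (red hP), toWord_mk_of_isReduced (red hb)]
    · rw [toWord_mk_of_isReduced (red hP), toWord_mk_of_isReduced (red hb)]
      intro x hx
      apply h x
      cases u <;> simp_all
  rw [Between, h1, h2, h3, List.length_append]
  omega

theorem Between.symm {a P b : FreeGroup α} (h : Between a P b) : Between b P a := by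
  have e : ∀ x y : FreeGroup α, (x⁻¹ * y).norm = (y⁻¹ * x).norm := fun x y => by
    rw [← norm_inv_eq]; simp
  rw [Between, e b a, h, e a P, e P b, add_comm]

/-- A common first letter could be dropped from both words, giving a path from `a` to `b` that is
shorter by two and avoids `1`. -/
theorem Between.head_ne {a b : FreeGroup α} (h : Between a 1 b) :
    ∀ x ∈ a.toWord.head?, ∀ y ∈ b.toWord.head?, x ≠ y := by
  rintro x hx _ hy rfl
  have ha : a.toWord = x :: a.toWord.tail := (List.cons_head?_tail hx).symm
  have hb : b.toWord = x :: b.toWord.tail := (List.cons_head?_tail hy).symm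
  have e : a⁻¹ * b = (FreeGroup.mk a.toWord.tail)⁻¹ * FreeGroup.mk b.toWord.tail := by
    conv_lhs => rw [← mk_toWord (x := a), ← mk_toWord (x := b), ha, hb]
    rw [← List.singleton_append, mk_append, ← List.singleton_append (l := b.toWord.tail),
      mk_append]
    group
  have h1 : (a⁻¹ * b).norm ≤ a.toWord.tail.length + b.toWord.tail.length := by
    rw [e]
    refine (norm_mul_le _ _).trans ?_
    rw [norm_inv_eq]
    exact add_le_add norm_mk_le norm_mk_le
  have h2 := congrArg List.length ha
  have h3 := congrArg List.length hb
  simp only [Between, mul_one, norm_inv_eq, inv_one, one_mul] at h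
  simp only [norm, List.length_cons] at h h1 h2 h3
  omega

/-- Translate so that `P = 1`, and let `q` be the first letter of `Q ≠ 1`. Of two points with `1`
between them at most one starts with `q`, so two of the three points do not start with `q`. Passing
from one of these two to the other through `Q` is a detour of length `2|Q|`. -/
theorem IsMedian.eq {P Q a b c : FreeGroup α} (hP : IsMedian P a b c) (hQ : IsMedian Q a b c) :
    P = Q := by
  wlog h : P = 1 generalizing P Q a b c
  · have := this (hP.mul_left P⁻¹) (hQ.mul_left P⁻¹) (by simp)
    exact mul_left_cancel this
  subst h
  by_contra hne
  have hw : Q.toWord ≠ [] := fun h => hne (toWord_eq_nil_iff.1 h).symm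
  obtain ⟨q, w, hq⟩ := List.exists_cons_of_ne_nil hw
  have key : ∀ {a b : FreeGroup α}, Between a 1 b → Between a Q b →
      (∀ x ∈ a.toWord.head?, x ≠ q) → (∀ x ∈ b.toWord.head?, x ≠ q) → False := by
    intro a b h1 h2 ha hb
    have e1 : (a⁻¹ * Q).norm = a.norm + Q.norm := norm_inv_mul_of_head_ne (by simpa [hq] using ha)
    have e2 : (b⁻¹ * Q).norm = b.norm + Q.norm := norm_inv_mul_of_head_ne (by simpa [hq] using hb)
    have e3 : (Q⁻¹ * b).norm = (b⁻¹ * Q).norm := by rw [← norm_inv_eq]; simp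
    simp only [Between, mul_one, norm_inv_eq, inv_one, one_mul] at h1 h2
    have : Q.norm ≠ 0 := by simpa [norm] using hne ∘ Eq.symm
    omega
  have dich : ∀ {a b : FreeGroup α}, Between a 1 b →
      (∀ x ∈ a.toWord.head?, x ≠ q) ∨ (∀ x ∈ b.toWord.head?, x ≠ q) := by
    intro a b h
    by_contra! hc
    obtain ⟨⟨x, hx, rfl⟩, y, hy, rfl⟩ := hc
    exact Between.head_ne h _ hx _ hy rfl
  rcases dich hP.1 with h1 | h1
  · rcases dich hP.2.2 with h2 | h2
    · exact key hP.1 hQ.1 h1 h2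
    · exact key hP.2.1 hQ.2.1 h1 h2
  · rcases dich hP.2.1 with h2 | h2
    · exact key hP.1 hQ.1 h2 h1
    · exact key hP.2.2 hQ.2.2 h1 h2

end FreeGroup

/-! ### Cyclically reduced words and commuting elements -/

namespace FreeGroup

section CyclePow

variable {β : Type*}

/-- The `n`-fold repetition of a list. -/
def cyclePow (C : List β) (n : ℕ) : List β := (List.replicate n C).flatten

@[simp] theorem cyclePow_zero (C : List β) : cyclePow C 0 = [] := rfl

theorem cyclePow_succ (C : List β) (n : ℕ) : cyclePow C (n + 1) = C ++ cyclePow C n := by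
  simp [cyclePow, List.replicate_succ]

@[simp] theorem length_cyclePow (C : List β) (n : ℕ) : (cyclePow C n).length = n * C.length := by
  simp [cyclePow]

theorem cyclePow_add (C : List β) (m n : ℕ) :
    cyclePow C (m + n) = cyclePow C m ++ cyclePow C n := by
  rw [cyclePow, List.replicate_add, List.flatten_append]; rfl

theorem append_cyclePow {C p : List β} (h : p ++ C = C ++ p) (n : ℕ) :
    p ++ cyclePow C n = cyclePow C n ++ p := by
  induction n with
  | zero => simp
  | succ n ih => rw [cyclePow_succ, ← List.append_assoc, h, List.append_assoc, ih,
      List.append_assoc]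

theorem cyclePow_append_self (C : List β) (n : ℕ) : C ++ cyclePow C n = cyclePow C n ++ C :=
  append_cyclePow rfl n

/-- Periodicity: both sides are prefixes of a larger power of `C` and have the same length. -/
theorem append_eq_of_isPrefix_cyclePow {C p w : List β} {M : ℕ} (h : p ++ w <+: cyclePow C M)
    (hw : w.length = C.length) : p ++ w = C ++ p := by
  have h1 : p ++ w <+: cyclePow C (M + 1) := by
    rw [cyclePow_succ, cyclePow_append_self]
    exact h.trans (List.prefix_append _ _)
  have h2 : C ++ p <+: cyclePow C (M + 1) := by
    rw [cyclePow_succ, List.prefix_append_right_inj]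
    exact (List.prefix_append _ _).trans h
  have h3 : (p ++ w).length = (C ++ p).length := by simp [hw, add_comm]
  exact (List.prefix_of_prefix_length_le h1 h2 h3.le).eq_of_length h3

theorem isPrefix_cyclePow {C p : List β} (h : p ++ C = C ++ p) {n : ℕ}
    (hn : p.length ≤ n * C.length) : p <+: cyclePow C n := by
  refine List.prefix_of_prefix_length_le (l₃ := p ++ cyclePow C n) (List.prefix_append _ _) ?_
    (by simpa using hn)
  rw [append_cyclePow h]
  exact List.prefix_append _ _

theorem append_comm_append {C p q : List β} (hp : p ++ C = C ++ p) (hq : q ++ C = C ++ q) :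
    (p ++ q) ++ C = C ++ (p ++ q) := by
  rw [List.append_assoc, hq, ← List.append_assoc, hp, List.append_assoc]

theorem cyclePow_append_comm {C p : List β} (hp : p ++ C = C ++ p) (n : ℕ) :
    cyclePow p n ++ C = C ++ cyclePow p n := (append_cyclePow hp.symm n).symm

/-- Words that commute with `C` are prefixes of the infinite power of `C`, hence determined by their
length. -/
theorem eq_of_append_comm {C p q : List β} (hC : C ≠ []) (hp : p ++ C = C ++ p)
    (hq : q ++ C = C ++ q) (h : p.length = q.length) : p = q := by
  have hl : 1 ≤ C.length := List.length_pos_iff.2 hC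
  have h1 := isPrefix_cyclePow hp (n := p.length) (Nat.le_mul_of_pos_right _ hl)
  have h2 := isPrefix_cyclePow hq (n := p.length) (h ▸ Nat.le_mul_of_pos_right _ hl)
  exact (List.prefix_of_prefix_length_le h1 h2 h.le).eq_of_length h

end CyclePow

variable {α : Type*} [DecidableEq α]

/-- Multiplication by `h` on the right cancels at most the last `|h|` letters of `g`. -/
theorem isPrefix_toWord_mul {g h : FreeGroup α} {q : List (α × Bool)} (hq : q <+: g.toWord)
    (hl : q.length + h.norm ≤ g.norm) : q <+: (g * h).toWord := by
  obtain ⟨p, k, s, e1, e2, e3⟩ := exists_cancel g h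
  rw [e3]
  refine List.IsPrefix.trans ?_ (List.prefix_append _ _)
  refine List.prefix_of_prefix_length_le (l₃ := g.toWord) hq (e1 ▸ List.prefix_append _ _) ?_
  simp only [norm, e1, e2, List.length_append, invRev_length] at hl
  omega

/-! ### Powers of cyclically reduced elements and their centralizers. -/

theorem toWord_pow_eq {c : FreeGroup α} (hc : IsCyclicallyReduced c.toWord) (n : ℕ) :
    (c ^ n).toWord = cyclePow c.toWord n := by
  rw [toWord_pow]
  exact (hc.flatten_replicate n).isReduced.reduce_eq

theorem norm_pow_eq {c : FreeGroup α} (hc : IsCyclicallyReduced c.toWord) (n : ℕ) :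
    (c ^ n).norm = n * c.norm := by
  rw [norm, toWord_pow_eq hc, length_cyclePow, norm]

omit [DecidableEq α] in
theorem isCyclicallyReduced_iff_append {L : List (α × Bool)} :
    IsCyclicallyReduced L ↔ IsReduced (L ++ L) := by
  rw [isCyclicallyReduced_iff, IsReduced, IsReduced, List.isChain_append]
  simp

theorem IsCyclicallyReduced.inv {c : FreeGroup α} (hc : IsCyclicallyReduced c.toWord) :
    IsCyclicallyReduced c⁻¹.toWord := by
  rw [isCyclicallyReduced_iff_append] at hc ⊢
  rw [toWord_inv, ← invRev_append]
  exact isReduced_invRev hc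

/-- If the word of `g * c ^ N` has a long prefix in common with a power of `c'`, then `g`
conjugates `c` to `c'`. -/
theorem exists_conj_words {g c c' : FreeGroup α} {u : List (α × Bool)} {N M : ℕ}
    (hc : IsCyclicallyReduced c.toWord) (hn : c'.norm = c.norm)
    (h1 : u <+: (g * c ^ N).toWord) (h2 : u <+: cyclePow c'.toWord M)
    (hu : g.norm + c.norm ≤ u.length) (hN : g.norm + c.norm ≤ N * c.norm) :
    ∃ p k w, g.toWord = p ++ invRev k ∧ p ++ w = c'.toWord ++ p ∧ k ++ w = c.toWord ++ k ∧
      w.length = c.norm := by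
  obtain ⟨p, k, s, e1, e2, e3⟩ := exists_cancel g (c ^ N)
  rw [toWord_pow_eq hc] at e2
  have l1 := congrArg List.length e1
  have l2 := congrArg List.length e2
  simp only [List.length_append, invRev_length, length_cyclePow] at l1 l2
  simp only [norm] at hn hu hN ⊢
  have hw : (s.take c.toWord.length).length = c.toWord.length := by
    rw [List.length_take]; omega
  -- `w` is the first period of `s`. It continues the cancelled part inside the power of `c` and
  -- continues `p` inside the power of `c'`.
  refine ⟨p, invRev k, s.take c.toWord.length, by simpa using e1, ?_, ?_, hw⟩
  · refine append_eq_of_isPrefix_cyclePow (M := M) ?_ (hw.trans hn.symm)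
    refine List.IsPrefix.trans (List.prefix_of_prefix_length_le (l₃ := p ++ s) ?_ (e3 ▸ h1) ?_) h2
    · exact (List.prefix_append_right_inj p).2 (List.take_prefix _ _)
    · rw [List.length_append, hw]; omega
  · refine append_eq_of_isPrefix_cyclePow (M := N) ?_ hw
    rw [e2]
    exact (List.prefix_append_right_inj _).2 (List.take_prefix _ _)

/-- With the words of `exists_conj_words`, `g = p k⁻¹`, `c = k w k⁻¹` and `c' = p w p⁻¹`. This is
the finite form of the fact that `g c^∞ = c'^∞` forces `g c g⁻¹ = c'` when `c` and `c'` have the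
same length. -/
theorem mul_eq_mul_of_isPrefix {g c c' : FreeGroup α} {u : List (α × Bool)} {N M : ℕ}
    (hc : IsCyclicallyReduced c.toWord) (hn : c'.norm = c.norm)
    (h1 : u <+: (g * c ^ N).toWord) (h2 : u <+: cyclePow c'.toWord M)
    (hu : g.norm + c.norm ≤ u.length) (hN : g.norm + c.norm ≤ N * c.norm) : g * c = c' * g := by
  obtain ⟨p, k, w, e1, e2, e3, -⟩ := exists_conj_words hc hn h1 h2 hu hN
  have e1' := congrArg FreeGroup.mk e1
  have e2' := congrArg FreeGroup.mk e2
  have e3' := congrArg FreeGroup.mk e3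
  simp only [mk_append, mk_invRev, mk_toWord] at e1' e2' e3'
  rw [e1', mul_assoc, ← mul_assoc c', ← e2', mul_assoc]
  congr 1
  rw [inv_mul_eq_iff_eq_mul, ← mul_assoc, e3']
  group

theorem norm_pos {g : FreeGroup α} (h : g ≠ 1) : 1 ≤ g.norm :=
  Nat.one_le_iff_ne_zero.2 fun h' => h (norm_eq_zero.1 h')

/-- An element that commutes with a cyclically reduced element, or its inverse, has a word
commuting with its word. -/
theorem append_comm_or_of_commute {g c : FreeGroup α} (hc : IsCyclicallyReduced c.toWord)
    (hc1 : c ≠ 1) (h : Commute g c) :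
    g.toWord ++ c.toWord = c.toWord ++ g.toWord ∨
      g⁻¹.toWord ++ c.toWord = c.toWord ++ g⁻¹.toWord := by
  have hpos := norm_pos hc1
  have a1 : g.norm ≤ g.norm * c.norm := Nat.le_mul_of_pos_right _ hpos
  -- As `g c^N = c^N g`, only the last `|g|` letters of the power can be lost. With `N = 2|g| + 1`
  -- at least `|g| + 1` periods survive, of length at least `|g| + |c|`.
  obtain ⟨p, k, w, e1, e2, e3, e4⟩ := exists_conj_words (g := g) (c := c) (c' := c)
    (u := cyclePow c.toWord (g.norm + 1)) (N := 2 * g.norm + 1) (M := g.norm + 1) hc rfl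
    (by
      rw [(h.pow_right _).eq]
      refine isPrefix_toWord_mul ?_ ?_
      · rw [toWord_pow_eq hc, show 2 * g.norm + 1 = g.norm + 1 + g.norm by ring,
          cyclePow_add _ (g.norm + 1)]
        exact List.prefix_append _ _
      · rw [length_cyclePow, norm_pow_eq hc]
        change (g.norm + 1) * c.norm + g.norm ≤ _
        nlinarith)
    List.prefix_rfl
    (by
      rw [length_cyclePow]
      change _ ≤ (g.norm + 1) * c.norm
      nlinarith)
    (by nlinarith)
  rcases List.eq_nil_or_concat k with rfl | ⟨k, x, rfl⟩
  · left
    simp only [List.nil_append, List.append_nil, invRev_empty] at e1 e3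
    rw [e1, ← e2, e3]
  rcases List.eq_nil_or_concat p with rfl | ⟨p, y, rfl⟩
  · right
    simp only [List.nil_append, List.append_nil] at e1 e2
    rw [toWord_inv, e1, invRev_invRev, ← e3, e2]
  -- If `p` and `k` were both nonempty, both would end with the last letter of `w`, and `p k⁻¹`
  -- would not be reduced.
  · exfalso
    have hw : w ≠ [] := by rintro rfl; simp at e4; omega
    rw [List.concat_eq_append] at e1 e2
    rw [List.concat_eq_append] at e1 e3
    have t2 := congrArg List.getLast? e2
    have t3 := congrArg List.getLast? e3
    rw [← List.append_assoc, List.getLast?_append_of_ne_nil _ hw, List.getLast?_concat] at t2 t3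
    have hxy : x = y := Option.some_injective _ (t3.symm.trans t2)
    subst hxy
    have hr := e1 ▸ isReduced_toWord (x := g)
    rw [invRev_append] at hr
    refine ne_invLetter_of_isReduced (L := p) (M := invRev k) (x := x) (y := invLetter x) ?_ rfl
    simpa [invRev_eq] using hr

theorem isReduced_of_append_comm {c : FreeGroup α} {p : List (α × Bool)}
    (hc : IsCyclicallyReduced c.toWord) (hc1 : c ≠ 1)
    (h : p ++ c.toWord = c.toWord ++ p) : IsReduced p := by
  have := isPrefix_cyclePow h (n := p.length) (Nat.le_mul_of_pos_right _ (norm_pos hc1))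
  exact (hc.flatten_replicate _).isReduced.infix this.isInfix

/-- Up to inversion the word of `g` commutes with that of `c`. Its repetitions are then prefixes of
powers of `c`, so they are reduced. -/
theorem norm_pow_of_commute {g c : FreeGroup α} (hc : IsCyclicallyReduced c.toWord)
    (hc1 : c ≠ 1) (h : Commute g c) (n : ℕ) : (g ^ n).norm = n * g.norm := by
  have key : ∀ g : FreeGroup α, g.toWord ++ c.toWord = c.toWord ++ g.toWord →
      (g ^ n).norm = n * g.norm := by
    intro g hg
    rw [norm, toWord_pow]
    have := isReduced_of_append_comm hc hc1 (cyclePow_append_comm hg n)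
    rw [cyclePow] at this
    rw [this.reduce_eq]
    exact length_cyclePow _ _
  rcases append_comm_or_of_commute hc hc1 h with h | h
  · exact key g h
  · rw [← norm_inv_eq, ← inv_pow, key _ h, norm_inv_eq]

/-- Elements commuting with cyclically reduced elements are shortest in their conjugacy class. -/
theorem norm_le_of_conj {c c' d y : FreeGroup α} (hc : IsCyclicallyReduced c.toWord)
    (hc1 : c ≠ 1) (hc' : IsCyclicallyReduced c'.toWord) (hc1' : c' ≠ 1) (hd : Commute d c)
    (he : Commute (y⁻¹ * d * y) c') : (y⁻¹ * d * y).norm ≤ d.norm := by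
  by_contra! hlt
  -- Conjugation by `y` adds at most `2|y|` to the length of any power, while a difference of
  -- lengths grows with the exponent; `2|y| + 1` is enough.
  have h1 := norm_pow_of_commute hc' hc1' he (2 * y.norm + 1)
  have h2 := norm_pow_of_commute hc hc1 hd (2 * y.norm + 1)
  have e : (y⁻¹ * d * y) ^ (2 * y.norm + 1) = y⁻¹ * d ^ (2 * y.norm + 1) * y := by
    have := conj_pow (i := 2 * y.norm + 1) (a := y⁻¹) (b := d)
    simpa using this
  have h3 : (y⁻¹ * d ^ (2 * y.norm + 1) * y).norm ≤
      y.norm + (d ^ (2 * y.norm + 1)).norm + y.norm := by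
    refine (norm_mul_le _ _).trans (Nat.add_le_add_right ?_ _)
    refine (norm_mul_le _ _).trans (Nat.add_le_add_right ?_ _)
    rw [norm_inv_eq]
  rw [← e, h1, h2] at h3
  nlinarith

/-! ### The cyclically reduced core of an element -/

/-- The longest common prefix of the words of two elements. -/
def gcp (g h : FreeGroup α) : FreeGroup α := FreeGroup.mk (lcp g.toWord h.toWord)

/-- The conjugating prefix of an element. -/
def hd (g : FreeGroup α) : FreeGroup α := gcp g g⁻¹

/-- The cyclically reduced core of an element. -/
def core (g : FreeGroup α) : FreeGroup α := (hd g)⁻¹ * g * hd g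

@[simp] theorem core_one : core (1 : FreeGroup α) = 1 := by simp [core]

theorem core_eq_one_iff {g : FreeGroup α} : core g = 1 ↔ g = 1 := by
  constructor
  · intro h
    have : g = hd g * core g * (hd g)⁻¹ := by rw [core]; group
    rw [this, h]; group
  · rintro rfl; simp

/-- Write `g = q r q⁻¹` as a reduced word with `r` cyclically reduced, so that `g⁻¹ = q r⁻¹ q⁻¹`.
For nonempty `r` the first letters of `r` and `r⁻¹` differ, and the common prefix of `g` and `g⁻¹`
is exactly `q`. This replaces the search for `q` by one comparison of two words. -/
theorem isCyclicallyReduced_core (g : FreeGroup α) : IsCyclicallyReduced (core g).toWord := by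
  have hL := reduceCyclically.conj_conjugator_reduceCyclically g.toWord
  have hr := reduceCyclically.isCyclicallyReduced (isReduced_toWord (x := g))
  generalize reduceCyclically.conjugator g.toWord = q at hL
  generalize reduceCyclically g.toWord = r at hL hr
  have hcore : hd g = FreeGroup.mk q ∨ g = 1 := by
    rcases eq_or_ne r [] with rfl | hne
    · right
      rw [← mk_toWord (x := g), ← hL]
      rw [mk_append, mk_invRev, List.append_nil, mul_inv_cancel]
    left
    rw [hd, gcp, toWord_inv, ← hL, invRev_append, invRev_append, invRev_invRev,
      List.append_assoc, lcp_append]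
    obtain ⟨r', x, rfl⟩ := (List.eq_nil_or_concat r).resolve_left hne
    rw [List.concat_eq_append] at *
    have e : invRev (r' ++ [x]) = invLetter x :: invRev r' := by simp [invRev_eq]
    rw [e]
    cases hrr : r' ++ [x] with
    | nil => simp at hrr
    | cons y t =>
      rw [List.cons_append, List.cons_append, lcp_cons_of_ne, List.append_nil]
      rintro rfl
      have := hr.2 x (by simp) (invLetter x) (by simp [hrr]) rfl
      simp [invLetter] at this
  rcases hcore with h | rfl
  · have : core g = FreeGroup.mk r := by
      rw [core, h]
      conv_lhs => rw [← mk_toWord (x := g), ← hL]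
      simp only [mk_append, mk_invRev]
      group
    rw [this, toWord_mk_of_isReduced hr.isReduced]
    exact hr
  · simp

/-! ### Transitivity of commutation. -/

omit [DecidableEq α] in
theorem commute_conj {g h : FreeGroup α} (x : FreeGroup α) (hgh : Commute g h) :
    Commute (x⁻¹ * g * x) (x⁻¹ * h * x) := by
  have := hgh.eq
  rw [commute_iff_eq]
  calc x⁻¹ * g * x * (x⁻¹ * h * x) = x⁻¹ * (g * h) * x := by group
    _ = x⁻¹ * (h * g) * x := by rw [this]
    _ = _ := by group

omit [DecidableEq α] in
theorem commute_of_commute_conj {g h : FreeGroup α} (x : FreeGroup α)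
    (hgh : Commute (x⁻¹ * g * x) (x⁻¹ * h * x)) : Commute g h := by
  have := commute_conj x⁻¹ hgh
  simpa [mul_assoc] using this

/-- Commutativity is transitive on the nontrivial elements of a free group. -/
theorem commute_trans {g h c : FreeGroup α} (hc1 : c ≠ 1) (hg : Commute g c) (hh : Commute h c) :
    Commute g h := by
  wlog hc : IsCyclicallyReduced c.toWord generalizing g h c
  · refine commute_of_commute_conj (hd c) ?_
    exact this (c := core c) (fun h => hc1 (core_eq_one_iff.1 h)) (commute_conj _ hg)
      (commute_conj _ hh) (isCyclicallyReduced_core c)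
  have hC : c.toWord ≠ [] := fun h => hc1 (toWord_eq_nil_iff.1 h)
  have key : ∀ g h : FreeGroup α, g.toWord ++ c.toWord = c.toWord ++ g.toWord →
      h.toWord ++ c.toWord = c.toWord ++ h.toWord → Commute g h := by
    intro g h hg hh
    -- Both orders of the product commute with the word of `c` and have the same length.
    have := eq_of_append_comm hC (append_comm_append hg hh) (append_comm_append hh hg)
      (by simp [add_comm])
    have := congrArg FreeGroup.mk this
    rwa [mk_append, mk_append, mk_toWord, mk_toWord] at this
  rcases append_comm_or_of_commute hc hc1 hg with h1 | h1 <;>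
  rcases append_comm_or_of_commute hc hc1 hh with h2 | h2
  · exact key _ _ h1 h2
  · exact Commute.inv_right_iff.1 (key _ _ h1 h2)
  · exact Commute.inv_left_iff.1 (key _ _ h1 h2)
  · exact Commute.inv_left_iff.1 (Commute.inv_right_iff.1 (key _ _ h1 h2))

omit [DecidableEq α] in
theorem eq_one_of_sq_eq_one {g : FreeGroup α} (h : g * g = 1) : g = 1 := by
  have := pow_left_injective (M := FreeGroup α) (n := 2) two_ne_zero
  exact this (by simpa [sq] using h)

/-- `g²` commutes with `c` and with `g`. By transitivity `g` commutes with `c`, unless `g² = 1`,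
which means `g = 1`; in either case `c = c⁻¹`, and there is no torsion. It keeps the ends `g c^∞`
and `c^{-∞}` apart. -/
theorem eq_one_of_conj_eq_inv {g c : FreeGroup α} (h : g * c = c⁻¹ * g) : c = 1 := by
  have hcomm : Commute c g → c = 1 := by
    intro hc
    refine eq_one_of_sq_eq_one ?_
    have : c * g = c⁻¹ * g := hc.eq.trans h
    have := mul_right_cancel this
    nth_rewrite 1 [this]
    simp
  by_cases hg : g * g = 1
  · rw [eq_one_of_sq_eq_one hg] at h hcomm
    exact hcomm (Commute.one_right c)
  · refine hcomm (commute_trans (c := g * g) hg ?_ ?_)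
    · have h' : g * c⁻¹ = c * g := by
        rw [mul_inv_eq_iff_eq_mul, mul_assoc, h]; group
      rw [commute_iff_eq, ← mul_assoc, ← h', mul_assoc g g c, h]
      group
    · exact (Commute.refl g).mul_right (Commute.refl g)

end FreeGroup

/-! ### The center of a noncommuting pair -/

namespace FreeGroup

variable {α : Type*} [DecidableEq α]

/-- The point `P` is the median of the three ends `u v^∞`, `v^∞`, `v^{-∞}` of the Cayley tree. -/
def IsCenter (P u v : FreeGroup α) : Prop :=
  ∀ y : FreeGroup α, ∃ n₀ : ℕ, ∀ n, n₀ ≤ n →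
    IsMedian P (u * v ^ n * y) (v ^ n * y) (v⁻¹ ^ n * y)

theorem IsCenter.eq {P Q u v : FreeGroup α} (hP : IsCenter P u v) (hQ : IsCenter Q u v) :
    P = Q := by
  obtain ⟨m, hm⟩ := hP 1
  obtain ⟨n, hn⟩ := hQ 1
  exact (hm _ (le_max_left m n)).eq (hn _ (le_max_right m n))

/-- Powers of `x v x⁻¹` are translates by `x` of powers of `v` with a trailing `x⁻¹`. The arbitrary
right factor `y` in `IsCenter` absorbs it. -/
theorem IsCenter.conj {P u v : FreeGroup α} (h : IsCenter P u v) (x : FreeGroup α) :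
    IsCenter (x * P) (x * u * x⁻¹) (x * v * x⁻¹) := by
  intro y
  obtain ⟨n, hn⟩ := h (x⁻¹ * y)
  refine ⟨n, fun m hm => ?_⟩
  have := (hn m hm).mul_left x
  rw [conj_pow, show (x * v * x⁻¹)⁻¹ = x * v⁻¹ * x⁻¹ by group, conj_pow]
  convert this using 1 <;> group

/-- `A`, `B`, `C` are prefixes long enough to show where the three words diverge. As `B` and `C`
differ at the first letter, `A` can agree there with only one of them. One of the two common
prefixes is therefore empty, and the product is the other, the branching point of the tripod. -/
theorem isMedian_of_words {a b c : FreeGroup α} {A B C ra rb rc : List (α × Bool)}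
    (ha : a.toWord = A ++ ra) (hb : b.toWord = B ++ rb) (hc : c.toWord = C ++ rc)
    {x₁ y₁ x₂ y₂ x₃ y₃ : α × Bool} {A₁ B₁ A₂ C₂ B₃ C₃ : List (α × Bool)}
    (h1 : A = lcp A B ++ x₁ :: A₁) (h1' : B = lcp A B ++ y₁ :: B₁) (hn1 : x₁ ≠ y₁)
    (h2 : A = lcp A C ++ x₂ :: A₂) (h2' : C = lcp A C ++ y₂ :: C₂) (hn2 : x₂ ≠ y₂)
    (h3 : B = x₃ :: B₃) (h3' : C = y₃ :: C₃) (hn3 : x₃ ≠ y₃) :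
    IsMedian (FreeGroup.mk (lcp A B) * FreeGroup.mk (lcp A C)) a b c := by
  generalize lcp A B = l₁ at *
  generalize lcp A C = l₂ at *
  have hA : IsReduced A := (ha ▸ isReduced_toWord).infix ⟨[], ra, by simp⟩
  have hl1 : (FreeGroup.mk l₁).toWord = l₁ :=
    toWord_mk_of_isReduced (hA.infix ⟨[], x₁ :: A₁, h1.symm⟩)
  have hl2 : (FreeGroup.mk l₂).toWord = l₂ :=
    toWord_mk_of_isReduced (hA.infix ⟨[], x₂ :: A₂, h2.symm⟩)
  have hh : l₁ = [] ∨ l₂ = [] := by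
    by_contra! hcon
    obtain ⟨z, l₁, rfl⟩ := List.exists_cons_of_ne_nil hcon.1
    obtain ⟨w, l₂, rfl⟩ := List.exists_cons_of_ne_nil hcon.2
    simp only [List.cons_append] at h1 h1' h2 h2'
    rw [h1] at h2
    rw [h1'] at h3
    rw [h2'] at h3'
    simp only [List.cons.injEq] at h2 h3 h3'
    exact hn3 (h3.1.symm.trans (h2.1.trans h3'.1))
  rcases hh with rfl | rfl
  · rw [show FreeGroup.mk ([] : List (α × Bool)) = 1 from rfl, one_mul]
    simp only [List.nil_append] at h1 h1'
    refine ⟨between_of_words (l := []) (u := l₂) (v := x₂ :: A₂ ++ ra) (w := B ++ rb)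
      ?_ (by simpa using hb) hl2 ?_, between_of_words (l := l₂) (u := []) (v := x₂ :: A₂ ++ ra)
      (w := y₂ :: C₂ ++ rc) ?_ ?_ (by simpa using hl2) (by simpa using hn2),
      Between.symm (between_of_words (l := []) (u := l₂) (v := y₂ :: C₂ ++ rc) (w := B ++ rb)
      ?_ (by simpa using hb) hl2 ?_)⟩
    · rw [ha]; nth_rewrite 1 [h2]; simp
    · have : l₂ ++ (x₂ :: A₂ ++ ra) = x₁ :: A₁ ++ ra := by
        rw [← h1]; nth_rewrite 1 [h2]; simp
      rw [this, h1']
      simpa using hn1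
    · rw [ha]; nth_rewrite 1 [h2]; simp
    · rw [hc]; nth_rewrite 1 [h2']; simp
    · rw [hc]; nth_rewrite 1 [h2']; simp
    · have : l₂ ++ (y₂ :: C₂ ++ rc) = y₃ :: C₃ ++ rc := by
        rw [← h3']; nth_rewrite 1 [h2']; simp
      rw [this, h3]
      simpa using hn3.symm
  · rw [show FreeGroup.mk ([] : List (α × Bool)) = 1 from rfl, mul_one]
    simp only [List.nil_append] at h2 h2'
    refine ⟨between_of_words (l := l₁) (u := []) (v := x₁ :: A₁ ++ ra) (w := y₁ :: B₁ ++ rb)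
      ?_ ?_ (by simpa using hl1) (by simpa using hn1), between_of_words (l := []) (u := l₁)
      (v := x₁ :: A₁ ++ ra) (w := C ++ rc) ?_ (by simpa using hc) hl1 ?_,
      between_of_words (l := []) (u := l₁) (v := y₁ :: B₁ ++ rb) (w := C ++ rc)
      ?_ (by simpa using hc) hl1 ?_⟩
    · rw [ha]; nth_rewrite 1 [h1]; simp
    · rw [hb]; nth_rewrite 1 [h1']; simp
    · rw [ha]; nth_rewrite 1 [h1]; simp
    · have : l₁ ++ (x₁ :: A₁ ++ ra) = x₂ :: A₂ ++ ra := by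
        rw [← h2]; nth_rewrite 1 [h1]; simp
      rw [this, h2']
      simpa using hn2
    · rw [hb]; nth_rewrite 1 [h1']; simp
    · have : l₁ ++ (y₁ :: B₁ ++ rb) = x₃ :: B₃ ++ rb := by
        rw [← h3]; nth_rewrite 1 [h1']; simp
      rw [this, h3']
      simpa using hn3

/-- The first letters of a cyclically reduced word and of its inverse differ. -/
theorem head_ne_of_isCyclicallyReduced {c : FreeGroup α} (hc : IsCyclicallyReduced c.toWord)
    (hc1 : c ≠ 1) : ∃ x B y C, c.toWord = x :: B ∧ c⁻¹.toWord = y :: C ∧ x ≠ y := by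
  have hne : c.toWord ≠ [] := fun h => hc1 (toWord_eq_nil_iff.1 h)
  obtain ⟨x, B, hx⟩ := List.exists_cons_of_ne_nil hne
  obtain ⟨L, z, hz⟩ := (List.eq_nil_or_concat c.toWord).resolve_left hne
  rw [List.concat_eq_append] at hz
  refine ⟨x, B, invLetter z, invRev L, hx, by rw [toWord_inv, hz]; simp [invRev_eq], ?_⟩
  rintro rfl
  have := hc.2 z (by simp [hz]) (invLetter z) (by simp [hx]) rfl
  simp [invLetter] at this

/-- The words of `g * c ^ n` for large `n` share long prefixes. -/
theorem isPrefix_mul_pow {g c y : FreeGroup α} (hc : IsCyclicallyReduced c.toWord) {N n : ℕ}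
    (hN : g.norm < N * c.norm) (hn : N + y.norm ≤ n) :
    (g * c ^ N).toWord <+: (g * c ^ n * y).toWord := by
  obtain ⟨p, k, s, e1, e2, e3⟩ := exists_cancel g (c ^ N)
  have l1 := congrArg List.length e1
  have l2 := congrArg List.length e2
  rw [toWord_pow_eq hc] at e2 l2
  simp only [List.length_append, invRev_length, length_cyclePow] at l1 l2
  have hs : s ≠ [] := by
    rintro rfl
    simp only [norm, List.length_nil] at *
    omega
  have hpos : 1 ≤ c.norm := Nat.one_le_iff_ne_zero.2 fun h => by simp [h] at hN
  have key : (g * c ^ n).toWord = p ++ s ++ cyclePow c.toWord (n - N) := by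
    have hr : IsReduced (p ++ s ++ cyclePow c.toWord (n - N)) := by
      -- The power is too long to be cancelled by `g`, so `s` is nonempty. Together with further
      -- periods it is part of a power of `c`, and reducedness passes across the overlap `s`.
      refine IsReduced.append_overlap (e3 ▸ isReduced_toWord) ?_ hs
      refine (hc.flatten_replicate (N + (n - N))).isReduced.infix ⟨invRev k, [], ?_⟩
      change _ = cyclePow _ _
      rw [cyclePow_add, e2]
      simp
    rw [← toWord_mk_of_isReduced hr]
    congr 1
    rw [mk_append, ← e3, mk_toWord, ← toWord_pow_eq hc, mk_toWord, mul_assoc, ← pow_add]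
    congr 2
    omega
  refine isPrefix_toWord_mul ?_ ?_
  · rw [key, e3]
    exact List.prefix_append _ _
  · rw [norm, norm, key, e3, List.length_append (bs := cyclePow _ _), length_cyclePow]
    have : y.norm ≤ (n - N) * c.norm :=
      (show y.norm ≤ n - N by omega).trans (Nat.le_mul_of_pos_right _ hpos)
    exact Nat.add_le_add_left this _

theorem lcp_spec_of_incomparable {A B : List (α × Bool)}
    (h : ∀ u, u <+: A → u <+: B → u = A ∨ u = B → False) :
    ∃ x y A₁ B₁, A = lcp A B ++ x :: A₁ ∧ B = lcp A B ++ y :: B₁ ∧ x ≠ y := by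
  obtain ⟨l, m, h1, h2, h3⟩ := lcp_spec A B
  rcases h3 with rfl | rfl | ⟨a, b, l'', m'', rfl, rfl, hab⟩
  · rw [List.append_nil] at h1
    exact (h (lcp A B) (h1 ▸ List.prefix_rfl) ⟨m, h2.symm⟩ (Or.inl h1.symm)).elim
  · rw [List.append_nil] at h2
    exact (h (lcp A B) ⟨l, h1.symm⟩ (h2 ▸ List.prefix_rfl) (Or.inr h2.symm)).elim
  · exact ⟨a, b, l'', m'', h1, h2, hab⟩

/-- The center of a noncommuting pair, if the exponent `N` is large enough. -/
def center (N : ℕ) (u v : FreeGroup α) : FreeGroup α :=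
  hd v * (gcp ((hd v)⁻¹ * u * hd v * core v ^ N) (core v ^ N) *
    gcp ((hd v)⁻¹ * u * hd v * core v ^ N) (core v ^ N)⁻¹)

/-- If two of the words of `g c^N`, `c^N`, `c^{-N}` did not diverge, the first and one of the others
would share a prefix of length at least `|g| + |c|`. Then `g` would conjugate `c` to `c` or to
`c⁻¹`, both excluded. The other two words differ at the first letter since `c` is cyclically
reduced. -/
theorem isCenter_of_isCyclicallyReduced {g c : FreeGroup α} {N : ℕ}
    (hc : IsCyclicallyReduced c.toWord) (hgc : ¬ Commute g c)
    (hN : 2 * g.norm + c.norm ≤ N * c.norm) :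
    IsCenter (gcp (g * c ^ N) (c ^ N) * gcp (g * c ^ N) (c ^ N)⁻¹) g c := by
  have hc1 : c ≠ 1 := by rintro rfl; exact hgc (Commute.one_right g)
  have hpos := norm_pos hc1
  have hA : N * c.norm ≤ (g * c ^ N).norm + g.norm := by
    have := norm_mul_le g⁻¹ (g * c ^ N)
    rw [inv_mul_cancel_left, norm_pow_eq hc, norm_inv_eq] at this
    omega
  have hB : (c ^ N).toWord = cyclePow c.toWord N := toWord_pow_eq hc N
  have hC : (c ^ N)⁻¹.toWord = cyclePow c⁻¹.toWord N := by rw [← inv_pow, toWord_pow_eq hc.inv]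
  have lB : (c ^ N).toWord.length = N * c.norm := by rw [hB, length_cyclePow]; rfl
  have lC : (c ^ N)⁻¹.toWord.length = N * c.norm := by
    rw [hC, length_cyclePow]; change _ * c⁻¹.norm = _; rw [norm_inv_eq]
  obtain ⟨x₁, y₁, A₁, B₁, h1, h1', hn1⟩ :=
    lcp_spec_of_incomparable (A := (g * c ^ N).toWord) (B := (c ^ N).toWord) (by
      intro u hu1 hu2 hu
      refine hgc (mul_eq_mul_of_isPrefix hc rfl hu1 (hB ▸ hu2) ?_ (by omega))
      -- `|g c^N| ≥ N|c| - |g| ≥ |g| + |c|`: this is what the factor `2` in `hN` is for.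
      rcases hu with rfl | rfl
      · change _ ≤ (g * c ^ N).norm; omega
      · omega)
  obtain ⟨x₂, y₂, A₂, C₂, h2, h2', hn2⟩ :=
    lcp_spec_of_incomparable (A := (g * c ^ N).toWord) (B := (c ^ N)⁻¹.toWord) (by
      intro u hu1 hu2 hu
      refine hc1 (eq_one_of_conj_eq_inv (mul_eq_mul_of_isPrefix (g := g) hc norm_inv_eq hu1
        (hC ▸ hu2) ?_ (by omega)))
      rcases hu with rfl | rfl
      · change _ ≤ (g * c ^ N).norm; omega
      · omega)
  have hN0 : ∃ N', N = N' + 1 := Nat.exists_eq_succ_of_ne_zero (by rintro rfl; omega)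
  obtain ⟨x₃, B₃, y₃, C₃, h3, h3', hn3⟩ := head_ne_of_isCyclicallyReduced hc hc1
  have h3 : ∃ B₃, (c ^ N).toWord = x₃ :: B₃ := by
    obtain ⟨N', rfl⟩ := hN0
    rw [hB, cyclePow_succ, h3]
    exact ⟨_, rfl⟩
  have h3' : ∃ C₃, (c ^ N)⁻¹.toWord = y₃ :: C₃ := by
    obtain ⟨N', rfl⟩ := hN0
    rw [hC, cyclePow_succ, h3']
    exact ⟨_, rfl⟩
  obtain ⟨B₃, h3⟩ := h3
  obtain ⟨C₃, h3'⟩ := h3'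
  intro y
  -- The `n - N ≥ |y|` additional periods protect the prefixes from cancellation with `y`.
  refine ⟨N + y.norm, fun n hn => ?_⟩
  obtain ⟨ra, ha⟩ := isPrefix_mul_pow (g := g) (y := y) (N := N) hc (by omega) hn
  obtain ⟨rb, hb⟩ := isPrefix_mul_pow (g := 1) (y := y) (N := N) hc (by simp; omega) hn
  obtain ⟨rc, hc'⟩ := isPrefix_mul_pow (g := 1) (y := y) (N := N) hc.inv (by simp; omega) hn
  rw [one_mul, one_mul] at hb
  rw [one_mul, one_mul, inv_pow] at hc'
  exact isMedian_of_words ha.symm hb.symm hc'.symm h1 h1' hn1 h2 h2' hn2 h3 h3' hn3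

theorem isCenter_center {u v : FreeGroup α} {N : ℕ} (h : ¬ Commute u v)
    (hN : 2 * ((hd v)⁻¹ * u * hd v).norm + (core v).norm ≤ N * (core v).norm) :
    IsCenter (center N u v) u v := by
  have := (isCenter_of_isCyclicallyReduced (isCyclicallyReduced_core v)
    (fun h' => h (commute_of_commute_conj (hd v) h')) hN).conj (hd v)
  have e1 : hd v * ((hd v)⁻¹ * u * hd v) * (hd v)⁻¹ = u := by group
  have e2 : hd v * core v * (hd v)⁻¹ = v := by rw [core]; group
  rwa [e1, e2] at this

/-- The centers of two conjugate noncommuting pairs determine the conjugating element. -/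
theorem center_mul_inv_center {u v x : FreeGroup α} {N N' : ℕ} (h : ¬ Commute u v)
    (hN : 2 * ((hd v)⁻¹ * u * hd v).norm + (core v).norm ≤ N * (core v).norm)
    (hN' : 2 * ((hd (x⁻¹ * v * x))⁻¹ * (x⁻¹ * u * x) * hd (x⁻¹ * v * x)).norm +
      (core (x⁻¹ * v * x)).norm ≤ N' * (core (x⁻¹ * v * x)).norm) :
    center N u v * (center N' (x⁻¹ * u * x) (x⁻¹ * v * x))⁻¹ = x := by
  have h1 := isCenter_center h hN
  have h2 := (isCenter_center (fun h' => h (commute_of_commute_conj x h')) hN').conj x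
  have e : ∀ w, x * (x⁻¹ * w * x) * x⁻¹ = w := fun w => by group
  rw [e, e] at h2
  rw [h1.eq h2]
  group

/-! ### Transport of a commuting element along a conjugation -/

/-- The conjugate of `b` by an element that conjugates `v` to `v'`, if `b` commutes with `v` and
the exponents are large enough. -/
def transport (n M : ℕ) (v v' b : FreeGroup α) : FreeGroup α :=
  hd v' * (FreeGroup.mk ((core v' ^ M).toWord.take ((hd v)⁻¹ * b * hd v * core v ^ n).norm) *
    (core v' ^ n)⁻¹) * (hd v')⁻¹

/-- If the word of `d` commutes with that of `c`, nothing cancels. Otherwise the word of `d⁻¹` does,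
it is a prefix of `c^n`, and `d c^n` is what remains of `c^n`. The power thus removes the ambiguity
of the sign. -/
theorem append_comm_mul_pow {d c : FreeGroup α} (hc : IsCyclicallyReduced c.toWord) (hc1 : c ≠ 1)
    (h : Commute d c) {n : ℕ} (hn : d.norm ≤ n * c.norm) :
    (d * c ^ n).toWord ++ c.toWord = c.toWord ++ (d * c ^ n).toWord := by
  rcases append_comm_or_of_commute hc hc1 h with h | h
  · have hcom := append_comm_append h (cyclePow_append_self c.toWord n).symm
    rwa [toWord_mul, toWord_pow_eq hc, (isReduced_of_append_comm hc hc1 hcom).reduce_eq]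
  · obtain ⟨s, hs⟩ := isPrefix_cyclePow h (n := n) (by
      change d⁻¹.norm ≤ _; rw [norm_inv_eq]; exact hn)
    have e : d * c ^ n = FreeGroup.mk s := by
      rw [← mk_toWord (x := c ^ n), toWord_pow_eq hc, ← hs, mk_append, mk_toWord]
      group
    have hr : IsReduced s := (hc.flatten_replicate n).isReduced.infix
      ⟨_, [], (List.append_nil _).trans hs⟩
    rw [e, toWord_mk_of_isReduced hr]
    have h2 := cyclePow_append_self c.toWord n
    rw [← hs, ← List.append_assoc, ← h, List.append_assoc, List.append_assoc] at h2
    exact (List.append_cancel_left h2).symm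

/-- Let `d` and `e` be `b` and its conjugate, seen from the cores `c` of `v` and `c'` of the
conjugate of `v`. The words of `d c^n` and `e c'^n` are prefixes of powers of `c` and `c'`. They
have the same length, since elements commuting with a nontrivial cyclically reduced element are
shortest in their conjugacy class. So `e c'^n` is found by cutting `c'^M` at a known length, without
knowledge of `a`. -/
theorem transport_eq {v b a : FreeGroup α} {n M : ℕ} (hb : Commute b v) (hv : v = 1 → b = 1)
    (hn : ((hd v)⁻¹ * b * hd v).norm ≤ n * (core v).norm)
    (hM : ((hd v)⁻¹ * b * hd v).norm + n * (core v).norm ≤ M * (core (a⁻¹ * v * a)).norm) :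
    transport n M v (a⁻¹ * v * a) b = a⁻¹ * b * a := by
  rcases eq_or_ne v 1 with rfl | hv1
  · simp only [hv rfl, transport]
    simp
    rfl
  set v' := a⁻¹ * v * a with hv'
  have hv1' : v' ≠ 1 := by
    intro h
    apply hv1
    have : v = a * v' * a⁻¹ := by rw [hv']; group
    rw [this, h]; group
  have hc := isCyclicallyReduced_core v
  have hc' := isCyclicallyReduced_core v'
  have hc1 : core v ≠ 1 := fun h => hv1 (core_eq_one_iff.1 h)
  have hc1' : core v' ≠ 1 := fun h => hv1' (core_eq_one_iff.1 h)
  set d := (hd v)⁻¹ * b * hd v with hd'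
  set y := (hd v)⁻¹ * a * hd v' with hy
  set e := y⁻¹ * d * y with he
  have hcy : core v' = y⁻¹ * core v * y := by rw [core, core, hy, hv']; group
  have hdc : Commute d (core v) := commute_conj _ hb
  have hec : Commute e (core v') := by rw [hcy]; exact commute_conj y hdc
  have hde : d = y⁻¹⁻¹ * e * y⁻¹ := by rw [he]; group
  have hcc : core v = y⁻¹⁻¹ * core v' * y⁻¹ := by rw [hcy]; group
  have len : ∀ {s t : FreeGroup α}, Commute s (core v) → Commute t (core v') →
      t = y⁻¹ * s * y → t.norm = s.norm := by
    intro s t hs ht hst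
    have hst' : s = y⁻¹⁻¹ * t * y⁻¹ := by rw [hst]; group
    refine le_antisymm ?_ ?_
    · rw [hst]
      exact norm_le_of_conj hc hc1 hc' hc1' hs (hst ▸ ht)
    · rw [hst']
      exact norm_le_of_conj hc' hc1' hc hc1 ht (hst' ▸ hs)
  have lc : (core v').norm = (core v).norm := len (Commute.refl _) (Commute.refl _) hcy
  have le' : e.norm = d.norm := len hdc hec he
  have lf : (e * core v' ^ n).norm = (d * core v ^ n).norm := by
    refine len (hdc.mul_left ((Commute.refl _).pow_left n))
      (hec.mul_left ((Commute.refl _).pow_left n)) ?_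
    have := conj_pow (i := n) (a := y⁻¹) (b := core v)
    rw [inv_inv] at this
    rw [hcy, this, he]
    group
  have hpos := append_comm_mul_pow hc' hc1' hec (n := n) (by rw [le', lc]; exact hn)
  have hle : (e * core v' ^ n).norm ≤ M * (core v').norm := by
    refine (norm_mul_le _ _).trans ?_
    rw [norm_pow_eq hc', le', lc]
    rwa [lc] at hM
  have hpre := isPrefix_cyclePow hpos hle
  rw [← toWord_pow_eq hc'] at hpre
  have htake : (core v' ^ M).toWord.take (d * core v ^ n).norm = (e * core v' ^ n).toWord := by
    rw [← lf]
    exact (List.prefix_iff_eq_take.1 hpre).symm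
  rw [transport, htake, mk_toWord, he, hy, hd']
  group

end FreeGroup

/-! ### Structured programs for stack machines -/

/-- Structured programs that work on stacks indexed by `K` with symbols in `Γ`. -/
inductive StackProg (K Γ : Type) : Type
  | skip : StackProg K Γ
  | push (k : K) (a : Γ) : StackProg K Γ
  | seq (p q : StackProg K Γ) : StackProg K Γ
  /-- Pop a symbol from the stack `k`, run `body` on it, and start again if `cont` says so. -/
  | iter (k : K) (cont : Option Γ → Bool) (body : Option Γ → StackProg K Γ) : StackProg K Γ

namespace StackProg

variable {K Γ : Type} [DecidableEq K]

/-- `Runs p S t S'`: the program `p`, started on the stacks `S`, ends with the stacks `S'` after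
`t` steps. -/
inductive Runs : StackProg K Γ → (K → List Γ) → ℕ → (K → List Γ) → Prop
  | skip (S : K → List Γ) : Runs skip S 1 S
  | push (k : K) (a : Γ) (S : K → List Γ) :
      Runs (push k a) S 1 (Function.update S k (a :: S k))
  | seq {p q : StackProg K Γ} {S S' S'' : K → List Γ} {t t' : ℕ} :
      Runs p S t S' → Runs q S' t' S'' → Runs (seq p q) S (t + t') S''
  | last {k : K} {cont : Option Γ → Bool} {body : Option Γ → StackProg K Γ}
      {S S' : K → List Γ} {t : ℕ} : cont (S k).head? = false →
      Runs (body (S k).head?) (Function.update S k (S k).tail) t S' →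
      Runs (iter k cont body) S (1 + t) S'
  | next {k : K} {cont : Option Γ → Bool} {body : Option Γ → StackProg K Γ}
      {S S' S'' : K → List Γ} {t t' : ℕ} : cont (S k).head? = true →
      Runs (body (S k).head?) (Function.update S k (S k).tail) t S' →
      Runs (iter k cont body) S' t' S'' → Runs (iter k cont body) S (1 + t + t') S''

/-- The total number of symbols on the stacks. -/
def stackSize [Fintype K] (S : K → List Γ) : ℕ := ∑ k, (S k).length

theorem stackSize_update [Fintype K] (S : K → List Γ) (k : K) (l : List Γ) :
    stackSize (Function.update S k l) + (S k).length = stackSize S + l.length := by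
  have h : (fun i => (Function.update S k l i).length) =
      Function.update (fun i => (S i).length) k l.length := by
    funext i
    by_cases hi : i = k
    · subst hi; simp
    · simp [hi]
  have h1 := Finset.sum_update_of_mem (Finset.mem_univ k) (fun i => (S i).length) l.length
  have h2 := Finset.add_sum_erase Finset.univ (fun i => (S i).length) (Finset.mem_univ k)
  rw [stackSize, stackSize, h, h1]
  rw [Finset.sdiff_singleton_eq_erase]
  omega

/-- A step adds at most one symbol, so every time bound is also a bound for the growth of the data.
-/
theorem Runs.stackSize_le [Fintype K] {p : StackProg K Γ} {S S' : K → List Γ} {t : ℕ}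
    (h : Runs p S t S') : stackSize S' ≤ stackSize S + t := by
  have tail : ∀ (S : K → List Γ) (k : K),
      stackSize (Function.update S k (S k).tail) ≤ stackSize S := fun S k => by
    have := stackSize_update S k (S k).tail
    have := (S k).length_tail
    omega
  induction h with
  | skip S => omega
  | push k a S =>
    have := stackSize_update S k (a :: S k)
    simp only [List.length_cons] at this
    omega
  | seq _ _ ih ih' => omega
  | @last k _ _ S _ _ _ _ ih => have := tail S k; omega
  | @next k _ _ S _ _ _ _ _ _ _ ih ih' => have := tail S k; omega

/-! ### Translation of structured programs into machines. -/

/-- The labels of the machine that executes a program. -/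
def Lab : StackProg K Γ → Type
  | skip => Unit
  | push _ _ => Unit
  | seq p q => p.Lab ⊕ q.Lab
  | iter _ _ body => Option (Σ o, (body o).Lab)

/-- The label at which the execution of a program starts. -/
def entry : (p : StackProg K Γ) → p.Lab
  | skip => ()
  | push _ _ => ()
  | seq p _ => Sum.inl p.entry
  | iter _ _ _ => none

/-- The labels of a program form a finite type. -/
@[reducible] def fintypeLab [Fintype Γ] : (p : StackProg K Γ) → Fintype p.Lab
  | skip => inferInstanceAs (Fintype Unit)
  | push _ _ => inferInstanceAs (Fintype Unit)
  | seq p q =>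
    letI := fintypeLab p
    letI := fintypeLab q
    inferInstanceAs (Fintype (p.Lab ⊕ q.Lab))
  | iter _ _ body =>
    letI := fun o => fintypeLab (body o)
    inferInstanceAs (Fintype (Option (Σ o, (body o).Lab)))

/-- The alphabets of a machine with stacks for a program and one more output stack. -/
abbrev Alphabet (K Γ Out : Type) : Option K → Type
  | none => Out
  | some _ => Γ

open Turing

variable {Out Λ : Type}

/-- The statements of the machine that executes a program. -/
def code : (p : StackProg K Γ) → (p.Lab → Λ) → Λ → p.Lab →
    TM2.Stmt (Alphabet K Γ Out) Λ (Option Γ)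
  | skip, _, exit, _ => .goto fun _ => exit
  | push k a, _, exit, _ => .push (some k) (fun _ => a) (.goto fun _ => exit)
  | seq p q, e, exit, l =>
    match l with
    | Sum.inl l => p.code (fun l => e (Sum.inl l)) (e (Sum.inr q.entry)) l
    | Sum.inr l => q.code (fun l => e (Sum.inr l)) exit l
  | iter k cont body, e, exit, l =>
    match l with
    | none => .pop (some k) (fun _ o => o) (.goto fun o => e (some ⟨o, (body o).entry⟩))
    | some ⟨o, l⟩ =>
      (body o).code (fun l => e (some ⟨o, l⟩)) (if cont o then e none else exit) l

/-- Stacks of a program together with the contents of the output stack. -/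
def withOutput (S : K → List Γ) (out : List Out) : ∀ k, List (Alphabet K Γ Out k)
  | none => out
  | some k => S k

theorem withOutput_update (S : K → List Γ) (out : List Out) (k : K) (l : List Γ) :
    withOutput (Function.update S k l) out =
      Function.update (withOutput S out) (some k) l := by
  funext i
  cases i with
  | none => simp [withOutput]
  | some i =>
    by_cases h : i = k
    · subst h; simp [withOutput]
    · simp [withOutput, h]

/-- The machine `m` gets from the configuration `c` to `c'` in `n` steps. -/
def StepsTo (m : Λ → TM2.Stmt (Alphabet K Γ Out) Λ (Option Γ)) (n : ℕ)
    (c c' : TM2.Cfg (Alphabet K Γ Out) Λ (Option Γ)) : Prop :=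
  (flip bind (TM2.step m))^[n] (some c) = some c'

theorem StepsTo.trans {m : Λ → TM2.Stmt (Alphabet K Γ Out) Λ (Option Γ)} {n n' : ℕ}
    {c c' c'' : TM2.Cfg (Alphabet K Γ Out) Λ (Option Γ)} (h : StepsTo m n c c')
    (h' : StepsTo m n' c' c'') : StepsTo m (n + n') c c'' := by
  rw [StepsTo, add_comm, Function.iterate_add_apply, h, h']

theorem StepsTo.one {m : Λ → TM2.Stmt (Alphabet K Γ Out) Λ (Option Γ)}
    {c c' : TM2.Cfg (Alphabet K Γ Out) Λ (Option Γ)} (h : TM2.step m c = some c') :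
    StepsTo m 1 c c' := by
  simpa [StepsTo, flip] using h

/-- The embedding `e` of the labels and the label `exit` are arbitrary, since a subprogram is run
inside the label type of the whole program. The internal state only carries the symbol popped last
to the next jump and may be anything in between. -/
theorem Runs.stepsTo {p : StackProg K Γ} {S S' : K → List Γ} {t : ℕ} (h : Runs p S t S')
    (m : Λ → TM2.Stmt (Alphabet K Γ Out) Λ (Option Γ)) (e : p.Lab → Λ) (exit : Λ)
    (hm : ∀ l, m (e l) = p.code e exit l) (v : Option Γ) (out : List Out) :
    ∃ v', StepsTo m t ⟨some (e p.entry), v, withOutput S out⟩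
      ⟨some exit, v', withOutput S' out⟩ := by
  induction h generalizing Λ v with
  | skip S =>
    refine ⟨v, StepsTo.one ?_⟩
    simp [TM2.step, hm, code]
  | push k a S =>
    refine ⟨v, StepsTo.one ?_⟩
    rw [withOutput_update]
    simp only [TM2.step, hm, code, TM2.stepAux]
    rfl
  | @seq p q S S' S'' t t' _ _ ih ih' =>
    obtain ⟨v', h1⟩ := ih m (fun l => e (Sum.inl l)) (e (Sum.inr q.entry))
      (fun l => hm (Sum.inl l)) v
    obtain ⟨v'', h2⟩ := ih' m (fun l => e (Sum.inr l)) exit (fun l => hm (Sum.inr l)) v'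
    exact ⟨v'', h1.trans h2⟩
  | @last k cont body S S' t hc _ ih =>
    obtain ⟨v', h1⟩ := ih m (fun l => e (some ⟨_, l⟩)) exit (fun l => by
      rw [hm (some ⟨_, l⟩)]; simp [code, hc]) (S k).head?
    refine ⟨v', (StepsTo.one ?_).trans h1⟩
    rw [withOutput_update]
    change TM2.step m ⟨some (e none), _, _⟩ = _
    rw [TM2.step, hm none]
    rfl
  | @next k cont body S S' S'' t t' hc _ _ ih ih' =>
    obtain ⟨v', h1⟩ := ih m (fun l => e (some ⟨_, l⟩)) (e none) (fun l => by
      rw [hm (some ⟨_, l⟩)]; simp [code, hc]) (S k).head?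
    obtain ⟨v'', h2⟩ := ih' m e exit hm v'
    refine ⟨v'', ((StepsTo.one ?_).trans h1).trans h2⟩
    rw [withOutput_update]
    change TM2.step m ⟨some (e none), _, _⟩ = _
    rw [TM2.step, hm none]
    rfl

/-- The machine that executes a program and then transfers the symbols of the stack `r` to the
output stack, as given by `emit`. -/
def machine [Fintype K] [Fintype Γ] [Fintype Out] (p : StackProg K Γ) (inp r : K)
    (emit : Γ → Option Out) : TM2ComputableAux Γ Out where
  tm :=
    letI := p.fintypeLab
    letI : Fintype (Alphabet K Γ Out (some inp)) := inferInstanceAs (Fintype Γ)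
    { K := Option K
      k₀ := some inp
      k₁ := none
      Γ := Alphabet K Γ Out
      Λ := p.Lab ⊕ Option (Option Out)
      main := Sum.inl p.entry
      σ := Option Γ
      initialState := none
      m := fun l => match l with
        | Sum.inl l => p.code Sum.inl (Sum.inr none) l
        | Sum.inr none =>
          .pop (some r) (fun _ o => o) (.goto fun o => Sum.inr (some (o.bind emit)))
        -- A halting configuration is required to have the initial internal state.
        | Sum.inr (some none) => .load (fun _ => none) .halt
        | Sum.inr (some (some x)) => .push none (fun _ => x) (.goto fun _ => Sum.inr none) }
  inputAlphabet := Equiv.refl Γ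
  outputAlphabet := Equiv.refl Out

/-- Moving a stack to another one reverses it, hence `L.reverse` in the register. Each symbol costs
a pop and a push; finding the register empty and halting cost two more steps. -/
theorem machine_haltsWithin [Fintype K] [Fintype Γ] [Fintype Out] {p : StackProg K Γ}
    {inp r : K} {emit : Γ → Option Out} {s : List Γ} {L : List Out} {f : Out → Γ} {t : ℕ}
    (hf : ∀ x, emit (f x) = some x)
    (h : Runs p (Function.update (fun _ => []) inp s) t
      (Function.update (fun _ => []) r (L.reverse.map f))) :
    HaltsWithin (p.machine inp r emit) s L (t + 2 * L.length + 2) := by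
  obtain ⟨v, h1⟩ := h.stepsTo (p.machine inp r emit).tm.m Sum.inl (Sum.inr none)
    (fun _ => rfl) none ([] : List Out)
  have h2 : ∀ (L' out : List Out) (v : Option Γ),
      StepsTo (p.machine inp r emit).tm.m (2 * L'.length + 2)
        ⟨some (Sum.inr none), v, withOutput (Function.update (fun _ => []) r (L'.map f)) out⟩
        ⟨none, none, withOutput (fun _ => []) (L'.reverse ++ out)⟩ := by
    intro L'
    induction L' with
    | nil =>
      intro out v
      have a1 : StepsTo (p.machine inp r emit).tm.m 1
          ⟨some (Sum.inr none), v, withOutput (Function.update (fun _ => []) r []) out⟩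
          ⟨some (Sum.inr (some none)), none, withOutput (fun _ => []) out⟩ := by
        refine StepsTo.one ?_
        have e : (Function.update (fun _ => []) r [] : K → List Γ) = fun _ => [] := by simp
        have e' : (withOutput (fun _ => []) out : ∀ k, List (Alphabet K Γ Out k)) =
            Function.update (withOutput (fun _ => []) out) (some r) [] := by
          rw [← withOutput_update, e]
        rw [e]
        conv_rhs => rw [e']
        rfl
      exact a1.trans (StepsTo.one rfl)
    | cons x L' ih =>
      intro out v
      have a1 : StepsTo (p.machine inp r emit).tm.m 1
          ⟨some (Sum.inr none), v,
            withOutput (Function.update (fun _ => []) r ((x :: L').map f)) out⟩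
          ⟨some (Sum.inr (some (some x))), some (f x),
            withOutput (Function.update (fun _ => []) r (L'.map f)) out⟩ := by
        refine StepsTo.one ?_
        have e' : withOutput (Function.update (fun _ => []) r (L'.map f)) out =
            Function.update (withOutput (Function.update (fun _ => []) r ((x :: L').map f)) out)
              (some r) (L'.map f) := by
          rw [← withOutput_update, Function.update_idem]
        rw [e', ← hf x]
        simp only [machine, TM2.step, TM2.stepAux]
        simp [withOutput]
      have a2 : StepsTo (p.machine inp r emit).tm.m 1
          ⟨some (Sum.inr (some (some x))), some (f x),
            withOutput (Function.update (fun _ => []) r (L'.map f)) out⟩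
          ⟨some (Sum.inr none), some (f x),
            withOutput (Function.update (fun _ => []) r (L'.map f)) (x :: out)⟩ := by
        refine StepsTo.one ?_
        simp only [machine, TM2.step, TM2.stepAux]
        congr 2
        funext i
        cases i <;> simp [withOutput]
      have := (a1.trans a2).trans (ih (x :: out) (some (f x)))
      convert this using 1
      · simp; ring
      · simp
  have h3 := h1.trans (h2 L.reverse [] v)
  refine ⟨⟨⟨t + 2 * L.length + 2, ?_⟩, le_rfl⟩⟩
  rw [List.length_reverse, ← add_assoc, List.reverse_reverse, List.append_nil] at h3
  have ei : initList (p.machine inp r emit).tm (s.map (p.machine inp r emit).inputAlphabet.invFun) =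
      ⟨some (Sum.inl p.entry), none,
        withOutput (Function.update (fun _ => []) inp s) ([] : List Out)⟩ := by
    rw [initList]
    congr 1
    funext i
    cases i with
    | none => rfl
    | some i =>
      by_cases hi : i = inp
      · subst hi
        simp [machine, withOutput]
        rfl
      · simp [machine, withOutput, hi]
  have eh : haltList (p.machine inp r emit).tm
      (L.map (p.machine inp r emit).outputAlphabet.invFun) =
      ⟨none, none, withOutput (fun _ => []) L⟩ := by
    rw [haltList]
    congr 1
    funext i
    cases i with
    | none =>
      simp [machine, withOutput]
      rfl
    | some i => simp [machine, withOutput]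
  rw [ei, Option.map_some, eh]
  exact h3

end StackProg

theorem HaltsWithin.mono {Γ₀ Γ₁ : Type} {M : Turing.TM2ComputableAux Γ₀ Γ₁} {s : List Γ₀}
    {o : List Γ₁} {t t' : ℕ} (h : HaltsWithin M s o t) (ht : t ≤ t') : HaltsWithin M s o t' := by
  obtain ⟨h⟩ := h
  exact ⟨⟨h.toEvalsTo, h.steps_le_m.trans ht⟩⟩

/-- The output of a machine is determined by its input. -/
theorem HaltsWith.eq {Γ₀ Γ₁ : Type} {M : Turing.TM2ComputableAux Γ₀ Γ₁} {s : List Γ₀}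
    {o o' : List Γ₁} (h : HaltsWith M s o) (h' : HaltsWith M s o') : o = o' := by
  obtain ⟨⟨n, h⟩⟩ := h
  obtain ⟨⟨n', h'⟩⟩ := h'
  have halt : ∀ (o : List (M.tm.Γ M.tm.k₁)) (k : ℕ),
      (flip bind M.tm.step)^[k + 1] (some (Turing.haltList M.tm o)) = none := by
    intro o k
    induction k with
    | zero => rfl
    | succ k ih => rw [Function.iterate_succ_apply', ih]; rfl
  have key : ∀ {n n' : ℕ} {a a' : List (M.tm.Γ M.tm.k₁)} {c : Option M.tm.Cfg}, n ≤ n' →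
      (flip bind M.tm.step)^[n] c = some (Turing.haltList M.tm a) →
      (flip bind M.tm.step)^[n'] c = some (Turing.haltList M.tm a') →
      Turing.haltList M.tm a = Turing.haltList M.tm a' := by
    intro n n' a a' c hn h h'
    obtain ⟨k, rfl⟩ := Nat.exists_eq_add_of_le' hn
    rw [Function.iterate_add_apply, h] at h'
    cases k with
    | zero => exact Option.some_injective _ h'
    | succ k => rw [halt] at h'; cases h'
  have e : Turing.haltList M.tm (o.map M.outputAlphabet.invFun) =
      Turing.haltList M.tm (o'.map M.outputAlphabet.invFun) := by
    rcases le_total n n' with hn | hn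
    · exact key hn h h'
    · exact (key hn h' h).symm
  have e2 := congrFun (congrArg Turing.TM2.Cfg.stk e) M.tm.k₁
  simp only [Turing.haltList, dite_true] at e2
  exact List.map_injective_iff.2 M.outputAlphabet.symm.injective e2

/-! ### Registers that hold elements of a free group -/

namespace StackProg

open FreeGroup (zipTake invLetter)

variable {X Reg : Type} [DecidableEq Reg]

/-- Programs for five tapes and the registers `Reg`, together with a scratch register `none`. -/
abbrev RegProg (X Reg : Type) : Type := StackProg (Fin 5 ⊕ Option Reg) (AAGSymbol X)

/-- `p` gets from `S` to `S'` in at most `t` steps. -/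
def RunsIn (p : RegProg X Reg) (S : Fin 5 ⊕ Option Reg → List (AAGSymbol X)) (t : ℕ)
    (S' : Fin 5 ⊕ Option Reg → List (AAGSymbol X)) : Prop :=
  ∃ t' ≤ t, Runs p S t' S'

variable {S S' S'' : Fin 5 ⊕ Option Reg → List (AAGSymbol X)} {p q : RegProg X Reg} {t t' : ℕ}

theorem RunsIn.mono (h : RunsIn p S t S') (ht : t ≤ t') : RunsIn p S t' S' := by
  obtain ⟨s, hs, h⟩ := h
  exact ⟨s, hs.trans ht, h⟩

theorem RunsIn.of_eq (h : RunsIn p S t S') (ht : t ≤ t') (hS : S' = S'') : RunsIn p S t' S'' :=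
  hS ▸ h.mono ht

theorem RunsIn.seq (h : RunsIn p S t S') (h' : RunsIn q S' t' S'') :
    RunsIn (seq p q) S (t + t') S'' := by
  obtain ⟨s, hs, h⟩ := h
  obtain ⟨s', hs', h'⟩ := h'
  exact ⟨s + s', by omega, h.seq h'⟩

theorem RunsIn.skip (S : Fin 5 ⊕ Option Reg → List (AAGSymbol X)) : RunsIn skip S 1 S :=
  ⟨1, le_rfl, Runs.skip S⟩

theorem RunsIn.skip_of_eq (h : S' = S) : RunsIn StackProg.skip S 1 S' := h ▸ RunsIn.skip S

theorem RunsIn.push (k : Fin 5 ⊕ Option Reg) (a : AAGSymbol X)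
    (S : Fin 5 ⊕ Option Reg → List (AAGSymbol X)) :
    RunsIn (push k a) S 1 (Function.update S k (a :: S k)) :=
  ⟨1, le_rfl, Runs.push k a S⟩

section iter

variable {k : Fin 5 ⊕ Option Reg} {cont : Option (AAGSymbol X) → Bool}
  {body : Option (AAGSymbol X) → RegProg X Reg} {o : Option (AAGSymbol X)}

theorem RunsIn.last (ho : (S k).head? = o) (hc : cont o = false)
    (h : RunsIn (body o) (Function.update S k (S k).tail) t S') :
    RunsIn (iter k cont body) S (1 + t) S' := by
  obtain ⟨s, hs, h⟩ := h
  subst ho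
  exact ⟨1 + s, by omega, Runs.last hc h⟩

theorem RunsIn.next (ho : (S k).head? = o) (hc : cont o = true)
    (h : RunsIn (body o) (Function.update S k (S k).tail) t S')
    (h' : RunsIn (iter k cont body) S' t' S'') :
    RunsIn (iter k cont body) S (1 + t + t') S'' := by
  obtain ⟨s, hs, h⟩ := h
  obtain ⟨s', hs', h'⟩ := h'
  subst ho
  exact ⟨1 + s + s', by omega, Runs.next hc h h'⟩

end iter

variable [DecidableEq X]

/-- The word of a group element, as a string of symbols. -/
def encodeElement (g : FreeGroup X) : List (AAGSymbol X) := g.toWord.map AAGSymbol.letter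

@[simp] theorem encodeElement_one : encodeElement (1 : FreeGroup X) = [] := rfl

/-- The stacks that hold the tapes `T` and the registers `R`. -/
def regStacks (T : Fin 5 → List (AAGSymbol X)) (R : Option Reg → FreeGroup X) :
    Fin 5 ⊕ Option Reg → List (AAGSymbol X) :=
  Sum.elim T fun i => encodeElement (R i)

variable {T : Fin 5 → List (AAGSymbol X)} {R : Option Reg → FreeGroup X}

theorem regStacks_update (T : Fin 5 → List (AAGSymbol X)) (R : Option Reg → FreeGroup X)
    (i : Option Reg) (g : FreeGroup X) :
    Function.update (regStacks T R) (Sum.inr i) (encodeElement g) =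
      regStacks T (Function.update R i g) := by
  funext k
  rcases k with k | k
  · simp [regStacks]
  · by_cases h : k = i
    · subst h; simp [regStacks]
    · simp [regStacks, h]

theorem regStacks_update_tape (T : Fin 5 → List (AAGSymbol X)) (R : Option Reg → FreeGroup X)
    (τ : Fin 5) (l : List (AAGSymbol X)) :
    Function.update (regStacks T R) (Sum.inl τ) l = regStacks (Function.update T τ l) R := by
  funext k
  rcases k with k | k
  · by_cases h : k = τ
    · subst h; simp [regStacks]
    · simp [regStacks, h]
  · simp [regStacks]

omit [DecidableEq Reg] in
theorem head?_regStacks_of_eq_one {i : Option Reg} (h : R i = 1) :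
    (regStacks T R (Sum.inr i)).head? = none := by simp [regStacks, h]

theorem update_tail_of_eq_one {i : Option Reg} (h : R i = 1) :
    Function.update (regStacks T R) (Sum.inr i) (regStacks T R (Sum.inr i)).tail =
      regStacks T R := by
  have : (regStacks T R (Sum.inr i)).tail = regStacks T R (Sum.inr i) := by simp [regStacks, h]
  rw [this, Function.update_eq_self]

omit [DecidableEq Reg] in
theorem head?_regStacks_of_eq_cons {i : Option Reg} {x : X × Bool} {l : List (X × Bool)}
    (h : (R i).toWord = x :: l) :
    (regStacks T R (Sum.inr i)).head? = some (AAGSymbol.letter x) := by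
  simp [regStacks, encodeElement, h]

theorem toWord_mk_tail {g : FreeGroup X} {x : X × Bool} {l : List (X × Bool)}
    (h : g.toWord = x :: l) : (FreeGroup.mk l).toWord = l :=
  FreeGroup.toWord_mk_of_isReduced
    ((h ▸ FreeGroup.isReduced_toWord (x := g)).infix ⟨[x], [], by simp⟩)

theorem update_tail_of_eq_cons {i : Option Reg} {x : X × Bool} {l : List (X × Bool)}
    (h : (R i).toWord = x :: l) :
    Function.update (regStacks T R) (Sum.inr i) (regStacks T R (Sum.inr i)).tail =
      regStacks T (Function.update R i (FreeGroup.mk l)) := by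
  rw [← regStacks_update]
  congr 1
  rw [encodeElement, toWord_mk_tail h]
  simp [regStacks, encodeElement, h]

theorem eq_mk_mul {g : FreeGroup X} {x : X × Bool} {l : List (X × Bool)}
    (h : g.toWord = x :: l) : g = FreeGroup.mk [x] * FreeGroup.mk l := by
  rw [← FreeGroup.mk_append, List.singleton_append, ← h, FreeGroup.mk_toWord]

omit [DecidableEq X] in
theorem mk_invLetter (x : X × Bool) : FreeGroup.mk [invLetter x] = (FreeGroup.mk [x])⁻¹ := by
  rw [← FreeGroup.mk_invRev]; rfl

theorem toWord_mk_singleton_mul (x : X × Bool) (g : FreeGroup X) :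
    (FreeGroup.mk [x] * g).toWord =
      match g.toWord with
      | [] => [x]
      | y :: l => if y = invLetter x then l else x :: y :: l := by
  rw [FreeGroup.toWord_mul, FreeGroup.toWord_mk, FreeGroup.reduce_singleton,
    List.singleton_append, FreeGroup.reduce.cons, FreeGroup.reduce_toWord]
  cases g.toWord with
  | nil => rfl
  | cons y l =>
    have : (x.1 = y.1 ∧ x.2 = !y.2) ↔ y = invLetter x := by
      rw [Prod.ext_iff]
      simp only [invLetter]
      constructor
      · rintro ⟨h1, h2⟩; exact ⟨h1.symm, by simp [h2]⟩
      · rintro ⟨h1, h2⟩; exact ⟨h1.symm, by simp [h2]⟩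
    simp only [this]

/-- Multiply the register `j` from the left by the letter `x`. -/
def absorb (x : X × Bool) (j : Option Reg) : RegProg X Reg :=
  iter (Sum.inr j) (fun _ => false) fun o =>
    match o with
    | some (AAGSymbol.letter y) =>
      if y = invLetter x then skip
      else seq (push (Sum.inr j) (AAGSymbol.letter y)) (push (Sum.inr j) (AAGSymbol.letter x))
    | _ => push (Sum.inr j) (AAGSymbol.letter x)

/-- Only the first letter of a reduced word can cancel with `x`, and it is the top of the stack: one
pop and at most two pushes. -/
theorem runsIn_absorb (x : X × Bool) (j : Option Reg) (T : Fin 5 → List (AAGSymbol X))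
    (R : Option Reg → FreeGroup X) :
    RunsIn (absorb x j) (regStacks T R) 3
      (regStacks T (Function.update R j (FreeGroup.mk [x] * R j))) := by
  have hw := toWord_mk_singleton_mul x (R j)
  rw [← regStacks_update, encodeElement, hw]
  cases h : (R j).toWord with
  | nil =>
    have h1 := FreeGroup.toWord_eq_nil_iff.1 h
    refine (RunsIn.last (head?_regStacks_of_eq_one h1) rfl (t := 1) ?_).mono (by norm_num)
    rw [update_tail_of_eq_one h1]
    convert RunsIn.push _ _ _ using 2
    simp [regStacks, h1]
  | cons y l =>
    refine (RunsIn.last (head?_regStacks_of_eq_cons h) rfl (t := 2) ?_).mono (by norm_num)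
    rw [update_tail_of_eq_cons h]
    by_cases hy : y = invLetter x
    · simp only [hy, if_true]
      refine (RunsIn.skip_of_eq ?_).mono one_le_two
      rw [← regStacks_update, encodeElement, toWord_mk_tail h]
    · simp only [hy, if_false]
      convert (RunsIn.push (Sum.inr j) _ (regStacks T _)).seq (RunsIn.push (Sum.inr j) _ _) using 1
      rw [← regStacks_update, encodeElement, toWord_mk_tail h]
      simp

/-- The registers `js` multiplied from the left by `g`. -/
def lmulAll (js : List (Option Reg)) (g : FreeGroup X) (R : Option Reg → FreeGroup X) :
    Option Reg → FreeGroup X :=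
  fun j => if j ∈ js then g * R j else R j

omit [DecidableEq X] in
theorem lmulAll_lmulAll (js : List (Option Reg)) (g h : FreeGroup X)
    (R : Option Reg → FreeGroup X) :
    lmulAll js g (lmulAll js h R) = lmulAll js (g * h) R := by
  funext j
  by_cases hj : j ∈ js <;> simp [lmulAll, hj, mul_assoc]

omit [DecidableEq X] in
theorem lmulAll_one (js : List (Option Reg)) (R : Option Reg → FreeGroup X) :
    lmulAll js 1 R = R := by
  funext j
  simp [lmulAll]

omit [DecidableEq X] in
theorem lmulAll_update {js : List (Option Reg)} {i : Option Reg} (hi : i ∉ js) (g h : FreeGroup X)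
    (R : Option Reg → FreeGroup X) :
    lmulAll js g (Function.update R i h) = Function.update (lmulAll js g R) i h := by
  funext j
  by_cases hj : j = i
  · subst hj; simp [lmulAll, hi]
  · simp [lmulAll, hj]

/-- Multiply the registers `js` from the left by the letter `x`. -/
def absorbAll (x : X × Bool) (js : List (Option Reg)) : RegProg X Reg :=
  js.foldr (fun j p => seq (absorb x j) p) skip

theorem runsIn_absorbAll (x : X × Bool) {js : List (Option Reg)} (hjs : js.Nodup)
    (T : Fin 5 → List (AAGSymbol X)) (R : Option Reg → FreeGroup X) :
    RunsIn (absorbAll x js) (regStacks T R) (3 * js.length + 1)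
      (regStacks T (lmulAll js (FreeGroup.mk [x]) R)) := by
  induction js generalizing R with
  | nil =>
    refine RunsIn.skip_of_eq (congrArg (regStacks T) ?_)
    funext i
    simp [lmulAll]
  | cons j js ih =>
    rw [List.nodup_cons] at hjs
    refine ((runsIn_absorb x j T R).seq (ih hjs.2 _)).of_eq (by simp; omega)
      (congrArg (regStacks T) ?_)
    funext i
    by_cases hi : i = j
    · subst hi; simp [lmulAll, hjs.1]
    · simp [lmulAll, hi]

/-- Multiply the registers `js` from the left by the inverse of the register `i`, which is
cleared. -/
def ldivs (i : Option Reg) (js : List (Option Reg)) : RegProg X Reg :=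
  iter (Sum.inr i) Option.isSome fun o =>
    match o with
    | some (AAGSymbol.letter x) => absorbAll (invLetter x) js
    | _ => skip

/-- The letters `x₁, …, x_n` leave the stack from the left, and successive left multiplication by
their inverses is multiplication by `x_n⁻¹ ⋯ x₁⁻¹`. Division, not multiplication, is therefore the
basic operation. -/
theorem runsIn_ldivs {i : Option Reg} {js : List (Option Reg)} (hjs : js.Nodup) (hi : i ∉ js)
    (T : Fin 5 → List (AAGSymbol X)) (R : Option Reg → FreeGroup X) :
    RunsIn (ldivs i js) (regStacks T R) ((3 * js.length + 2) * (R i).norm + 2)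
      (regStacks T (Function.update (lmulAll js (R i)⁻¹ R) i 1)) := by
  have main : ∀ (w : List (X × Bool)) (R : Option Reg → FreeGroup X), (R i).toWord = w →
      RunsIn (ldivs i js) (regStacks T R) ((3 * js.length + 2) * w.length + 2)
        (regStacks T (Function.update (lmulAll js (R i)⁻¹ R) i 1)) := by
    intro w
    induction w with
    | nil =>
      intro R h
      have h1 := FreeGroup.toWord_eq_nil_iff.1 h
      refine (RunsIn.last (head?_regStacks_of_eq_one h1) rfl (t := 1) ?_).mono (by simp)
      rw [update_tail_of_eq_one h1]
      refine RunsIn.skip_of_eq (congrArg (regStacks T) ?_)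
      rw [h1, inv_one, lmulAll_one, ← h1, Function.update_eq_self]
    | cons x l ih =>
      intro R h
      have ih' := ih (lmulAll js (FreeGroup.mk [invLetter x])
        (Function.update R i (FreeGroup.mk l))) (by
          simp [lmulAll, hi, toWord_mk_tail h, -FreeGroup.toWord_mk])
      have := RunsIn.next (S := regStacks T R) (cont := Option.isSome)
        (head?_regStacks_of_eq_cons h) rfl
        (by rw [update_tail_of_eq_cons h]; exact runsIn_absorbAll (invLetter x) hjs T _) ih'
      refine this.of_eq ?_ (congrArg (regStacks T) ?_)
      · simp only [List.length_cons]; ring_nf; omega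
      · have e : lmulAll js (FreeGroup.mk [invLetter x])
            (Function.update R i (FreeGroup.mk l)) i = FreeGroup.mk l := by simp [lmulAll, hi]
        rw [e, lmulAll_lmulAll, lmulAll_update hi, Function.update_idem, eq_mk_mul h, mul_inv_rev,
          mk_invLetter]
  exact main _ R rfl

/-! ### Powers of prescribed length in linear time. -/

/-- The number of passes of `powReg`. -/
def powCount (len c : ℕ) : ℕ := (len + c) / (c + 1)

theorem le_powCount_mul (len c : ℕ) : len ≤ powCount len c * (c + 1) := by
  have := Nat.div_add_mod (len + c) (c + 1)
  have := Nat.mod_lt (len + c) (show 0 < c + 1 by omega)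
  rw [powCount, mul_comm]
  omega

theorem powCount_mul_le (len c : ℕ) : powCount len c * (c + 1) ≤ len + c :=
  Nat.div_mul_le_self _ _

@[simp] theorem powCount_zero (c : ℕ) : powCount 0 c = 0 := by simp [powCount]

/-- This is the recursion of the loop in `powReg`: a round consumes one letter by its own pop and up
to `c` more in `powPass`. The extra letter makes the loop end even for the trivial base, where `c =
0`. -/
theorem powCount_succ (len c : ℕ) : powCount (len + 1) c = powCount (len - c) c + 1 := by
  rw [powCount, powCount, show len + 1 + c = len + (c + 1) by ring,
    Nat.add_div_right _ (Nat.succ_pos c)]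
  congr 1
  rcases le_total c len with h | h
  · rw [Nat.sub_add_cancel h]
  · rw [Nat.sub_eq_zero_of_le h, zero_add, Nat.div_eq_of_lt (by omega),
      Nat.div_eq_of_lt (by omega)]

/-- Remove the first letter of a register. -/
def dropLetter (j : Option Reg) : RegProg X Reg := iter (Sum.inr j) (fun _ => false) fun _ => skip

/-- The word of an element without its first letters. -/
def dropWord (n : ℕ) (g : FreeGroup X) : FreeGroup X := FreeGroup.mk (g.toWord.drop n)

theorem toWord_dropWord (n : ℕ) (g : FreeGroup X) : (dropWord n g).toWord = g.toWord.drop n :=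
  FreeGroup.toWord_mk_of_isReduced
    (FreeGroup.isReduced_toWord.infix (List.drop_suffix n _).isInfix)

theorem norm_dropWord (n : ℕ) (g : FreeGroup X) : (dropWord n g).norm = g.norm - n := by
  rw [FreeGroup.norm, toWord_dropWord, List.length_drop]; rfl

theorem runsIn_dropLetter (j : Option Reg) (T : Fin 5 → List (AAGSymbol X))
    (R : Option Reg → FreeGroup X) :
    RunsIn (dropLetter j) (regStacks T R) 2
      (regStacks T (Function.update R j (dropWord 1 (R j)))) := by
  cases h : (R j).toWord with
  | nil =>
    have h1 := FreeGroup.toWord_eq_nil_iff.1 h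
    refine RunsIn.last (head?_regStacks_of_eq_one h1) rfl (t := 1) ?_
    rw [update_tail_of_eq_one h1]
    refine RunsIn.skip_of_eq (congrArg (regStacks T) ?_)
    rw [show dropWord 1 (R j) = R j by rw [dropWord, h, h1]; rfl, Function.update_eq_self]
  | cons x l =>
    refine RunsIn.last (head?_regStacks_of_eq_cons h) rfl (t := 1) ?_
    rw [update_tail_of_eq_cons h]
    refine RunsIn.skip_of_eq (congrArg (regStacks T) ?_)
    rw [dropWord, h]; rfl

/-- One pass of `powReg`. -/
def powPass (i j k : Option Reg) : RegProg X Reg :=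
  iter (Sum.inr i) Option.isSome fun o =>
    match o with
    | some (AAGSymbol.letter x) => seq (absorbAll (invLetter x) [none, k]) (dropLetter j)
    | _ => skip

theorem runsIn_powPass {i j k : Option Reg} (hi : i ≠ none) (hj : j ≠ none) (hk : k ≠ none)
    (hij : i ≠ j) (hik : i ≠ k) (hjk : j ≠ k)
    (T : Fin 5 → List (AAGSymbol X)) (R : Option Reg → FreeGroup X) :
    RunsIn (powPass i j k) (regStacks T R) (10 * (R i).norm + 2)
      (regStacks T (Function.update (Function.update (lmulAll [none, k] (R i)⁻¹ R) i 1) j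
        (dropWord (R i).norm (R j)))) := by
  have hjs : [none, k].Nodup := by simpa using hk.symm
  have hi' : i ∉ [none, k] := by simp [hi, hik]
  have hj' : j ∉ [none, k] := by simp [hj, hjk]
  have main : ∀ (w : List (X × Bool)) (R : Option Reg → FreeGroup X), (R i).toWord = w →
      RunsIn (powPass i j k) (regStacks T R) (10 * w.length + 2)
        (regStacks T (Function.update (Function.update (lmulAll [none, k] (R i)⁻¹ R) i 1) j
          (dropWord w.length (R j)))) := by
    intro w
    induction w with
    | nil =>
      intro R h
      have h1 := FreeGroup.toWord_eq_nil_iff.1 h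
      refine (RunsIn.last (head?_regStacks_of_eq_one h1) rfl (t := 1) ?_).mono (by simp)
      rw [update_tail_of_eq_one h1]
      refine RunsIn.skip_of_eq (congrArg (regStacks T) ?_)
      rw [h1, inv_one, lmulAll_one, ← h1, Function.update_eq_self]
      simp [dropWord, FreeGroup.mk_toWord]
    | cons x l ih =>
      intro R h
      set R₁ := Function.update R i (FreeGroup.mk l) with hR₁
      set R₂ := lmulAll [none, k] (FreeGroup.mk [invLetter x]) R₁ with hR₂
      set R₃ := Function.update R₂ j (dropWord 1 (R₂ j)) with hR₃
      have e2 : R₂ i = FreeGroup.mk l := by simp [hR₂, lmulAll, hi, hik, hR₁]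
      have e2j : R₂ j = R j := by simp [hR₂, lmulAll, hj, hjk, hR₁, hij.symm]
      have e3 : R₃ i = FreeGroup.mk l := by simp [hR₃, hij, e2]
      have ih' := ih R₃ (by rw [e3, toWord_mk_tail h])
      have := RunsIn.next (S := regStacks T R) (cont := Option.isSome)
        (head?_regStacks_of_eq_cons h) rfl
        (by
          rw [update_tail_of_eq_cons h]
          exact (runsIn_absorbAll (invLetter x) hjs T R₁).seq (runsIn_dropLetter j T R₂)) ih'
      refine this.of_eq ?_ (congrArg (regStacks T) ?_)
      · simp only [List.length_cons, List.length_nil]; omega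
      · have e4 : dropWord (x :: l).length (R j) = dropWord l.length (R₃ j) := by
          rw [hR₃, Function.update_self, e2j, dropWord, dropWord, toWord_dropWord, List.drop_drop,
            List.length_cons, add_comm]
        have hx : FreeGroup.mk [invLetter x] = (FreeGroup.mk [x])⁻¹ := mk_invLetter x
        rw [e4, e3, hR₃, lmulAll_update hj', Function.update_comm hij.symm, Function.update_idem,
          hR₂, lmulAll_lmulAll, hR₁, lmulAll_update hi', Function.update_idem, eq_mk_mul h,
          mul_inv_rev, hx]
  exact main _ R rfl

/-- Multiply the register `k` from the left by a power of the inverse of the register `i`.  The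
length of the register `j`, which is cleared, determines the exponent. -/
def powReg (i j k : Reg) : RegProg X Reg :=
  iter (Sum.inr (some j)) Option.isSome fun o =>
    match o with
    | some (AAGSymbol.letter _) => seq (powPass (some i) (some j) (some k)) (ldivs none [some i])
    | _ => skip

/-- Each round moves the base through the scratch register and back. By `powCount_mul_le` the number
of rounds times the length of a round is linear in the lengths of `i` and `j`. -/
theorem runsIn_powReg {i j k : Reg} (hij : i ≠ j) (hik : i ≠ k) (hjk : j ≠ k)
    (T : Fin 5 → List (AAGSymbol X)) (R : Option Reg → FreeGroup X) (hR : R none = 1) :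
    RunsIn (powReg i j k) (regStacks T R)
      (powCount (R (some j)).norm (R (some i)).norm * (15 * (R (some i)).norm + 5) + 2)
      (regStacks T (Function.update (Function.update R (some k)
        ((R (some i) ^ powCount (R (some j)).norm (R (some i)).norm)⁻¹ * R (some k)))
          (some j) 1)) := by
  generalize hn : (R (some j)).norm = n
  induction n using Nat.strong_induction_on generalizing R with
  | _ n ih =>
    cases h : (R (some j)).toWord with
    | nil =>
      have h1 := FreeGroup.toWord_eq_nil_iff.1 h
      obtain rfl : n = 0 := by rw [← hn, h1]; rfl
      refine (RunsIn.last (head?_regStacks_of_eq_one h1) rfl (t := 1) ?_).mono (by simp)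
      rw [update_tail_of_eq_one h1]
      refine RunsIn.skip_of_eq (congrArg (regStacks T) ?_)
      rw [powCount_zero, pow_zero, inv_one, one_mul, Function.update_eq_self, ← h1,
        Function.update_eq_self]
    | cons x l =>
      have hl : n = l.length + 1 := by rw [← hn, FreeGroup.norm, h]; rfl
      set c := R (some i) with hc
      set R₁ := Function.update R (some j) (FreeGroup.mk l) with hR₁
      have e1i : R₁ (some i) = c := by simp [hR₁, hij, hc]
      have e1j : R₁ (some j) = FreeGroup.mk l := by simp [hR₁]
      have e1l : (FreeGroup.mk l).norm = l.length := by
        rw [FreeGroup.norm, toWord_mk_tail h]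
      have r1 := runsIn_powPass (i := some i) (j := some j) (k := some k) (by simp) (by simp)
        (by simp) (by simpa using hij) (by simpa using hik) (by simpa using hjk) T R₁
      rw [e1i, e1j] at r1
      set R₂ := Function.update (Function.update (lmulAll [none, some k] c⁻¹ R₁) (some i) 1)
        (some j) (dropWord c.norm (FreeGroup.mk l)) with hR₂
      have r2 := runsIn_ldivs (i := none) (js := [some i]) (by simp) (by simp) T R₂
      set R₃ := Function.update (lmulAll [some i] (R₂ none)⁻¹ R₂) none 1 with hR₃
      have e2n : R₂ none = c⁻¹ := by simp [hR₂, lmulAll, hR₁, hR]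
      have e3 : R₃ = Function.update (Function.update R (some k) (c⁻¹ * R (some k))) (some j)
          (dropWord c.norm (FreeGroup.mk l)) := by
        funext r
        rcases r with _ | r
        · simp [hR₃, hR]
        · by_cases h1 : r = i
          · subst h1; simp [hR₃, lmulAll, hR₂, hR₁, hR, hij, hik, hc]
          · by_cases h2 : r = j
            · subst h2; simp [hR₃, lmulAll, hR₂, h1]
            · by_cases h3 : r = k
              · subst h3; simp [hR₃, lmulAll, hR₂, h1, h2, hR₁]
              · simp [hR₃, lmulAll, hR₂, h1, h2, h3, hR₁]
      have e3n : R₃ none = 1 := by simp [hR₃]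
      have e3i : R₃ (some i) = c := by simp [e3, hij, hik, hc]
      have e3j : (R₃ (some j)).norm = l.length - c.norm := by
        rw [e3, Function.update_self, norm_dropWord, e1l]
      have e3k : R₃ (some k) = c⁻¹ * R (some k) := by simp [e3, hjk.symm]
      have ih' := ih (l.length - c.norm) (by omega) R₃ e3n e3j
      have := RunsIn.next (S := regStacks T R) (cont := Option.isSome)
        (head?_regStacks_of_eq_cons h) rfl
        (by
          rw [update_tail_of_eq_cons h]
          exact r1.seq r2) ih'
      refine this.of_eq ?_ (congrArg (regStacks T) ?_)
      · rw [hl, powCount_succ, e3i, e2n, FreeGroup.norm_inv_eq]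
        simp only [List.length_cons, List.length_nil]
        ring_nf
        omega
      · rw [e3i, e3k, hl, powCount_succ, e3, ← mul_assoc, ← mul_inv_rev, ← pow_succ']
        funext r
        by_cases h1 : r = some j
        · subst h1; simp
        · by_cases h2 : r = some k
          · subst h2; simp [h1]
          · simp [h1, h2]

/-! ### Comparison of two words letter by letter. -/

/-- One step of `zipReg`. -/
def zipBody (test : X × Bool → X × Bool → Bool) (i j k : Reg) :
    Option (AAGSymbol X) → RegProg X Reg
  | some (AAGSymbol.letter x) =>
    iter (Sum.inr (some j)) (fun _ => false) fun o =>
      match o with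
      | some (AAGSymbol.letter y) =>
        if test x y then absorb (invLetter y) (some k) else ldivs (some i) []
      | _ => ldivs (some i) []
  | _ => skip

/-- Compare the registers `i` and `j`, which are cleared, and multiply the register `k` from the
left by the inverse of the word of the letters of `j` for which `test` succeeds. -/
def zipReg (test : X × Bool → X × Bool → Bool) (i j k : Reg) : RegProg X Reg :=
  seq
    (iter (Sum.inr (some i)) Option.isSome (zipBody test i j k))
    (ldivs (some j) [])

theorem runsIn_clear (i : Option Reg) (T : Fin 5 → List (AAGSymbol X))
    (R : Option Reg → FreeGroup X) :
    RunsIn (ldivs i []) (regStacks T R) (2 * (R i).norm + 2)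
      (regStacks T (Function.update R i 1)) := by
  have := runsIn_ldivs (i := i) (js := []) (by simp) (by simp) T R
  have e : lmulAll [] (R i)⁻¹ R = R := by funext j; simp [lmulAll]
  rw [e] at this
  simpa using this

theorem runsIn_zipReg (test : X × Bool → X × Bool → Bool) {i j k : Reg} (hij : i ≠ j)
    (hik : i ≠ k) (hjk : j ≠ k) (T : Fin 5 → List (AAGSymbol X)) (R : Option Reg → FreeGroup X) :
    RunsIn (zipReg test i j k) (regStacks T R)
      (5 * (R (some i)).norm + 2 * (R (some j)).norm + 10)
      (regStacks T (Function.update (Function.update (Function.update R (some k)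
        ((FreeGroup.mk (zipTake test (R (some i)).toWord (R (some j)).toWord))⁻¹ * R (some k)))
          (some i) 1) (some j) 1)) := by
  -- The rest `g` that the loop leaves in `j` depends on where it stops. Only its length matters, as
  -- `j` is cleared afterwards.
  have main : ∀ (w : List (X × Bool)) (R : Option Reg → FreeGroup X), (R (some i)).toWord = w →
      ∃ g, g.norm ≤ (R (some j)).norm ∧ RunsIn
        (iter (Sum.inr (some i)) Option.isSome (zipBody test i j k))
        (regStacks T R) (5 * w.length + 6)
        (regStacks T (Function.update (Function.update (Function.update R (some k)
          ((FreeGroup.mk (zipTake test w (R (some j)).toWord))⁻¹ * R (some k)))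
            (some i) 1) (some j) g)) := by
    intro w
    induction w with
    | nil =>
      intro R h
      have h1 := FreeGroup.toWord_eq_nil_iff.1 h
      refine ⟨R (some j), le_rfl, ?_⟩
      refine (RunsIn.last (head?_regStacks_of_eq_one h1) rfl (t := 1) ?_).mono (by simp)
      rw [update_tail_of_eq_one h1]
      refine RunsIn.skip_of_eq (congrArg (regStacks T) ?_)
      rw [show (FreeGroup.mk (zipTake test [] (R (some j)).toWord))⁻¹ * R (some k) = R (some k) by
        simp [zipTake, ← FreeGroup.one_eq_mk], Function.update_eq_self, ← h1,
        Function.update_eq_self, Function.update_eq_self]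
    | cons x l ih =>
      intro R h
      have hl : (FreeGroup.mk l).norm = l.length := by rw [FreeGroup.norm, toWord_mk_tail h]
      set R₁ := Function.update R (some i) (FreeGroup.mk l) with hR₁
      have e1j : R₁ (some j) = R (some j) := by simp [hR₁, hij.symm]
      have e1i : R₁ (some i) = FreeGroup.mk l := by simp [hR₁]
      have e1k : R₁ (some k) = R (some k) := by simp [hR₁, hik.symm]
      have clear_i : ∀ R₂ : Option Reg → FreeGroup X, R₂ (some i) = FreeGroup.mk l →
          RunsIn (ldivs (some i) []) (regStacks T R₂) (2 * l.length + 2)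
            (regStacks T (Function.update R₂ (some i) 1)) := by
        intro R₂ h2
        have := runsIn_clear (some i) T R₂
        rwa [h2, hl] at this
      cases hj : (R (some j)).toWord with
      | nil =>
        have h1 := FreeGroup.toWord_eq_nil_iff.1 hj
        refine ⟨1, by simp, ?_⟩
        have e1j' : R₁ (some j) = 1 := e1j.trans h1
        have := RunsIn.next (S := regStacks T R) (cont := Option.isSome)
          (t := 1 + (2 * l.length + 2))
          (S' := regStacks T (Function.update R₁ (some i) 1)) (S'' :=
          regStacks T (Function.update R₁ (some i) 1)) (t' := 1 + 1)
          (body := zipBody test i j k) (head?_regStacks_of_eq_cons h) rfl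
          (by
            rw [update_tail_of_eq_cons h]
            rw [zipBody]
            refine RunsIn.last (head?_regStacks_of_eq_one e1j') rfl ?_
            rw [update_tail_of_eq_one e1j']
            exact clear_i R₁ e1i)
          (by
            have h0 : Function.update R₁ (some i) 1 (some i) = 1 := by simp
            refine RunsIn.last (cont := Option.isSome) (head?_regStacks_of_eq_one h0) rfl ?_
            rw [update_tail_of_eq_one h0]
            exact RunsIn.skip _)
        refine this.of_eq (by simp only [List.length_cons]; omega) (congrArg (regStacks T) ?_)
        rw [show (FreeGroup.mk (zipTake test (x :: l) []))⁻¹ * R (some k) = R (some k) by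
          simp [zipTake, ← FreeGroup.one_eq_mk], Function.update_eq_self, hR₁,
          Function.update_idem]
        refine (Function.update_eq_self_iff.2 ?_).symm
        simp [hij.symm, h1]
      | cons y m =>
        have hm : (FreeGroup.mk m).norm = m.length := by rw [FreeGroup.norm, toWord_mk_tail hj]
        have hjn : (R (some j)).norm = m.length + 1 := by rw [FreeGroup.norm, hj]; rfl
        set R₂ := Function.update R₁ (some j) (FreeGroup.mk m) with hR₂
        have e2i : R₂ (some i) = FreeGroup.mk l := by simp [hR₂, hij, e1i]
        have e2k : R₂ (some k) = R (some k) := by simp [hR₂, hjk.symm, e1k]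
        by_cases ht : test x y = true
        · set R₃ := Function.update R₂ (some k) (FreeGroup.mk [invLetter y] * R₂ (some k)) with hR₃
          have e3i : R₃ (some i) = FreeGroup.mk l := by simp [hR₃, hik, e2i]
          have e3j : R₃ (some j) = FreeGroup.mk m := by simp [hR₃, hjk, hR₂]
          obtain ⟨g, hg, ih'⟩ := ih R₃ (by rw [e3i, toWord_mk_tail h])
          refine ⟨g, hg.trans (by rw [e3j, hm, hjn]; omega), ?_⟩
          have := RunsIn.next (S := regStacks T R) (cont := Option.isSome) (S' := regStacks T R₃)
            (body := zipBody test i j k) (head?_regStacks_of_eq_cons h) rfl (t := 1 + 3)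
            (by
              rw [update_tail_of_eq_cons h]
              rw [zipBody]
              refine RunsIn.last (head?_regStacks_of_eq_cons (e1j ▸ hj)) rfl (t := 3) ?_
              rw [update_tail_of_eq_cons (e1j ▸ hj)]
              simp only [ht, if_true]
              exact runsIn_absorb (invLetter y) (some k) T R₂) ih'
          refine this.of_eq (by simp only [List.length_cons]; omega) (congrArg (regStacks T) ?_)
          have e4 : zipTake test (x :: l) (y :: m) = y :: zipTake test l m := by
            simp [zipTake, ht]
          rw [e4, e3j, toWord_mk_tail hj, ← List.singleton_append, ← FreeGroup.mul_mk, mul_inv_rev]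
          funext r
          by_cases r1 : r = some j
          · subst r1; simp
          · by_cases r2 : r = some i
            · subst r2; simp [r1]
            · by_cases r3 : r = some k
              · subst r3; simp [r1, r2, hR₃, e2k, mul_assoc, mk_invLetter,
                  -FreeGroup.inv_mk, -FreeGroup.mul_mk]
              · simp [r1, r2, r3, hR₃, hR₂, hR₁]
        · refine ⟨FreeGroup.mk m, by rw [hm, hjn]; omega, ?_⟩
          have := RunsIn.next (S := regStacks T R) (cont := Option.isSome)
            (t := 1 + (2 * l.length + 2))
            (S' := regStacks T (Function.update R₂ (some i) 1)) (S'' :=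
            regStacks T (Function.update R₂ (some i) 1)) (t' := 1 + 1)
            (body := zipBody test i j k) (head?_regStacks_of_eq_cons h) rfl
            (by
              rw [update_tail_of_eq_cons h]
              rw [zipBody]
              refine RunsIn.last (head?_regStacks_of_eq_cons (e1j ▸ hj)) rfl ?_
              rw [update_tail_of_eq_cons (e1j ▸ hj)]
              simp only [ht]
              exact clear_i R₂ e2i)
            (by
              have h0 : Function.update R₂ (some i) 1 (some i) = 1 := by simp
              refine RunsIn.last (cont := Option.isSome) (head?_regStacks_of_eq_one h0) rfl ?_
              rw [update_tail_of_eq_one h0]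
              exact RunsIn.skip _)
          refine this.of_eq (by simp only [List.length_cons]; omega) (congrArg (regStacks T) ?_)
          rw [show (FreeGroup.mk (zipTake test (x :: l) (y :: m)))⁻¹ * R (some k) = R (some k) by
            simp [zipTake, ht, ← FreeGroup.one_eq_mk], Function.update_eq_self, hR₂, hR₁,
            Function.update_comm (by simpa using hij.symm) _ _ (Function.update R _ _),
            Function.update_idem]
  obtain ⟨g, hg, h⟩ := main _ R rfl
  have h2 := runsIn_clear (some j) T (Function.update (Function.update (Function.update R (some k)
    ((FreeGroup.mk (zipTake test (R (some i)).toWord (R (some j)).toWord))⁻¹ * R (some k)))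
      (some i) 1) (some j) g)
  rw [Function.update_idem, Function.update_self] at h2
  refine (h.seq h2).mono ?_
  change 5 * (R (some i)).norm + 6 + _ ≤ _
  omega

end StackProg

/-! ### Programs for registers -/

/-- Programs for registers that hold elements of a free group. -/
inductive RegCode (Reg : Type) : Type
  | skip : RegCode Reg
  /-- Multiply the register `k` from the left by the register `i` or by its inverse. -/
  | mul (b : Bool) (i k : Reg) : RegCode Reg
  | clear (k : Reg) : RegCode Reg
  /-- Multiply the register `k` from the left by the inverse of the longest common prefix of the
  registers `i` and `j`, or of the prefix of `j` with the length of `i`; then clear both. -/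
  | zip (b : Bool) (i j k : Reg) : RegCode Reg
  /-- Multiply the register `k` from the left by a power of the inverse of the register `i` that
  is as long as the register `j`, which is cleared. -/
  | pow (i j k : Reg) : RegCode Reg
  | seq (p q : RegCode Reg) : RegCode Reg
  | ifOne (i : Reg) (p q : RegCode Reg) : RegCode Reg

namespace RegCode

open FreeGroup (zipTake)
open StackProg

variable {X Reg : Type} [DecidableEq Reg]

/-- Execute the programs of a list one after the other. -/
def ofList (l : List (RegCode Reg)) : RegCode Reg := l.foldr seq skip

/-- The registers of each instruction are different. -/
def ok : RegCode Reg → Bool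
  | skip => true
  | mul _ i k => i ≠ k
  | clear _ => true
  | zip _ i j k => i ≠ j ∧ i ≠ k ∧ j ≠ k
  | pow i j k => i ≠ j ∧ i ≠ k ∧ j ≠ k
  | seq p q => p.ok && q.ok
  | ifOne _ p q => p.ok && q.ok

variable [DecidableEq X]

/-- The test that belongs to a zip instruction. -/
def zipTest (b : Bool) (x y : X × Bool) : Bool := !b || decide (x = y)

/-- The element whose inverse a zip instruction multiplies with. -/
def zipElem (b : Bool) (g h : FreeGroup X) : FreeGroup X :=
  FreeGroup.mk (zipTake (zipTest b) g.toWord h.toWord)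

/-- The effect of a program. -/
def eval : RegCode Reg → (Reg → FreeGroup X) → (Reg → FreeGroup X)
  | skip, R => R
  | mul b i k, R => Function.update R k ((if b then R i else (R i)⁻¹) * R k)
  | clear k, R => Function.update R k 1
  | zip b i j k, R => Function.update (Function.update (Function.update R k
      ((zipElem b (R i) (R j))⁻¹ * R k)) i 1) j 1
  | pow i j k, R =>
    Function.update (Function.update R k ((R i ^ powCount (R j).norm (R i).norm)⁻¹ * R k)) j 1
  | seq p q, R => q.eval (p.eval R)
  | ifOne i p q, R => if R i = 1 then p.eval R else q.eval R

/-- The stack program that executes a program for registers. -/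
def compile : RegCode Reg → RegProg X Reg
  | skip => .skip
  -- Division empties its source. The scratch register holds the inverse for a moment, and a second
  -- division restores `i`.
  | mul true i k => .seq (ldivs (some i) [none]) (ldivs none [some i, some k])
  | mul false i k => .seq (ldivs (some i) [none, some k]) (ldivs none [some i])
  | clear k => ldivs (some k) []
  | zip b i j k => zipReg (zipTest b) i j k
  | pow i j k => powReg i j k
  | seq p q => .seq p.compile q.compile
  | ifOne i p q => .iter (Sum.inr (some i)) (fun _ => false) fun o =>
    match o with
    | some (AAGSymbol.letter x) =>
      -- The letter popped for the test is put back.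
      .seq (.push (Sum.inr (some i)) (AAGSymbol.letter x)) q.compile
    | _ => p.compile

/-- The registers together with an empty scratch register. -/
def withScratch (R : Reg → FreeGroup X) : Option Reg → FreeGroup X := fun o => o.elim 1 R

omit [DecidableEq Reg] [DecidableEq X] in
@[simp] theorem withScratch_none (R : Reg → FreeGroup X) : withScratch R none = 1 := rfl

omit [DecidableEq Reg] [DecidableEq X] in
@[simp] theorem withScratch_some (R : Reg → FreeGroup X) (i : Reg) :
    withScratch R (some i) = R i := rfl

omit [DecidableEq X] in
theorem withScratch_update (R : Reg → FreeGroup X) (i : Reg) (g : FreeGroup X) :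
    withScratch (Function.update R i g) = Function.update (withScratch R) (some i) g := by
  funext r
  rcases r with _ | r
  · simp
  · by_cases h : r = i
    · subst h; simp
    · simp [h]

/-- The total length of the registers. -/
def size [Fintype Reg] (R : Reg → FreeGroup X) : ℕ := ∑ i, (R i).norm

omit [DecidableEq Reg] in
theorem norm_le_size [Fintype Reg] (R : Reg → FreeGroup X) (i : Reg) : (R i).norm ≤ size R :=
  Finset.single_le_sum (f := fun i => (R i).norm) (fun _ _ => Nat.zero_le _) (Finset.mem_univ i)

omit [DecidableEq Reg] in
theorem stackSize_withScratch [Fintype Reg] (R : Reg → FreeGroup X) :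
    stackSize (regStacks (fun _ => []) (withScratch R)) = size R := by
  simp [stackSize, regStacks, size, encodeElement, FreeGroup.norm, Fintype.sum_option]

/-- Every instruction takes time linear in the total length of the registers. Since time bounds
growth, linear bounds can be composed, and `C` depends on the program alone because register
programs contain no general loop. -/
theorem exists_runsIn_compile [Fintype Reg] (p : RegCode Reg) (hp : p.ok = true) :
    ∃ C : ℕ, ∀ (T : Fin 5 → List (AAGSymbol X)) (R : Reg → FreeGroup X),
      RunsIn (X := X) p.compile (regStacks T (withScratch R)) (C * (size R + 1))
        (regStacks T (withScratch (p.eval R))) := by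
  induction p with
  | skip => exact ⟨1, fun T R => (RunsIn.skip _).mono (by omega)⟩
  | mul b i k =>
    have hik : i ≠ k := by simpa [ok] using hp
    refine ⟨20, fun T R => ?_⟩
    have hi := norm_le_size R i
    cases b
    · have hl := runsIn_ldivs (i := some i) (js := [none, some k]) (by simp) (by simpa using hik)
        T (withScratch R)
      refine (hl.seq (runsIn_ldivs (i := none) (js := [some i]) (by simp) (by simp) T _)).of_eq
        ?_ (congrArg (regStacks T) ?_)
      · simp [lmulAll]; omega
      · rw [eval, withScratch_update]
        funext r
        rcases r with _ | r
        · simp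
        · by_cases h1 : r = i
          · subst h1; simp [lmulAll, hik]
          · by_cases h2 : r = k
            · subst h2; simp [lmulAll, h1]
            · simp [lmulAll, h1, h2]
    · have hl := runsIn_ldivs (i := some i) (js := [none]) (by simp) (by simp)
        T (withScratch R)
      refine (hl.seq (runsIn_ldivs (i := none) (js := [some i, some k]) (by simpa using hik)
        (by simp) T _)).of_eq ?_ (congrArg (regStacks T) ?_)
      · simp [lmulAll]; omega
      · rw [eval, withScratch_update]
        funext r
        rcases r with _ | r
        · simp
        · by_cases h1 : r = i
          · subst h1; simp [lmulAll, hik]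
          · by_cases h2 : r = k
            · subst h2; simp [lmulAll, h1]
            · simp [lmulAll, h1, h2]
  | clear k =>
    refine ⟨2, fun T R => ?_⟩
    have hi := norm_le_size R k
    rw [eval, withScratch_update]
    refine (runsIn_clear (some k) T (withScratch R)).mono ?_
    rw [withScratch_some]
    omega
  | zip b i j k =>
    obtain ⟨hij, hik, hjk⟩ : i ≠ j ∧ i ≠ k ∧ j ≠ k := by simpa [ok] using hp
    refine ⟨10, fun T R => ?_⟩
    have hi := norm_le_size R i
    have hj := norm_le_size R j
    rw [eval, withScratch_update, withScratch_update, withScratch_update]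
    refine (runsIn_zipReg (zipTest b) hij hik hjk T (withScratch R)).mono ?_
    simp only [withScratch_some]
    omega
  | pow i j k =>
    obtain ⟨hij, hik, hjk⟩ : i ≠ j ∧ i ≠ k ∧ j ≠ k := by simpa [ok] using hp
    refine ⟨30, fun T R => ?_⟩
    have hi := norm_le_size R i
    have hj := norm_le_size R j
    rw [eval, withScratch_update, withScratch_update]
    refine (runsIn_powReg hij hik hjk T (withScratch R) rfl).mono ?_
    simp only [withScratch_some]
    have h1 := powCount_mul_le (R j).norm (R i).norm
    have h2 : powCount (R j).norm (R i).norm * (15 * (R i).norm + 5) ≤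
      15 * (powCount (R j).norm (R i).norm * ((R i).norm + 1)) := by
      rw [mul_left_comm]
      exact Nat.mul_le_mul_left _ (by omega)
    omega
  | seq p q ihp ihq =>
    simp only [ok, Bool.and_eq_true] at hp
    obtain ⟨C, hC⟩ := ihp hp.1
    obtain ⟨D, hD⟩ := ihq hp.2
    -- After `p` the size plus one has grown at most by the factor `C + 1`.
    refine ⟨C + D * (C + 1), fun T R => ((hC T R).seq (hD T _)).mono ?_⟩
    -- `eval` does not see the tapes, so its growth may be measured in a run with empty tapes.
    obtain ⟨t, ht, h⟩ := hC (fun _ => []) R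
    have := h.stackSize_le
    rw [stackSize_withScratch, stackSize_withScratch] at this
    calc C * (size R + 1) + D * (size (p.eval R) + 1)
        ≤ C * (size R + 1) + D * ((C + 1) * (size R + 1)) := by
          gcongr
          rw [add_mul, one_mul]
          omega
      _ = _ := by ring
  | ifOne i p q ihp ihq =>
    simp only [ok, Bool.and_eq_true] at hp
    obtain ⟨C, hC⟩ := ihp hp.1
    obtain ⟨D, hD⟩ := ihq hp.2
    refine ⟨C + D + 2, fun T R => ?_⟩
    rw [eval]
    cases h : (R i).toWord with
    | nil =>
      have h1 := FreeGroup.toWord_eq_nil_iff.1 h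
      rw [if_pos h1]
      refine (RunsIn.last (head?_regStacks_of_eq_one (R := withScratch R) (i := some i) h1) rfl
        (t := C * (size R + 1)) ?_).mono ?_
      · rw [update_tail_of_eq_one (R := withScratch R) (i := some i) h1]
        exact hC T R
      · ring_nf; omega
    | cons x l =>
      have h1 : R i ≠ 1 := fun h1 => by simp [h1] at h
      rw [if_neg h1]
      refine (RunsIn.last (head?_regStacks_of_eq_cons (R := withScratch R) (i := some i) h) rfl
        (t := 1 + D * (size R + 1)) ?_).mono ?_
      · rw [update_tail_of_eq_cons (R := withScratch R) (i := some i) h]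
        have := RunsIn.push (Sum.inr (some i)) (AAGSymbol.letter x)
          (regStacks T (Function.update (withScratch R) (some i) (FreeGroup.mk l)))
        refine (this.of_eq le_rfl ?_).seq (hD T R)
        have e : AAGSymbol.letter x :: regStacks T (Function.update (withScratch R) (some i)
            (FreeGroup.mk l)) (Sum.inr (some i)) = encodeElement (R i) := by
          simp [regStacks, encodeElement, toWord_mk_tail h, h, -FreeGroup.toWord_mk]
        rw [e, regStacks_update, Function.update_idem]
        congr 1
        exact Function.update_eq_self (some i) (withScratch R)
      · ring_nf; omega

end RegCode

/-! ### Computation of centers and of conjugates with registers -/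

namespace RegCode

open FreeGroup (hd core gcp center transport lcp zipTake zipTake_true)
open StackProg (powCount le_powCount_mul)

variable {X Main : Type} [DecidableEq X] [DecidableEq Main]

section vec

variable {β : Type*} (a0 a1 a2 a3 a4 a5 a6 a7 x : β)

theorem update_vec :
    Function.update ![a0, a1, a2, a3, a4, a5, a6, a7] 0 x = ![x, a1, a2, a3, a4, a5, a6, a7] ∧
    Function.update ![a0, a1, a2, a3, a4, a5, a6, a7] 1 x = ![a0, x, a2, a3, a4, a5, a6, a7] ∧
    Function.update ![a0, a1, a2, a3, a4, a5, a6, a7] 2 x = ![a0, a1, x, a3, a4, a5, a6, a7] ∧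
    Function.update ![a0, a1, a2, a3, a4, a5, a6, a7] 3 x = ![a0, a1, a2, x, a4, a5, a6, a7] ∧
    Function.update ![a0, a1, a2, a3, a4, a5, a6, a7] 4 x = ![a0, a1, a2, a3, x, a5, a6, a7] ∧
    Function.update ![a0, a1, a2, a3, a4, a5, a6, a7] 5 x = ![a0, a1, a2, a3, a4, x, a6, a7] ∧
    Function.update ![a0, a1, a2, a3, a4, a5, a6, a7] 6 x = ![a0, a1, a2, a3, a4, a5, x, a7] ∧
    Function.update ![a0, a1, a2, a3, a4, a5, a6, a7] 7 x = ![a0, a1, a2, a3, a4, a5, a6, x] := by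
  refine ⟨?_, ?_, ?_, ?_, ?_, ?_, ?_, ?_⟩ <;> funext i <;> fin_cases i <;> rfl

end vec

theorem zipElem_true (g h : FreeGroup X) : zipElem true g h = gcp g h := by
  rw [zipElem, gcp, lcp]
  congr 2

theorem zipElem_false (g h : FreeGroup X) :
    zipElem false g h = FreeGroup.mk (h.toWord.take g.norm) := by
  rw [zipElem, show (zipTest false : X × Bool → X × Bool → Bool) = fun _ _ => true by
    funext x y; simp [zipTest], zipTake_true]
  rfl

/-- The registers `R` together with empty auxiliary registers. -/
def withOnes (R : Main → FreeGroup X) : Main ⊕ Fin 8 → FreeGroup X :=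
  Sum.elim R ![1, 1, 1, 1, 1, 1, 1, 1]

/-- Compute `(hd v)⁻¹` and `core v` in the auxiliary registers `2` and `3`. -/
def hdCore (v : Main) : RegCode (Main ⊕ Fin 8) := ofList
  [mul true (.inl v) (.inr 0), mul false (.inl v) (.inr 1), zip true (.inr 0) (.inr 1) (.inr 2),
    mul false (.inr 2) (.inr 3), mul true (.inl v) (.inr 3), mul true (.inr 2) (.inr 3)]

theorem eval_hdCore (v : Main) (R : Main → FreeGroup X) (a4 a5 a6 a7 : FreeGroup X) :
    (hdCore v).eval (Sum.elim R ![1, 1, 1, 1, a4, a5, a6, a7]) =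
      Sum.elim R ![1, 1, (hd (R v))⁻¹, core (R v), a4, a5, a6, a7] := by
  simp only [hdCore, ofList, List.foldr, eval, zipElem_true, update_vec, Sum.elim_inl, Sum.elim_inr,
    Sum.update_elim_inr, Matrix.cons_val, if_true, mul_one, inv_inv,
    Bool.false_eq_true, if_false]
  rw [core, hd, mul_assoc]

/-- Multiply the auxiliary register `4` by the conjugate of `b` by the register `2`. -/
def conjCode (b : Main) : RegCode (Main ⊕ Fin 8) := ofList
  [mul false (.inr 2) (.inr 4), mul true (.inl b) (.inr 4), mul true (.inr 2) (.inr 4)]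

theorem eval_conjCode (b : Main) (R : Main → FreeGroup X) (a0 a1 h a3 a5 a6 a7 : FreeGroup X) :
    (conjCode b).eval (Sum.elim R ![a0, a1, h⁻¹, a3, 1, a5, a6, a7]) =
      Sum.elim R ![a0, a1, h⁻¹, a3, h⁻¹ * R b * h, a5, a6, a7] := by
  simp only [conjCode, ofList, List.foldr, eval, update_vec, Sum.elim_inl, Sum.elim_inr,
    Sum.update_elim_inr, Matrix.cons_val, if_true, mul_one, inv_inv,
    Bool.false_eq_true, if_false]
  rw [mul_assoc]

/-- Compute the inverse of a power of the auxiliary register `3` that is as long as the auxiliary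
register `4`. -/
def invPowCode : RegCode (Main ⊕ Fin 8) := ofList
  [mul true (.inr 4) (.inr 5), pow (.inr 3) (.inr 5) (.inr 6)]

theorem eval_invPowCode (R : Main → FreeGroup X) (a0 a1 a2 c d a7 : FreeGroup X) :
    invPowCode.eval (Sum.elim R ![a0, a1, a2, c, d, 1, 1, a7]) =
      Sum.elim R ![a0, a1, a2, c, d, 1, (c ^ powCount d.norm c.norm)⁻¹, a7] := by
  simp only [invPowCode, ofList, List.foldr, eval, update_vec, Sum.elim_inr,
    Sum.update_elim_inr, Matrix.cons_val, if_true, mul_one]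

/-- The inverse of the center of `u` and `v`. -/
def centerInv (u v : FreeGroup X) : FreeGroup X :=
  (center (4 * powCount ((hd v)⁻¹ * u * hd v).norm (core v).norm + 1) u v)⁻¹

/-- Compute the inverse of the center of `u` and `v`. -/
def centerCode (u v k : Main) : RegCode (Main ⊕ Fin 8) :=
  seq (hdCore v) (seq (conjCode u) (seq invPowCode (ofList
  [mul true (.inr 6) (.inr 5), mul true (.inr 6) (.inr 5), mul true (.inr 6) (.inr 5),
    mul true (.inr 6) (.inr 5), mul false (.inr 3) (.inr 5), clear (.inr 3), clear (.inr 6),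
    mul false (.inr 5) (.inr 0), mul true (.inr 4) (.inr 0), clear (.inr 4),
    mul false (.inr 5) (.inr 1), mul true (.inr 0) (.inr 7), zip true (.inr 0) (.inr 1) (.inr 2),
    zip true (.inr 7) (.inr 5) (.inr 2), clear (.inl k), mul true (.inr 2) (.inl k),
    clear (.inr 2)])))

/-- The auxiliary register `5` receives `c^{-N}` with `N = 4n + 1`. The two zip instructions then
divide `(hd v)⁻¹` by the two common prefixes, which is why the inverse of the center appears. -/
theorem eval_centerCode (u v k : Main) (R : Main → FreeGroup X) :
    (centerCode u v k).eval (withOnes R) =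
      withOnes (Function.update R k (centerInv (R u) (R v))) := by
  rw [centerCode, eval, eval, eval, withOnes, eval_hdCore, eval_conjCode, eval_invPowCode,
    centerInv, center]
  generalize (hd (R v))⁻¹ * R u * hd (R v) = g
  generalize core (R v) = c
  generalize powCount _ _ = n
  have hD : c⁻¹ * ((c ^ n)⁻¹ * ((c ^ n)⁻¹ * ((c ^ n)⁻¹ * (c ^ n)⁻¹))) = (c ^ (4 * n + 1))⁻¹ := by
    group
  simp only [ofList, List.foldr, eval, zipElem_true, update_vec, Sum.elim_inl, Sum.elim_inr,
    Sum.update_elim_inl, Sum.update_elim_inr, Matrix.cons_val, if_true, mul_one, inv_inv,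
    Bool.false_eq_true, if_false]
  simp only [hD, inv_inv, Function.update_idem, Function.update_self, mul_one, withOnes]
  congr 2
  group

/-- Compute the conjugate of `b` by an element that conjugates `v` to `v'`, if `b` commutes with
`v`. -/
def transportCode (v v' b k : Main) : RegCode (Main ⊕ Fin 8) :=
  seq (hdCore v) (seq (conjCode b) (seq invPowCode (seq (ofList
  [clear (.inr 2), clear (.inr 3), mul false (.inr 6) (.inr 7), mul false (.inr 6) (.inr 7),
    mul true (.inr 4) (.inr 7), clear (.inr 6)]) (seq (hdCore v') (seq invPowCode (ofList
  [mul false (.inr 6) (.inr 0), mul false (.inr 6) (.inr 0), mul false (.inr 6) (.inr 0),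
    mul false (.inr 6) (.inr 0), zip false (.inr 7) (.inr 0) (.inr 1), mul true (.inr 2) (.inr 5),
    mul true (.inr 6) (.inr 5), mul true (.inr 6) (.inr 5), mul false (.inr 1) (.inr 5),
    mul false (.inr 2) (.inr 5), clear (.inl k), mul true (.inr 5) (.inl k), clear (.inr 1),
    clear (.inr 2), clear (.inr 3), clear (.inr 4), clear (.inr 5), clear (.inr 6)]))))))

/-- The conjugate of `b` by an element that conjugates `v` to `v'`, if `b` commutes with `v`. -/
def transportOf (v v' b : FreeGroup X) : FreeGroup X :=
  transport (2 * powCount ((hd v)⁻¹ * b * hd v).norm (core v).norm)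
    (4 * powCount ((hd v)⁻¹ * b * hd v).norm (core v).norm) v v' b

/-- The program determines the exponent a second time, now from the core of `v'`; `hn` makes it
agree with the exponent found for `v`. -/
theorem eval_transportCode (v v' b k : Main) (R : Main → FreeGroup X)
    (hn : (core (R v')).norm = (core (R v)).norm) :
    (transportCode v v' b k).eval (withOnes R) =
      withOnes (Function.update R k (transportOf (R v) (R v') (R b))) := by
  rw [transportCode, eval, eval, eval, eval, eval, eval, withOnes, eval_hdCore, eval_conjCode,
    eval_invPowCode, transportOf, transport]
  generalize (hd (R v))⁻¹ * R b * hd (R v) = d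
  generalize core (R v) = c at *
  generalize hm : powCount d.norm c.norm = n
  have h1 : d * (c ^ n * c ^ n) = d * c ^ (2 * n) := by rw [two_mul, pow_add]
  have e1 : (ofList [clear (.inr 2), clear (.inr 3), mul false (.inr 6) (.inr 7),
      mul false (.inr 6) (.inr 7), mul true (.inr 4) (.inr 7), clear (.inr 6)]).eval
      (Sum.elim R ![1, 1, (hd (R v))⁻¹, c, d, 1, (c ^ n)⁻¹, 1]) =
      Sum.elim R ![1, 1, 1, 1, d, 1, 1, d * c ^ (2 * n)] := by
    simp only [ofList, List.foldr, eval, update_vec, Sum.elim_inr,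
      Sum.update_elim_inr, Matrix.cons_val, if_true, mul_one, inv_inv,
    Bool.false_eq_true, if_false]
    rw [h1]
  rw [e1, eval_hdCore, eval_invPowCode, hn, hm]
  generalize core (R v') = c'
  generalize d * c ^ (2 * n) = f
  have h2 : c' ^ n * (c' ^ n * (c' ^ n * c' ^ n)) = c' ^ (4 * n) := by
    rw [← pow_add, ← pow_add, ← pow_add]; congr 1; ring
  simp only [ofList, List.foldr, eval, zipElem_false, update_vec, Sum.elim_inl, Sum.elim_inr,
    Sum.update_elim_inl, Sum.update_elim_inr, Matrix.cons_val, if_true, mul_one, inv_inv,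
    Bool.false_eq_true, if_false]
  simp only [h2, Function.update_idem, Function.update_self, mul_one, withOnes]
  congr 2
  rw [two_mul, pow_add]
  group

/-- Execute `p` if `u` and `v` commute and `q` otherwise. -/
def ifComm (u v : Main) (p q : RegCode (Main ⊕ Fin 8)) : RegCode (Main ⊕ Fin 8) := seq (ofList
  [mul true (.inl v) (.inr 0), mul true (.inl u) (.inr 0), mul false (.inl v) (.inr 0),
    mul false (.inl u) (.inr 0)]) (ifOne (.inr 0) p (seq (clear (.inr 0)) q))

theorem eval_ifComm (u v : Main) (p q : RegCode (Main ⊕ Fin 8)) (R : Main → FreeGroup X) :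
    (ifComm u v p q).eval (withOnes R) =
      if R u * R v = R v * R u then p.eval (withOnes R) else q.eval (withOnes R) := by
  have h : (R u)⁻¹ * ((R v)⁻¹ * (R u * R v)) = 1 ↔ R u * R v = R v * R u := by
    rw [← mul_assoc, ← mul_inv_rev, inv_mul_eq_one, eq_comm]
  rw [ifComm, withOnes]
  simp only [ofList, List.foldr, eval, update_vec, Sum.elim_inl, Sum.elim_inr,
    Sum.update_elim_inr, Matrix.cons_val, if_true, mul_one,
    Bool.false_eq_true, if_false]
  by_cases hc : R u * R v = R v * R u
  · rw [if_pos hc, if_pos (h.2 hc), h.2 hc]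
  · rw [if_neg hc, if_neg (h.not.2 hc)]

/-- The two cores are conjugate, and both are shortest in their conjugacy class by
`norm_le_of_conj`. -/
theorem norm_core_conj (v a : FreeGroup X) : (core (a⁻¹ * v * a)).norm = (core v).norm := by
  have key : ∀ v a : FreeGroup X, (core (a⁻¹ * v * a)).norm ≤ (core v).norm := by
    intro v a
    rcases eq_or_ne v 1 with rfl | hv
    · simp
    have hv' : a⁻¹ * v * a ≠ 1 := fun h => hv (by
      have : v = a * (a⁻¹ * v * a) * a⁻¹ := by group
      rw [this, h]; group)
    have e : core (a⁻¹ * v * a) = ((hd v)⁻¹ * a * hd (a⁻¹ * v * a))⁻¹ * core v *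
        ((hd v)⁻¹ * a * hd (a⁻¹ * v * a)) := by
      rw [core, core]; group
    have := FreeGroup.norm_le_of_conj (d := core v) (y := (hd v)⁻¹ * a * hd (a⁻¹ * v * a))
      (FreeGroup.isCyclicallyReduced_core v) (mt FreeGroup.core_eq_one_iff.1 hv)
      (FreeGroup.isCyclicallyReduced_core (a⁻¹ * v * a)) (mt FreeGroup.core_eq_one_iff.1 hv')
      (Commute.refl _)
    rw [← e] at this
    exact this (Commute.refl _)
  refine (key v a).antisymm ?_
  have := key (a⁻¹ * v * a) a⁻¹
  rwa [show a⁻¹⁻¹ * (a⁻¹ * v * a) * a⁻¹ = v by group] at this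

/-- An element is determined by its action on two elements that do not commute. -/
theorem centerInv_inv_mul {u v x : FreeGroup X} (h : ¬ Commute u v) :
    (centerInv u v)⁻¹ * centerInv (x⁻¹ * u * x) (x⁻¹ * v * x) = x := by
  -- For `c = |core v| ≥ 1` one has `2c ≥ c + 1`, so `4 * powCount` periods have length at least `2
  -- * powCount * (c + 1)`, twice the length required. The additional period accounts for the
  -- summand `|core v|`.
  have key : ∀ u v : FreeGroup X, v ≠ 1 → 2 * ((hd v)⁻¹ * u * hd v).norm + (core v).norm ≤
      (4 * powCount ((hd v)⁻¹ * u * hd v).norm (core v).norm + 1) * (core v).norm := by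
    intro u v hv
    have h1 := FreeGroup.norm_pos (mt FreeGroup.core_eq_one_iff.1 hv)
    have h2 := le_powCount_mul ((hd v)⁻¹ * u * hd v).norm (core v).norm
    nlinarith
  have hv : v ≠ 1 := by rintro rfl; exact h (Commute.one_right u)
  have hv' : x⁻¹ * v * x ≠ 1 := fun h => hv (by
    have : v = x * (x⁻¹ * v * x) * x⁻¹ := by group
    rw [this, h]; group)
  rw [centerInv, centerInv, inv_inv]
  exact FreeGroup.center_mul_inv_center h (key u v hv) (key _ _ hv')

theorem transportOf_eq {v b a : FreeGroup X} (hb : Commute b v) (hv : v = 1 → b = 1) :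
    transportOf v (a⁻¹ * v * a) b = a⁻¹ * b * a := by
  have h2 := le_powCount_mul ((hd v)⁻¹ * b * hd v).norm (core v).norm
  have h3 : ((hd v)⁻¹ * b * hd v).norm ≤
      2 * powCount ((hd v)⁻¹ * b * hd v).norm (core v).norm * (core v).norm := by
    rcases eq_or_ne v 1 with h | h
    · simp [hv h]
    · have h1 := FreeGroup.norm_pos (mt FreeGroup.core_eq_one_iff.1 h)
      nlinarith
  refine FreeGroup.transport_eq hb hv h3 ?_
  rw [norm_core_conj]
  linarith

end RegCode

/-! ### Computation of the shared key with registers -/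

/-- `r₁` and `r₂` stand for a set `S` of elements: they are trivial only if `S` is trivial or
commutative; `r₁'` and `r₂'` are the conjugates by `x`. -/
structure IsSelection {X : Type} (S : Set (FreeGroup X)) (x r₁ r₁' r₂ r₂' : FreeGroup X) :
    Prop where
  eq₁ : r₁' = x⁻¹ * r₁ * x
  eq₂ : r₂' = x⁻¹ * r₂ * x
  trivial_of : r₁ = 1 → ∀ g ∈ S, g = 1
  commute_of : r₂ = 1 → ∀ g ∈ S, Commute g r₁
  not_commute : r₂ ≠ 1 → ¬ Commute r₁ r₂

namespace IsSelection

variable {X : Type} {S : Set (FreeGroup X)} {x y r₁ r₁' r₂ r₂' : FreeGroup X}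

theorem empty (x : FreeGroup X) : IsSelection ∅ x 1 1 1 1 where
  eq₁ := by group
  eq₂ := by group
  trivial_of := by simp
  commute_of := by simp
  not_commute := by simp

theorem commute_mem (h : IsSelection S x r₁ r₁' r₂ r₂') (h2 : r₂ = 1)
    (hy : y ∈ Subgroup.closure S) : Commute y r₁ := by
  have : Subgroup.closure S ≤ Subgroup.centralizer {r₁} := by
    rw [Subgroup.closure_le]
    intro g hg
    rw [SetLike.mem_coe, Subgroup.mem_centralizer_singleton_iff]
    exact (h.commute_of h2 g hg).eq
  exact Subgroup.mem_centralizer_singleton_iff.1 (this hy)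

theorem eq_one_of_mem (h : IsSelection S x r₁ r₁' r₂ r₂') (h1 : r₁ = 1)
    (hy : y ∈ Subgroup.closure S) : y = 1 := by
  have : Subgroup.closure S ≤ ⊥ := by
    rw [Subgroup.closure_le]
    intro g hg
    simpa using h.trivial_of h1 g hg
  simpa using this hy

end IsSelection

namespace RegCode

open FreeGroup (hd core)

variable {X : Type} [DecidableEq X]

/-- Fourteen main registers and the auxiliary registers. -/
abbrev KeyReg : Type := Fin 14 ⊕ Fin 8

theorem eval_mul_inl {Main : Type} [DecidableEq Main] (b : Bool) (i k : Main)
    (R : Main → FreeGroup X) :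
    (mul b (.inl i) (.inl k)).eval (withOnes R) =
      withOnes (Function.update R k ((if b then R i else (R i)⁻¹) * R k)) := by
  rw [eval, withOnes, Sum.update_elim_inl]; rfl

theorem eval_clear_inl {Main : Type} [DecidableEq Main] (k : Main)
    (R : Main → FreeGroup X) :
    (clear (.inl k)).eval (withOnes R) = withOnes (Function.update R k 1) := by
  rw [eval, withOnes, Sum.update_elim_inl]; rfl

theorem eval_ifOne_inl {Main : Type} [DecidableEq Main] (i : Main) (p q : RegCode (Main ⊕ Fin 8))
    (R : Main → FreeGroup X) :
    (ifOne (.inl i) p q).eval (withOnes R) =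
      if R i = 1 then p.eval (withOnes R) else q.eval (withOnes R) := rfl

theorem eval_skip {Reg : Type} [DecidableEq Reg] (R : Reg → FreeGroup X) : skip.eval R = R := rfl

theorem eval_seq {Reg : Type} [DecidableEq Reg] (p q : RegCode Reg) (R : Reg → FreeGroup X) :
    (seq p q).eval R = q.eval (p.eval R) := rfl

theorem eval_ofList_cons {Reg : Type} [DecidableEq Reg] (p : RegCode Reg) (l : List (RegCode Reg))
    (R : Reg → FreeGroup X) : (ofList (p :: l)).eval R = (ofList l).eval (p.eval R) := rfl

theorem eval_ofList_nil {Reg : Type} [DecidableEq Reg] (R : Reg → FreeGroup X) :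
    (ofList []).eval R = R := rfl

/-- Recover a secret that commutes with `b₁` in the register `11` and its conjugate by the other
secret in the register `12`. -/
def halfCode (a₁ a₁' a₂ a₂' b₁ b₁' : Fin 14) : RegCode KeyReg :=
  seq (ifComm a₁ b₁ (ofList [mul true (.inl a₂) (.inl 8), mul true (.inl a₂') (.inl 9)])
    (ofList [mul true (.inl a₁) (.inl 8), mul true (.inl a₁') (.inl 9)]))
  (ofList [centerCode 8 b₁ 10, centerCode 9 b₁ 11, mul false (.inl 10) (.inl 11),
    transportCode b₁ b₁' 11 12])

/-- `y` centralizes `R b₁`, so it conjugates the pair `(u, R b₁)` to `(u', R b₁)` for each selected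
`u` of the other party. If `u` does not commute with `R b₁`, this recovers `y`, and `transportOf`
gives its conjugate by `x`. If no such `u` exists, `x` and `y` commute, and the program computes the
trivial element. -/
theorem eval_halfCode {a₁ a₁' a₂ a₂' b₁ b₁' : Fin 14} {R : Fin 14 → FreeGroup X}
    {S : Set (FreeGroup X)} {x y : FreeGroup X}
    (ha : a₁ < 8 ∧ a₁' < 8 ∧ a₂ < 8 ∧ a₂' < 8) (hb : b₁ < 8 ∧ b₁' < 8)
    (h : IsSelection S y (R a₁) (R a₁') (R a₂) (R a₂')) (hx : x ∈ Subgroup.closure S)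
    (h1 : R b₁' = x⁻¹ * R b₁ * x) (hy : Commute y (R b₁)) (hy1 : R b₁ = 1 → y = 1)
    (h8 : ∀ i, 8 ≤ i → R i = 1) :
    ∃ R' e f, (halfCode a₁ a₁' a₂ a₂' b₁ b₁').eval (withOnes R) = withOnes R' ∧
      R' 11 = e ∧ R' 12 = f ∧ R' 13 = 1 ∧ f⁻¹ * e = x⁻¹ * y⁻¹ * x * y := by
  obtain ⟨u, u', hu, heval⟩ : ∃ u u', ((u' = y⁻¹ * u * y ∧ ¬ Commute u (R b₁)) ∨
      (u = u' ∧ Commute x y)) ∧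
      (ifComm a₁ b₁ (ofList [mul true (.inl a₂) (.inl 8), mul true (.inl a₂') (.inl 9)])
        (ofList [mul true (.inl a₁) (.inl 8), mul true (.inl a₁') (.inl 9)])).eval (withOnes R) =
      withOnes (Function.update (Function.update R 8 u) 9 u') := by
    rw [eval_ifComm]
    by_cases hc : R a₁ * R b₁ = R b₁ * R a₁
    · refine ⟨R a₂, R a₂', ?_, ?_⟩
      · by_cases hc2 : Commute (R a₂) (R b₁)
        · refine Or.inr ?_
          rcases eq_or_ne (R b₁) 1 with hb1 | hb1
          · rw [h.eq₂, hy1 hb1]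
            simp
          -- Both selected elements commute with `R b₁ ≠ 1`, hence with each other, so the second
          -- one must be trivial.
          · have h12 : R a₂ = 1 := by
              by_contra h2
              exact h.not_commute h2 (FreeGroup.commute_trans hb1 hc hc2)
            refine ⟨by rw [h.eq₂, h12]; group, ?_⟩
            rcases eq_or_ne (R a₁) 1 with ha1 | ha1
            · rw [h.eq_one_of_mem ha1 hx]
              exact Commute.one_left y
            · have e1 := FreeGroup.commute_trans ha1 (h.commute_mem h12 hx) hc.symm
              exact FreeGroup.commute_trans hb1 e1 hy
        · exact Or.inl ⟨h.eq₂, hc2⟩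
      · rw [if_pos hc]
        simp only [eval_ofList_cons, eval_ofList_nil, eval_mul_inl, if_true]
        rw [h8 8 le_rfl, mul_one]
        have : a₂' ≠ 8 := ha.2.2.2.ne
        simp [h8 9 (by decide), this]
    · refine ⟨R a₁, R a₁', Or.inl ⟨h.eq₁, hc⟩, ?_⟩
      rw [if_neg hc]
      simp only [eval_ofList_cons, eval_ofList_nil, eval_mul_inl, if_true]
      rw [h8 8 le_rfl, mul_one]
      have : a₁' ≠ 8 := ha.2.1.ne
      simp [h8 9 (by decide), this]
  have b8 : b₁ ≠ 8 ∧ b₁ ≠ 9 ∧ b₁ ≠ 10 ∧ b₁ ≠ 11 := by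
    have := hb.1
    refine ⟨?_, ?_, ?_, ?_⟩ <;> rintro rfl <;> revert this <;> decide
  have b8' : b₁' ≠ 8 ∧ b₁' ≠ 9 ∧ b₁' ≠ 10 ∧ b₁' ≠ 11 := by
    have := hb.2
    refine ⟨?_, ?_, ?_, ?_⟩ <;> rintro rfl <;> revert this <;> decide
  have hcore : (core (R b₁')).norm = (core (R b₁)).norm := by rw [h1, norm_core_conj]
  rw [halfCode, eval_seq, heval]
  simp only [eval_ofList_cons, eval_ofList_nil, eval_centerCode, eval_mul_inl]
  rw [eval_transportCode _ _ _ _ _ (by simpa [b8, b8'] using hcore)]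
  refine ⟨_, _, _, rfl, rfl, rfl, by simp [h8 13 (by decide)], ?_⟩
  suffices H : (transportOf (R b₁) (R b₁') ((centerInv u (R b₁))⁻¹ * centerInv u' (R b₁)))⁻¹ *
      ((centerInv u (R b₁))⁻¹ * centerInv u' (R b₁)) = x⁻¹ * y⁻¹ * x * y by
    simpa [b8, b8'] using H
  rw [h1]
  rcases hu with ⟨hu, hub⟩ | ⟨rfl, hxy⟩
  · have e1 : R b₁ = y⁻¹ * R b₁ * y := by rw [mul_assoc, ← hy.eq]; group
    have e2 : (centerInv u (R b₁))⁻¹ * centerInv u' (R b₁) = y := by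
      conv_lhs => rw [hu, show centerInv (y⁻¹ * u * y) (R b₁) =
        centerInv (y⁻¹ * u * y) (y⁻¹ * R b₁ * y) by rw [← e1]]
      exact centerInv_inv_mul hub
    rw [e2, transportOf_eq hy hy1]
    group
  · rw [inv_mul_cancel, transportOf_eq (Commute.one_left _) (fun _ => rfl),
      mul_assoc, mul_assoc, hxy.eq]
    group

/-- Compute the inverse of the shared key in the register `13`. -/
def keyCode : RegCode KeyReg :=
  seq (ifOne (.inl 6) (seq (halfCode 0 1 2 3 4 5) (ofList
      [mul true (.inl 12) (.inl 13), mul false (.inl 11) (.inl 13)]))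
    (ifOne (.inl 2) (seq (halfCode 4 5 6 7 0 1) (ofList
        [mul true (.inl 11) (.inl 13), mul false (.inl 12) (.inl 13)]))
      (ofList [centerCode 4 6 8, centerCode 5 7 9, centerCode 0 2 10, centerCode 1 3 11,
        mul false (.inl 8) (.inl 9), mul false (.inl 10) (.inl 11), mul true (.inl 9) (.inl 13),
        mul true (.inl 11) (.inl 13), mul false (.inl 9) (.inl 13),
        mul false (.inl 11) (.inl 13)])))
  (ofList ((List.finRange 13).map fun i => clear (.inl i.castSucc)))

theorem ok_keyCode : keyCode.ok = true := by decide

theorem eval_clear_all (R : Fin 14 → FreeGroup X) :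
    (ofList ((List.finRange 13).map fun i => clear (.inl i.castSucc)) : RegCode KeyReg).eval
      (withOnes R) = withOnes (Function.update (fun _ => 1) 13 (R 13)) := by
  have key : ∀ (l : List (Fin 13)) (R : Fin 14 → FreeGroup X),
      (ofList (l.map fun i => clear (.inl i.castSucc)) : RegCode KeyReg).eval (withOnes R) =
        withOnes (fun i => if i ∈ l.map Fin.castSucc then 1 else R i) := by
    intro l
    induction l with
    | nil => intro R; simp [eval_ofList_nil]
    | cons a l ih =>
      intro R
      rw [List.map_cons, eval_ofList_cons, eval_clear_inl, ih]
      congr 1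
      funext i
      by_cases h : i = a.castSucc
      · subst h; simp
      · simp [h]
  rw [key]
  congr 1
  funext i
  fin_cases i <;> rfl

/-- A trivial register `6` means that Bob's group is commutative, a trivial register `2` the same
for Alice's; `halfCode` then applies with the roles `(a, b)` or `(b, a)`. In the remaining case both
secrets come from centers of noncommuting pairs. -/
theorem eval_keyCode {R : Fin 14 → FreeGroup X} {A B : Set (FreeGroup X)} {a b : FreeGroup X}
    (hA : IsSelection A b (R 0) (R 1) (R 2) (R 3)) (hB : IsSelection B a (R 4) (R 5) (R 6) (R 7))
    (ha : a ∈ Subgroup.closure A) (hb : b ∈ Subgroup.closure B) (h8 : ∀ i, 8 ≤ i → R i = 1) :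
    keyCode.eval (withOnes R) =
      withOnes (Function.update (fun _ => 1) 13 (a⁻¹ * b⁻¹ * a * b)⁻¹) := by
  rw [keyCode, eval_seq]
  suffices h : ∃ R' : Fin 14 → FreeGroup X, eval _ (withOnes R) = withOnes R' ∧
      R' 13 = (a⁻¹ * b⁻¹ * a * b)⁻¹ by
    obtain ⟨R', h1, h2⟩ := h
    rw [h1, eval_clear_all, h2]
  rw [eval_ifOne_inl]
  split_ifs with h6
  · obtain ⟨R', e, f, h1, h2, h3, h4, h5⟩ := eval_halfCode (x := a) (y := b) (by decide)
      (by decide) hA ha hB.eq₁ (hB.commute_mem h6 hb) (fun h => hB.eq_one_of_mem h hb) h8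
    rw [eval_seq, h1]
    simp only [eval_ofList_cons, eval_ofList_nil, eval_mul_inl]
    refine ⟨_, rfl, ?_⟩
    rw [← h5]
    simp [h2, h3, h4]
  rw [eval_ifOne_inl]
  split_ifs with h2
  · obtain ⟨R', e, f, h1, h2, h3, h4, h5⟩ := eval_halfCode (x := b) (y := a) (by decide)
      (by decide) hB hb hA.eq₁ (hA.commute_mem h2 ha) (fun h => hA.eq_one_of_mem h ha) h8
    rw [eval_seq, h1]
    simp only [eval_ofList_cons, eval_ofList_nil, eval_mul_inl]
    refine ⟨_, rfl, ?_⟩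
    rw [show (a⁻¹ * b⁻¹ * a * b)⁻¹ = b⁻¹ * a⁻¹ * b * a by group, ← h5]
    simp [h2, h3, h4]
  · simp only [eval_ofList_cons, eval_ofList_nil, eval_centerCode, eval_mul_inl]
    refine ⟨_, rfl, ?_⟩
    have e1 : (centerInv (R 4) (R 6))⁻¹ * centerInv (R 5) (R 7) = a := by
      rw [hB.eq₁, hB.eq₂]
      exact centerInv_inv_mul (hB.not_commute h6)
    have e2 : (centerInv (R 0) (R 2))⁻¹ * centerInv (R 1) (R 3) = b := by
      rw [hA.eq₁, hA.eq₂]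
      exact centerInv_inv_mul (hA.not_commute h2)
    have e3 := h8 13 (by decide)
    simp [e1, e2, e3, mul_assoc]

/-! ### Updating the selection. -/

/-- Take the elements of the registers `8` and `9` into account in a selection. -/
def selectCode (r₁ r₁' r₂ r₂' : Fin 14) : RegCode KeyReg :=
  seq (ifOne (.inl r₁) (ofList [mul true (.inl 8) (.inl r₁), mul true (.inl 9) (.inl r₁')])
    (ifComm r₁ 8 skip (ofList [clear (.inl r₂), mul true (.inl 8) (.inl r₂), clear (.inl r₂'),
      mul true (.inl 9) (.inl r₂')])))
  (ofList [clear (.inl 8), clear (.inl 9)])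

/-- The new element becomes `r₁` if there is none yet, replaces `r₂` if it does not commute with
`r₁`, and is dropped otherwise. Registers are only copied or cleared, so the bound `N` persists; a
bound by running time would grow geometrically with the number of rounds. -/
theorem eval_selectCode {r₁ r₁' r₂ r₂' : Fin 14} (hr : [r₁, r₁', r₂, r₂', 8, 9].Nodup)
    {S : Set (FreeGroup X)} {x u : FreeGroup X} {R : Fin 14 → FreeGroup X} {N : ℕ}
    (h : IsSelection S x (R r₁) (R r₁') (R r₂) (R r₂')) (h8 : R 8 = u) (h9 : R 9 = x⁻¹ * u * x)
    (hN : ∀ i, (R i).norm ≤ N) :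
    ∃ R', (selectCode r₁ r₁' r₂ r₂').eval (withOnes R) = withOnes R' ∧
      IsSelection (insert u S) x (R' r₁) (R' r₁') (R' r₂) (R' r₂') ∧ R' 8 = 1 ∧ R' 9 = 1 ∧
      (∀ i, i ∉ [r₁, r₁', r₂, r₂', 8, 9] → R' i = R i) ∧ ∀ i, (R' i).norm ≤ N := by
  simp only [List.nodup_cons, List.mem_cons, not_or, List.not_mem_nil, not_false_iff,
    and_true, List.nodup_nil] at hr
  obtain ⟨⟨h1, h2, h3, h4, h5⟩, ⟨h6, h7, h10, h11⟩, ⟨h12, h13, h14⟩, ⟨h15, h16⟩, h17⟩ := hr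
  have hu : u.norm ≤ N := h8 ▸ hN 8
  have hu' : (x⁻¹ * u * x).norm ≤ N := h9 ▸ hN 9
  have bound : ∀ {R : Fin 14 → FreeGroup X} (k : Fin 14) {g : FreeGroup X}, g.norm ≤ N →
      (∀ i, (R i).norm ≤ N) → ∀ i, (Function.update R k g i).norm ≤ N := by
    intro R k g hg hR i
    by_cases hi : i = k
    · subst hi; simpa using hg
    · simpa [hi] using hR i
  have one : (1 : FreeGroup X).norm ≤ N := by simp
  rw [selectCode, eval_seq, eval_ifOne_inl]
  split_ifs with hr1
  · have hr1' : R r₁' = 1 := by rw [h.eq₁, hr1]; group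
    have hr2 : R r₂ = 1 := by
      by_contra h'
      exact h.not_commute h' (hr1 ▸ Commute.one_left _)
    refine ⟨Function.update (Function.update (Function.update (Function.update R r₁ u) r₁'
      (x⁻¹ * u * x)) 8 1) 9 1, ?_, ?_, by simp, by simp, ?_,
      bound _ one (bound _ one (bound _ hu' (bound _ hu hN)))⟩
    · simp only [eval_ofList_cons, eval_ofList_nil, eval_mul_inl, eval_clear_inl, if_true]
      rw [hr1, h8, mul_one, Function.update_of_ne (Ne.symm h1), hr1', mul_one,
        Function.update_of_ne (Ne.symm h5), h9]
    · have e1 : Function.update (Function.update (Function.update (Function.update R r₁ u) r₁'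
        (x⁻¹ * u * x)) 8 1) 9 1 r₁ = u := by simp [h1, h4, h5]
      have e2 : Function.update (Function.update (Function.update (Function.update R r₁ u) r₁'
        (x⁻¹ * u * x)) 8 1) 9 1 r₁' = x⁻¹ * u * x := by simp [h10, h11]
      have e3 : Function.update (Function.update (Function.update (Function.update R r₁ u) r₁'
        (x⁻¹ * u * x)) 8 1) 9 1 r₂ = R r₂ := by simp [Ne.symm h2, Ne.symm h6, h13, h14]
      have e4 : Function.update (Function.update (Function.update (Function.update R r₁ u) r₁'
        (x⁻¹ * u * x)) 8 1) 9 1 r₂' = R r₂' := by simp [Ne.symm h3, Ne.symm h7, h15, h16]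
      rw [e1, e2, e3, e4]
      exact ⟨rfl, h.eq₂, fun hu1 g hg => hg.elim (fun h => h.trans hu1) (h.trivial_of hr1 g),
        fun _ g hg => hg.elim (fun h => h ▸ Commute.refl _)
          (fun hg => h.trivial_of hr1 g hg ▸ Commute.one_left _), fun h' => (h' hr2).elim⟩
    · intro i hi
      simp only [List.mem_cons, not_or] at hi
      simp [hi.1, hi.2.1, hi.2.2.2.2.1, hi.2.2.2.2.2.1]
  rw [eval_ifComm]
  split_ifs with hc
  · refine ⟨Function.update (Function.update R 8 1) 9 1, ?_, ?_, by simp, by simp, ?_,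
      bound _ one (bound _ one hN)⟩
    · simp only [eval_ofList_cons, eval_ofList_nil, eval_clear_inl, eval_skip]
    · simp only [ne_eq, h4, h5, h10, h11, h13, h14, h15, h16, not_false_iff,
        Function.update_of_ne]
      exact ⟨h.eq₁, h.eq₂, fun h' => (hr1 h').elim,
        fun h2 g hg => hg.elim (fun h => h ▸ h8 ▸ hc.symm) (h.commute_of h2 g), h.not_commute⟩
    · intro i hi
      simp only [List.mem_cons, not_or] at hi
      simp [hi.2.2.2.2.1, hi.2.2.2.2.2.1]
  · refine ⟨Function.update (Function.update (Function.update (Function.update R r₂ u) r₂'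
      (x⁻¹ * u * x)) 8 1) 9 1, ?_, ?_, by simp, by simp, ?_,
      bound _ one (bound _ one (bound _ hu' (bound _ hu hN)))⟩
    · simp only [eval_ofList_cons, eval_ofList_nil, eval_mul_inl, eval_clear_inl, if_true]
      simp [Ne.symm h13, Ne.symm h14, Ne.symm h16, h8, h9]
    · have e1 : Function.update (Function.update (Function.update (Function.update R r₂ u) r₂'
        (x⁻¹ * u * x)) 8 1) 9 1 r₁ = R r₁ := by simp [h2, h3, h4, h5]
      have e2 : Function.update (Function.update (Function.update (Function.update R r₂ u) r₂'
        (x⁻¹ * u * x)) 8 1) 9 1 r₁' = R r₁' := by simp [h6, h7, h10, h11]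
      have e3 : Function.update (Function.update (Function.update (Function.update R r₂ u) r₂'
        (x⁻¹ * u * x)) 8 1) 9 1 r₂ = u := by simp [h12, h13, h14]
      have e4 : Function.update (Function.update (Function.update (Function.update R r₂ u) r₂'
        (x⁻¹ * u * x)) 8 1) 9 1 r₂' = x⁻¹ * u * x := by simp [h15, h16]
      rw [e1, e2, e3, e4]
      rw [h8] at hc
      exact ⟨h.eq₁, rfl, fun h' => (hr1 h').elim,
        fun h2 => (hc (h2 ▸ Commute.one_right _)).elim, fun _ => hc⟩
    · intro i hi
      simp only [List.mem_cons, not_or] at hi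
      simp [hi.2.2.1, hi.2.2.2.1, hi.2.2.2.2.1, hi.2.2.2.2.2.1]

end RegCode

/-! ### Reading the public data -/

namespace StackProg

open RegCode (KeyReg withOnes withScratch withScratch_update selectCode keyCode size)

variable {X : Type} [DecidableEq X]

/-- The stacks with the tapes `T` and the main registers `R`. -/
def keyStacks (T : Fin 5 → List (AAGSymbol X)) (R : Fin 14 → FreeGroup X) :
    Fin 5 ⊕ Option KeyReg → List (AAGSymbol X) :=
  regStacks T (withScratch (withOnes R))

theorem keyStacks_update (T : Fin 5 → List (AAGSymbol X)) (R : Fin 14 → FreeGroup X) (i : Fin 14)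
    (g : FreeGroup X) :
    regStacks T (Function.update (withScratch (withOnes R)) (some (.inl i)) g) =
      keyStacks T (Function.update R i g) := by
  rw [keyStacks, ← withScratch_update, withOnes, Sum.update_elim_inl]; rfl

theorem keyStacks_inl (T : Fin 5 → List (AAGSymbol X)) (R : Fin 14 → FreeGroup X) (τ : Fin 5) :
    keyStacks T R (.inl τ) = T τ := rfl

theorem keyStacks_update_tape (T : Fin 5 → List (AAGSymbol X)) (R : Fin 14 → FreeGroup X)
    (τ : Fin 5) (l : List (AAGSymbol X)) :
    Function.update (keyStacks T R) (.inl τ) l = keyStacks (Function.update T τ l) R :=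
  regStacks_update_tape _ _ _ _

/-- Move the symbols of the input up to the end of a tuple to the tape `τ`. -/
def moveTuple (τ : Fin 5) : RegProg X KeyReg :=
  iter (.inl 0) (fun o => match o with
      | some (AAGSymbol.letter _) => true
      | some AAGSymbol.wordEnd => true
      | _ => false)
    fun o => match o with
      | some (AAGSymbol.letter x) => push (.inl τ) (AAGSymbol.letter x)
      | some AAGSymbol.wordEnd => push (.inl τ) AAGSymbol.wordEnd
      | _ => skip

theorem runsIn_moveTuple {τ : Fin 5} (hτ : τ ≠ 0) {l s : List (AAGSymbol X)}
    (hl : AAGSymbol.tupleEnd ∉ l) (T : Fin 5 → List (AAGSymbol X))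
    (h0 : T 0 = l ++ AAGSymbol.tupleEnd :: s) (R : Fin 14 → FreeGroup X) :
    RunsIn (moveTuple τ) (keyStacks T R) (2 * l.length + 2)
      (keyStacks (Function.update (Function.update T 0 s) τ (l.reverse ++ T τ)) R) := by
  induction l generalizing T with
  | nil =>
    refine (RunsIn.last (S := keyStacks T R) (k := .inl 0) (o := some AAGSymbol.tupleEnd) (t := 1)
      (by simp [keyStacks_inl, h0]) rfl ?_).mono (by simp)
    refine RunsIn.skip_of_eq ?_
    rw [keyStacks_update_tape]
    simp only [keyStacks_inl, h0, List.nil_append, List.tail_cons, List.reverse_nil]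
    congr 1
    exact Function.update_eq_self_iff.2 (by simp [hτ])
  | cons a l ih =>
    have step : RunsIn (push (.inl τ) a) (Function.update (keyStacks T R) (.inl 0)
        (keyStacks T R (.inl 0)).tail) 1
        (keyStacks (Function.update (Function.update T 0 (l ++ AAGSymbol.tupleEnd :: s)) τ
          (a :: T τ)) R) := by
      refine (RunsIn.push _ _ _).of_eq le_rfl ?_
      rw [keyStacks_update_tape, keyStacks_update_tape]
      simp [keyStacks_inl, h0, hτ]
    have ih' := ih (fun h => hl (List.mem_cons_of_mem _ h)) (Function.update (Function.update T 0
      (l ++ AAGSymbol.tupleEnd :: s)) τ (a :: T τ)) (by simp [hτ.symm])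
    have hh : (keyStacks T R (.inl 0)).head? = some a := by simp [keyStacks_inl, h0]
    have fin : Function.update (Function.update (Function.update (Function.update T 0
        (l ++ AAGSymbol.tupleEnd :: s)) τ (a :: T τ)) 0 s) τ (l.reverse ++ Function.update
        (Function.update T 0 (l ++ AAGSymbol.tupleEnd :: s)) τ (a :: T τ) τ) =
        Function.update (Function.update T 0 s) τ ((a :: l).reverse ++ T τ) := by
      rw [Function.update_comm hτ, Function.update_idem, Function.update_idem]
      simp
    rw [fin] at ih'
    cases a with
    | letter x => exact (RunsIn.next hh rfl step ih').mono (by simp; omega)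
    | wordEnd => exact (RunsIn.next hh rfl step ih').mono (by simp; omega)
    | tupleEnd => exact (hl (List.mem_cons_self)).elim

/-- Read a word that is written from right to left on the tape `τ` to the register `i`. -/
def readWord (τ : Fin 5) (i : Fin 14) : RegProg X KeyReg :=
  iter (.inl τ) (fun o => match o with
      | some (AAGSymbol.letter _) => true
      | _ => false)
    fun o => match o with
      | some (AAGSymbol.letter x) => absorb x (some (.inl i))
      | some AAGSymbol.wordEnd => push (.inl τ) AAGSymbol.wordEnd
      | _ => skip

/-- Moving a tuple reversed it, so the last letter comes first and left multiplication rebuilds the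
word, reducing it on the way. The separator stays on the tape since it announces the next word. -/
theorem runsIn_readWord {τ : Fin 5} {i : Fin 14} {w : List (X × Bool)} {s : List (AAGSymbol X)}
    (hs : s = [] ∨ ∃ s', s = AAGSymbol.wordEnd :: s') (T : Fin 5 → List (AAGSymbol X))
    (hT : T τ = w.map AAGSymbol.letter ++ s) (R : Fin 14 → FreeGroup X) :
    RunsIn (readWord τ i) (keyStacks T R) (4 * w.length + 2)
      (keyStacks (Function.update T τ s) (Function.update R i
        (FreeGroup.mk w.reverse * R i))) := by
  induction w generalizing T R with
  | nil =>
    have e : keyStacks (Function.update T τ s) (Function.update R i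
        (FreeGroup.mk ([] : List (X × Bool)).reverse * R i)) = keyStacks T R := by
      have : (FreeGroup.mk ([] : List (X × Bool)).reverse * R i) = R i := one_mul _
      rw [this, Function.update_eq_self, ← show T τ = s from hT, Function.update_eq_self]
    rw [e]
    rcases hs with rfl | ⟨s', rfl⟩
    · refine RunsIn.last (k := .inl τ) (o := none) (t := 1)
        (by simp [keyStacks_inl, hT]) rfl (RunsIn.skip_of_eq ?_)
      have : (keyStacks T R (.inl τ)).tail = keyStacks T R (.inl τ) := by
        simp [keyStacks_inl, hT]
      rw [this, Function.update_eq_self]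
    · refine RunsIn.last (k := .inl τ) (o := some AAGSymbol.wordEnd) (t := 1)
        (by simp [keyStacks_inl, hT]) rfl ((RunsIn.push _ _ _).of_eq le_rfl ?_)
      rw [Function.update_idem, Function.update_self]
      refine Function.update_eq_self_iff.2 ?_
      simp [keyStacks_inl, hT]
  | cons x w ih =>
    have e : Function.update (keyStacks T R) (.inl τ) (keyStacks T R (.inl τ)).tail =
        keyStacks (Function.update T τ (w.map AAGSymbol.letter ++ s)) R := by
      rw [keyStacks_update_tape]
      simp [keyStacks_inl, hT]
    have step := runsIn_absorb x (some (.inl i)) (Function.update T τ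
      (w.map AAGSymbol.letter ++ s)) (withScratch (withOnes R))
    rw [keyStacks_update] at step
    change RunsIn _ (keyStacks _ R) _ _ at step
    rw [← e] at step
    refine (RunsIn.next (o := some (AAGSymbol.letter x)) (by simp [keyStacks_inl, hT]) rfl
      step (ih _ (by simp) _)).of_eq (by simp; omega) ?_
    rw [Function.update_idem, Function.update_idem, Function.update_self]
    congr 2
    rw [List.reverse_cons, ← FreeGroup.mul_mk, mul_assoc]
    rfl

/-- Words as they are written on a tape, from right to left, after reading a tuple. -/
def pile (L : List (GroupWord X)) : List (AAGSymbol X) :=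
  L.flatMap fun w => AAGSymbol.wordEnd :: w.reverse.map AAGSymbol.letter

omit [DecidableEq X] in
theorem pile_eq (L : List (GroupWord X)) :
    pile L = [] ∨ ∃ s, pile L = AAGSymbol.wordEnd :: s := by
  cases L with
  | nil => exact Or.inl rfl
  | cons w L => exact Or.inr ⟨_, rfl⟩

/-- Take the words on the tapes `τ` and `τ'` into account in a selection. -/
def selectLoop (τ τ' : Fin 5) (p : RegCode KeyReg) : RegProg X KeyReg :=
  iter (.inl τ) Option.isSome fun o => match o with
    | some AAGSymbol.wordEnd => seq (iter (.inl τ') (fun _ => false) fun _ => skip)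
      (seq (readWord τ 8) (seq (readWord τ' 9) p.compile))
    | _ => skip

theorem size_withOnes_le {R : Fin 14 → FreeGroup X} {N : ℕ} (hN : ∀ i, (R i).norm ≤ N) :
    size (withOnes R) ≤ 14 * N := by
  rw [size, Fintype.sum_sum_type]
  have h1 : ∑ i : Fin 8, (withOnes R (Sum.inr i)).norm = 0 :=
    Finset.sum_eq_zero fun i _ => by fin_cases i <;> simp [withOnes]
  have h2 : ∑ i : Fin 14, (withOnes R (Sum.inl i)).norm ≤ ∑ _i : Fin 14, N :=
    Finset.sum_le_sum fun i _ => hN i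
  rw [h1]
  simpa using h2

/-- All rounds have the same cost because the main registers stay within `N`. Generators and
conjugates lie on two tapes in the same order and are consumed together. -/
theorem runsIn_selectLoop {τ τ' : Fin 5} (hτ : τ ≠ τ') {r₁ r₁' r₂ r₂' : Fin 14}
    (hr : [r₁, r₁', r₂, r₂', 8, 9].Nodup) {C : ℕ}
    (hC : ∀ (T : Fin 5 → List (AAGSymbol X)) (R : KeyReg → FreeGroup X),
      RunsIn (selectCode r₁ r₁' r₂ r₂').compile (regStacks T (withScratch R)) (C * (size R + 1))
        (regStacks T (withScratch ((selectCode r₁ r₁' r₂ r₂').eval R))))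
    {x : FreeGroup X} {N : ℕ} (L : List (GroupWord X × GroupWord X))
    (hL : ∀ q ∈ L, FreeGroup.mk q.2 = x⁻¹ * FreeGroup.mk q.1 * x ∧ q.1.length ≤ N ∧
      q.2.length ≤ N)
    (T : Fin 5 → List (AAGSymbol X)) (hT : T τ = pile (L.map Prod.fst))
    (hT' : T τ' = pile (L.map Prod.snd)) (R : Fin 14 → FreeGroup X) (S : Set (FreeGroup X))
    (hS : IsSelection S x (R r₁) (R r₁') (R r₂) (R r₂')) (h8 : R 8 = 1) (h9 : R 9 = 1)
    (hN : ∀ i, (R i).norm ≤ N) :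
    ∃ R', RunsIn (selectLoop τ τ' (selectCode r₁ r₁' r₂ r₂')) (keyStacks T R)
        (L.length * (C * (14 * N + 1) + 8 * N + 7) + 2)
        (keyStacks (Function.update (Function.update T τ []) τ' []) R') ∧
      IsSelection (S ∪ {g | ∃ q ∈ L, g = FreeGroup.mk q.1}) x (R' r₁) (R' r₁') (R' r₂) (R' r₂') ∧
      R' 8 = 1 ∧ R' 9 = 1 ∧ (∀ i, i ∉ [r₁, r₁', r₂, r₂', 8, 9] → R' i = R i) ∧
      ∀ i, (R' i).norm ≤ N := by
  induction L generalizing T R S with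
  | nil =>
    refine ⟨R, ?_, by simpa using hS, h8, h9, fun _ _ => rfl, hN⟩
    have e : Function.update (Function.update T τ []) τ' [] = T := by
      have e1 : T τ = [] := hT
      have e2 : T τ' = [] := hT'
      rw [← e1, Function.update_eq_self, e1, ← e2, Function.update_eq_self]
    rw [e]
    refine (RunsIn.last (k := .inl τ) (o := none) (t := 1)
      (by simp [keyStacks_inl, hT, pile]) rfl (RunsIn.skip_of_eq ?_)).mono (by simp)
    have : (keyStacks T R (.inl τ)).tail = keyStacks T R (.inl τ) := by
      simp [keyStacks_inl, hT, pile]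
    rw [this, Function.update_eq_self]
  | cons q L ih =>
    obtain ⟨w, w'⟩ := q
    obtain ⟨hq, hw, hw'⟩ := hL (w, w') List.mem_cons_self
    simp only at hq hw hw'
    set s := pile (L.map Prod.fst) with hs
    set s' := pile (L.map Prod.snd) with hs'
    have eT : T τ = AAGSymbol.wordEnd :: (w.reverse.map AAGSymbol.letter ++ s) := hT
    have eT' : T τ' = AAGSymbol.wordEnd :: (w'.reverse.map AAGSymbol.letter ++ s') := hT'
    set T₁ := Function.update T τ (w.reverse.map AAGSymbol.letter ++ s) with hT₁
    set T₂ := Function.update T₁ τ' (w'.reverse.map AAGSymbol.letter ++ s') with hT₂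
    have e1 : Function.update (keyStacks T R) (.inl τ) (keyStacks T R (.inl τ)).tail =
        keyStacks T₁ R := by
      rw [keyStacks_update_tape]
      simp [keyStacks_inl, eT, hT₁]
    have r1 : RunsIn (iter (.inl τ') (fun _ => false) fun _ => skip) (keyStacks T₁ R) 2
        (keyStacks T₂ R) := by
      refine RunsIn.last (k := .inl τ') (o := some AAGSymbol.wordEnd) (t := 1)
        (by simp [keyStacks_inl, hT₁, eT', hτ.symm]) rfl (RunsIn.skip_of_eq ?_)
      rw [keyStacks_update_tape]
      simp [keyStacks_inl, hT₁, hT₂, eT', hτ.symm]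
    have r2 := runsIn_readWord (i := 8) (pile_eq (L.map Prod.fst)) T₂ (τ := τ) (w := w.reverse)
      (by simp [hT₂, hT₁, hτ, hs]) R
    rw [List.reverse_reverse, h8, mul_one] at r2
    set T₃ := Function.update T₂ τ s with hT₃
    set R₁ := Function.update R 8 (FreeGroup.mk w) with hR₁
    have r3 := runsIn_readWord (i := 9) (pile_eq (L.map Prod.snd)) T₃ (τ := τ') (w := w'.reverse)
      (by simp [hT₃, hT₂, hτ.symm, hs']) R₁
    have h9' : R₁ 9 = 1 := by simp [hR₁, h9]
    rw [List.reverse_reverse, h9', mul_one] at r3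
    set T₄ := Function.update T₃ τ' s' with hT₄
    set R₂ := Function.update R₁ 9 (FreeGroup.mk w') with hR₂
    have hN₂ : ∀ i, (R₂ i).norm ≤ N := by
      intro i
      by_cases i9 : i = 9
      · subst i9
        simpa [hR₂] using FreeGroup.norm_mk_le.trans hw'
      · by_cases i8 : i = 8
        · subst i8
          simpa [hR₂, hR₁] using FreeGroup.norm_mk_le.trans hw
        · simpa [hR₂, hR₁, i8, i9] using hN i
    have off : ∀ i, i ≠ 8 → i ≠ 9 → R₂ i = R i := fun i i8 i9 => by simp [hR₂, hR₁, i8, i9]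
    have hr' := hr
    simp only [List.nodup_cons, List.mem_cons, not_or, List.not_mem_nil, not_false_iff,
      and_true, List.nodup_nil] at hr'
    obtain ⟨⟨-, -, -, k1, k2⟩, ⟨-, -, k3, k4⟩, ⟨-, k5, k6⟩, ⟨k7, k8⟩, -⟩ := hr'
    obtain ⟨R₃, ev, hS₃, h8₃, h9₃, off₃, hN₃⟩ := RegCode.eval_selectCode hr (S := S) (x := x)
      (u := FreeGroup.mk w) (R := R₂) (N := N)
      (by rwa [off _ k1 k2, off _ k3 k4, off _ k5 k6, off _ k7 k8])
      (by simp [hR₂, hR₁]) (by simp [hR₂, hq, -FreeGroup.inv_mk, -FreeGroup.mul_mk]) hN₂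
    have r4 := hC T₄ (withOnes R₂)
    rw [ev] at r4
    have hsize := size_withOnes_le hN₂
    obtain ⟨R', r5, hS', h8', h9'', off', hN'⟩ := ih (fun q hq => hL q (List.mem_cons_of_mem _ hq))
      T₄ (by simp [hT₄, hT₃, hτ]) (by simp [hT₄]) R₃ _ hS₃ h8₃ h9₃ hN₃
    refine ⟨R', ?_, ?_, h8', h9'', fun i hi => ?_, hN'⟩
    · have body := r1.seq (r2.seq (r3.seq r4))
      rw [← e1] at body
      refine (RunsIn.next (k := .inl τ) (o := some AAGSymbol.wordEnd)
        (by simp [keyStacks_inl, eT]) rfl body r5).of_eq ?_ ?_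
      · have : C * (size (withOnes R₂) + 1) ≤ C * (14 * N + 1) :=
          Nat.mul_le_mul_left _ (by omega)
        simp only [List.length_cons, List.length_reverse, add_mul]
        omega
      · congr 1
        funext i
        by_cases i1 : i = τ'
        · subst i1; simp
        · by_cases i2 : i = τ
          · subst i2; simp [i1]
          · simp [i1, i2, hT₄, hT₃, hT₂, hT₁]
    · convert hS' using 1
      ext g
      simp only [Set.mem_union, Set.mem_ofPred_eq, List.mem_cons, Set.mem_insert_iff]
      constructor
      · rintro (h | ⟨q, rfl | hq, rfl⟩)
        · exact Or.inl (Or.inr h)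
        · exact Or.inl (Or.inl rfl)
        · exact Or.inr ⟨q, hq, rfl⟩
      · rintro ((rfl | h) | ⟨q, hq, rfl⟩)
        · exact Or.inr ⟨_, Or.inl rfl, rfl⟩
        · exact Or.inl h
        · exact Or.inr ⟨q, Or.inr hq, rfl⟩
    · rw [off' i hi, off₃ i hi]
      simp only [List.mem_cons, not_or] at hi
      exact off i hi.2.2.2.2.1 hi.2.2.2.2.2.1

end StackProg

/-! ### The machine -/

namespace StackProg

open RegCode (KeyReg withOnes withScratch selectCode keyCode size)

variable {X : Type} [DecidableEq X]

/-- The program that computes the inverse of the shared key from the public data. -/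
def aagProgram (X : Type) [DecidableEq X] : RegProg X KeyReg :=
  seq (moveTuple 1) (seq (moveTuple 2) (seq (moveTuple 3) (seq (moveTuple 4)
    (seq (selectLoop 1 4 (selectCode 0 1 2 3)) (seq (selectLoop 2 3 (selectCode 4 5 6 7))
      keyCode.compile)))))

omit [DecidableEq X] in
/-- The words of a tuple, each followed by a separator. -/
theorem reverse_flatMap_eq_pile (L : List (GroupWord X)) :
    (L.flatMap fun u => u.map AAGSymbol.letter ++ [AAGSymbol.wordEnd]).reverse =
      pile L.reverse := by
  induction L with
  | nil => rfl
  | cons w L ih =>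
    rw [List.flatMap_cons, List.reverse_append, ih, pile, pile, List.reverse_cons,
      List.flatMap_append]
    simp

omit [DecidableEq X] in
theorem tupleEnd_notMem (L : List (GroupWord X)) :
    AAGSymbol.tupleEnd ∉ L.flatMap fun u => u.map AAGSymbol.letter ++ [AAGSymbol.wordEnd] := by
  simp

omit [DecidableEq X] in
theorem length_le_encodeTuple {k : ℕ} (w : Fin k → GroupWord X) (i : Fin k) :
    (w i).length ≤ (encodeTuple w).length := by
  rw [encodeTuple, List.length_append, List.length_flatMap]
  have := List.single_le_sum (l := (List.ofFn w).map fun u =>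
    (u.map AAGSymbol.letter ++ [AAGSymbol.wordEnd]).length) (fun _ _ => Nat.zero_le _)
    ((w i).length + 1) (List.mem_map.2 ⟨w i, by simp, by simp⟩)
  omega

omit [DecidableEq X] in
theorem lt_length_encodeTuple {k : ℕ} (w : Fin k → GroupWord X) :
    k < (encodeTuple w).length := by
  rw [encodeTuple, List.length_append, List.length_flatMap]
  have : ((List.ofFn w).map fun u => 1).sum ≤ ((List.ofFn w).map fun u =>
      (u.map AAGSymbol.letter ++ [AAGSymbol.wordEnd]).length).sum :=
    List.sum_le_sum fun u _ => by simp
  simp only [List.map_const', List.length_ofFn, List.sum_replicate, smul_eq_mul, mul_one] at this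
  simp only [List.length_singleton]
  omega

theorem update_tapes {β : Type*} (a0 a1 a2 a3 a4 x : β) :
    Function.update ![a0, a1, a2, a3, a4] 0 x = ![x, a1, a2, a3, a4] ∧
    Function.update ![a0, a1, a2, a3, a4] 1 x = ![a0, x, a2, a3, a4] ∧
    Function.update ![a0, a1, a2, a3, a4] 2 x = ![a0, a1, x, a3, a4] ∧
    Function.update ![a0, a1, a2, a3, a4] 3 x = ![a0, a1, a2, x, a4] ∧
    Function.update ![a0, a1, a2, a3, a4] 4 x = ![a0, a1, a2, a3, x] := by
  refine ⟨?_, ?_, ?_, ?_, ?_⟩ <;> funext i <;> fin_cases i <;> rfl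

omit [DecidableEq X] in
/-- A tuple of generators and a tuple of conjugates, from right to left. -/
theorem exists_pile {k : ℕ} (w w' : Fin k → GroupWord X) {x : FreeGroup X} {N : ℕ}
    (h : ∀ i, FreeGroup.mk (w' i) = x⁻¹ * FreeGroup.mk (w i) * x ∧ (w i).length ≤ N ∧
      (w' i).length ≤ N) :
    ∃ L : List (GroupWord X × GroupWord X), L.length = k ∧
      ((List.ofFn w).flatMap fun u => u.map AAGSymbol.letter ++ [AAGSymbol.wordEnd]).reverse =
        pile (L.map Prod.fst) ∧
      ((List.ofFn w').flatMap fun u => u.map AAGSymbol.letter ++ [AAGSymbol.wordEnd]).reverse =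
        pile (L.map Prod.snd) ∧
      (∀ q ∈ L, FreeGroup.mk q.2 = x⁻¹ * FreeGroup.mk q.1 * x ∧ q.1.length ≤ N ∧
        q.2.length ≤ N) ∧
      (Set.range fun i => FreeGroup.mk (w i)) ⊆ {g | ∃ q ∈ L, g = FreeGroup.mk q.1} := by
  refine ⟨(List.ofFn fun i => (w i, w' i)).reverse, by simp, ?_, ?_, ?_, ?_⟩
  · rw [reverse_flatMap_eq_pile, List.map_reverse, List.map_ofFn]; rfl
  · rw [reverse_flatMap_eq_pile, List.map_reverse, List.map_ofFn]; rfl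
  · intro q hq
    rw [List.mem_reverse, List.mem_ofFn] at hq
    obtain ⟨i, rfl⟩ := hq
    exact h i
  · rintro _ ⟨i, rfl⟩
    exact ⟨(w i, w' i), by rw [List.mem_reverse, List.mem_ofFn]; exact ⟨i, rfl⟩, rfl⟩

/-- Only the two selection loops have a number of rounds depending on the input, namely `m` and `n`.
Everything else is a single pass over the data or a fixed register program. -/
theorem exists_runsIn_aagProgram (X : Type) [DecidableEq X] :
    ∃ D : ℕ, ∀ (m n : ℕ) (p : AAGInstance X m n),
      RunsIn (aagProgram X) (Function.update (fun _ => []) (.inl 0) p.publicData)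
        (D * ((m + n + 1) * p.size))
        (keyStacks (fun _ => []) (Function.update (fun _ => 1) 13
          (p.a⁻¹ * p.b⁻¹ * p.a * p.b)⁻¹)) := by
  obtain ⟨C₁, hC₁⟩ := RegCode.exists_runsIn_compile (X := X) (selectCode 0 1 2 3) (by decide)
  obtain ⟨C₂, hC₂⟩ := RegCode.exists_runsIn_compile (X := X) (selectCode 4 5 6 7) (by decide)
  obtain ⟨C₃, hC₃⟩ := RegCode.exists_runsIn_compile (X := X) keyCode RegCode.ok_keyCode
  refine ⟨15 * (C₁ + C₂ + C₃) + 40, fun m n p => ?_⟩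
  set N := p.size with hNdef
  have hsize : N = (encodeTuple p.genA).length + (encodeTuple p.genB).length +
      (encodeTuple p.conjB).length + (encodeTuple p.conjA).length := by
    rw [hNdef, AAGInstance.size, AAGInstance.publicData]
    simp only [List.length_append]
  set lA := (List.ofFn p.genA).flatMap fun u => u.map AAGSymbol.letter ++ [AAGSymbol.wordEnd]
  set lB := (List.ofFn p.genB).flatMap fun u => u.map AAGSymbol.letter ++ [AAGSymbol.wordEnd]
  set lB' := (List.ofFn p.conjB).flatMap fun u => u.map AAGSymbol.letter ++ [AAGSymbol.wordEnd]
  set lA' := (List.ofFn p.conjA).flatMap fun u => u.map AAGSymbol.letter ++ [AAGSymbol.wordEnd]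
  have len : ∀ {k : ℕ} (w : Fin k → GroupWord X), ((List.ofFn w).flatMap fun u =>
      u.map AAGSymbol.letter ++ [AAGSymbol.wordEnd]).length + 1 = (encodeTuple w).length :=
    fun w => by rw [encodeTuple, List.length_append]; rfl
  have hlA : lA.length + 1 = _ := len p.genA
  have hlB : lB.length + 1 = _ := len p.genB
  have hlB' : lB'.length + 1 = _ := len p.conjB
  have hlA' : lA'.length + 1 = _ := len p.conjA
  set sB' := lA' ++ [AAGSymbol.tupleEnd] with hsB'
  set sB := lB' ++ AAGSymbol.tupleEnd :: sB' with hsB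
  set sA := lB ++ AAGSymbol.tupleEnd :: sB with hsA
  have start : Function.update (fun _ => []) (.inl 0) p.publicData =
      keyStacks ![lA ++ AAGSymbol.tupleEnd :: sA, [], [], [], []] (fun _ => 1) := by
    have e0 : keyStacks ![[], [], [], [], []] (fun _ => 1) =
        (fun _ => [] : Fin 5 ⊕ Option KeyReg → List (AAGSymbol X)) := by
      funext i
      rcases i with i | _ | i | i
      · fin_cases i <;> rfl
      · rfl
      · rfl
      · fin_cases i <;> rfl
    rw [← e0, keyStacks_update_tape]
    simp only [update_tapes]
    congr 2
    simp [AAGInstance.publicData, encodeTuple, lA, lB, lA', lB', hsA, hsB, hsB']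
  rw [start]
  have r1 := runsIn_moveTuple (τ := 1) (l := lA) (by decide)
    (tupleEnd_notMem (List.ofFn p.genA))
    ![lA ++ AAGSymbol.tupleEnd :: sA, [], [], [], []] rfl (fun _ => 1)
  have r2 := runsIn_moveTuple (τ := 2) (l := lB) (by decide)
    (tupleEnd_notMem (List.ofFn p.genB))
    ![sA, lA.reverse, [], [], []] rfl (fun _ => 1)
  have r3 := runsIn_moveTuple (τ := 3) (l := lB') (by decide)
    (tupleEnd_notMem (List.ofFn p.conjB))
    ![sB, lA.reverse, lB.reverse, [], []] rfl (fun _ => 1)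
  have r4 := runsIn_moveTuple (τ := 4) (l := lA') (by decide)
    (tupleEnd_notMem (List.ofFn p.conjA))
    ![sB', lA.reverse, lB.reverse, lB'.reverse, []] rfl (fun _ => 1)
  simp only [update_tapes, Matrix.cons_val, List.append_nil] at r1 r2 r3 r4
  obtain ⟨LA, nA, pA, pA', hA, subA⟩ := exists_pile p.genA p.conjA (x := p.b) (N := N) fun i =>
    ⟨FreeGroup.mk_toWord, by have := length_le_encodeTuple p.genA i; omega,
      by have := length_le_encodeTuple p.conjA i; omega⟩
  obtain ⟨LB, nB, pB, pB', hB, subB⟩ := exists_pile p.genB p.conjB (x := p.a) (N := N) fun i =>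
    ⟨FreeGroup.mk_toWord, by have := length_le_encodeTuple p.genB i; omega,
      by have := length_le_encodeTuple p.conjB i; omega⟩
  -- Alice's generators are paired with the last tuple of the input, their conjugates by Bob's
  -- secret; hence the tapes `1` and `4`, and `2` and `3` for Bob's generators.
  obtain ⟨R₁, r5, h5, h58, h59, off5, hN5⟩ := runsIn_selectLoop (τ := 1) (τ' := 4) (by decide)
    (r₁ := 0) (r₁' := 1) (r₂ := 2) (r₂' := 3) (by decide) hC₁ LA hA
    ![[], lA.reverse, lB.reverse, lB'.reverse, lA'.reverse] pA pA' (fun _ => 1) ∅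
    (IsSelection.empty _) rfl rfl (by simp)
  have off : ∀ i, 4 ≤ i → R₁ i = 1 := by
    intro i hi
    by_cases h8 : i = 8
    · rw [h8, h58]
    · by_cases h9 : i = 9
      · rw [h9, h59]
      · refine off5 i ?_
        simp only [List.mem_cons, List.not_mem_nil, h8, h9, or_false]
        rintro (rfl | rfl | rfl | rfl) <;> revert hi <;> decide
  simp only [update_tapes] at r5
  obtain ⟨R₂, r6, h6, h68, h69, off6, hN6⟩ := runsIn_selectLoop (τ := 2) (τ' := 3) (by decide)
    (r₁ := 4) (r₁' := 5) (r₂ := 6) (r₂' := 7) (by decide) hC₂ LB hB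
    ![[], [], lB.reverse, lB'.reverse, []] pB pB' R₁ ∅
    (by rw [off 4 (by decide), off 5 (by decide), off 6 (by decide), off 7 (by decide)]
        exact IsSelection.empty _) h58 h59 hN5
  simp only [update_tapes] at r6
  have r7 := hC₃ ![[], [], [], [], []] (withOnes R₂)
  have hA2 : IsSelection {g | ∃ q ∈ LA, g = FreeGroup.mk q.1} p.b (R₂ 0) (R₂ 1) (R₂ 2)
      (R₂ 3) := by
    rw [off6 0 (by decide), off6 1 (by decide), off6 2 (by decide), off6 3 (by decide)]
    simpa using h5
  rw [Set.empty_union] at h6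
  rw [RegCode.eval_keyCode hA2 h6 (Subgroup.closure_mono subA p.a_mem)
    (Subgroup.closure_mono subB p.b_mem) ?_] at r7
  · refine (r1.seq (r2.seq (r3.seq (r4.seq (r5.seq (r6.seq r7)))))).of_eq ?_ ?_
    · have hs := size_withOnes_le hN6
      have k1 : C₃ * (size (withOnes R₂) + 1) ≤ C₃ * (14 * N + 1) :=
        Nat.mul_le_mul_left _ (by omega)
      have k2 : 1 ≤ N := by omega
      rw [nA, nB]
      have k3 : m * (C₁ * (14 * N + 1) + 8 * N + 7) ≤ m * (C₁ * (15 * N) + 15 * N) := by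
        refine Nat.mul_le_mul_left _ ?_
        have : C₁ * (14 * N + 1) ≤ C₁ * (15 * N) := Nat.mul_le_mul_left _ (by omega)
        omega
      have k4 : n * (C₂ * (14 * N + 1) + 8 * N + 7) ≤ n * (C₂ * (15 * N) + 15 * N) := by
        refine Nat.mul_le_mul_left _ ?_
        have : C₂ * (14 * N + 1) ≤ C₂ * (15 * N) := Nat.mul_le_mul_left _ (by omega)
        omega
      have k5 : C₃ * (14 * N + 1) ≤ C₃ * (15 * N) := Nat.mul_le_mul_left _ (by omega)
      have k6 : 2 * lA.length + 2 + (2 * lB.length + 2 + (2 * lB'.length + 2 +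
        (2 * lA'.length + 2))) ≤ 2 * N := by omega
      have k7 : m * (C₁ * (15 * N) + 15 * N) + n * (C₂ * (15 * N) + 15 * N) + C₃ * (15 * N) +
          10 * N ≤ (15 * (C₁ + C₂ + C₃) + 40) * ((m + n + 1) * N) := by
        nlinarith [Nat.zero_le (m * N), Nat.zero_le (n * N), Nat.zero_le (C₁ * N),
          Nat.zero_le (C₂ * N), Nat.zero_le (m * C₂ * N), Nat.zero_le (m * C₃ * N),
          Nat.zero_le (n * C₁ * N), Nat.zero_le (n * C₃ * N)]
      omega
    · rw [← keyStacks]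
      congr 1
      funext i
      fin_cases i <;> rfl
  · intro i hi
    by_cases h8 : i = 8
    · rw [h8, h68]
    · by_cases h9 : i = 9
      · rw [h9, h69]
      · rw [off6 i]
        · refine off i (le_trans (by decide) hi)
        · simp only [List.mem_cons, List.not_mem_nil, h8, h9, or_false]
          rintro (rfl | rfl | rfl | rfl) <;> revert hi <;> decide

end StackProg

instance (X : Type) [Fintype X] : Fintype (AAGSymbol X) :=
  Fintype.ofEquiv ((X × Bool) ⊕ Bool)
    { toFun := fun s => s.elim AAGSymbol.letter
        fun b => if b then AAGSymbol.wordEnd else AAGSymbol.tupleEnd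
      invFun := fun s => match s with
        | AAGSymbol.letter x => .inl x
        | AAGSymbol.wordEnd => .inr true
        | AAGSymbol.tupleEnd => .inr false
      left_inv := by rintro (x | _ | _) <;> rfl
      right_inv := by rintro (x | _ | _) <;> rfl }

/-- The letter that a symbol of the result stands for. -/
def emitInverse {X : Type} : AAGSymbol X → Option (X × Bool)
  | AAGSymbol.letter x => some (FreeGroup.invLetter x)
  | _ => none

/-- The machine that computes the shared key. -/
def aagMachine (X : Type) [Fintype X] [DecidableEq X] :
    Turing.TM2ComputableAux (AAGSymbol X) (X × Bool) :=
  (StackProg.aagProgram X).machine (Sum.inl 0) (Sum.inr (some (Sum.inl 13))) emitInverse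

/-- Separators and end symbols alone are that many. This turns the factor `m + n + 1` into a factor
`p.size`. -/
theorem AAGInstance.add_lt_size {X : Type} [DecidableEq X] {m n : ℕ} (p : AAGInstance X m n) :
    m + n + 1 < p.size := by
  rw [size, publicData]
  simp only [List.length_append]
  have := StackProg.lt_length_encodeTuple p.genA
  have := StackProg.lt_length_encodeTuple p.genB
  have := StackProg.lt_length_encodeTuple p.conjA
  have := StackProg.lt_length_encodeTuple p.conjB
  omega

/-- The register holds the inverse of the key: the transfer to the output reverses the word,
`emitInverse` inverts the letters, and together they invert the element. The length of the key is
bounded by the input size plus the running time. -/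
theorem exists_haltsWithin_aagMachine (X : Type) [Fintype X] [DecidableEq X] :
    ∃ D : ℕ, ∀ (m n : ℕ) (p : AAGInstance X m n),
      HaltsWithin (aagMachine X) p.publicData p.key (D * ((m + n + 1) * p.size)) := by
  obtain ⟨D, hD⟩ := StackProg.exists_runsIn_aagProgram X
  refine ⟨3 * D + 4, fun m n p => ?_⟩
  obtain ⟨t, ht, h⟩ := hD m n p
  have e : StackProg.keyStacks (fun _ => []) (Function.update (fun _ => 1) 13
      (p.a⁻¹ * p.b⁻¹ * p.a * p.b)⁻¹) = Function.update (fun _ => [])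
        (Sum.inr (some (Sum.inl 13)) : Fin 5 ⊕ Option RegCode.KeyReg)
        (p.key.reverse.map fun x => AAGSymbol.letter (FreeGroup.invLetter x)) := by
    funext i
    rcases i with i | _ | i | i
    · rfl
    · rfl
    · by_cases hi : i = 13
      · subst hi
        rw [Function.update_self]
        change List.map AAGSymbol.letter (p.a⁻¹ * p.b⁻¹ * p.a * p.b)⁻¹.toWord = _
        rw [FreeGroup.toWord_inv, FreeGroup.invRev_eq]
        simp [AAGInstance.key, ← List.map_reverse, Function.comp_def]
      · change List.map _ (FreeGroup.toWord (Function.update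
          (fun _ : Fin 14 => (1 : FreeGroup X)) 13 _ i)) = _
        rw [Function.update_of_ne hi, Function.update_of_ne (by simpa using hi)]
        rfl
    · fin_cases i <;> rfl
  rw [e] at h
  have hs := h.stackSize_le
  have h1 := StackProg.stackSize_update (K := Fin 5 ⊕ Option RegCode.KeyReg)
    (Γ := AAGSymbol X) (fun _ => []) (Sum.inr (some (Sum.inl 13)))
      (p.key.reverse.map fun x => AAGSymbol.letter (FreeGroup.invLetter x))
  have h2 := StackProg.stackSize_update (K := Fin 5 ⊕ Option RegCode.KeyReg)
    (Γ := AAGSymbol X) (fun _ => []) (Sum.inl 0) p.publicData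
  simp only [List.length_map, List.length_reverse, List.length_nil] at h1 h2
  refine (StackProg.machine_haltsWithin (fun x => ?_) h).mono ?_
  · simp [emitInverse, FreeGroup.invLetter]
  · have h3 : p.size ≤ (m + n + 1) * p.size := Nat.le_mul_of_pos_left _ (Nat.succ_pos _)
    have h4 := p.add_lt_size
    have h5 : p.publicData.length = p.size := rfl
    have h6 : (3 * D + 4) * ((m + n + 1) * p.size) =
      3 * (D * ((m + n + 1) * p.size)) + 4 * ((m + n + 1) * p.size) := by ring
    omega

/-! ### Finite balls, genericity and the conclusion. -/

/-- The set of all tuples is exponentially generic if the balls are finite and non-empty. -/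
theorem exponentiallyGeneric_univ {X ι : Type} [DecidableEq X] [Fintype ι]
    {s : (ι → FreeGroup X) → ℕ} (h0 : s (fun _ => 1) = 0)
    (hfin : ∀ r, {T | s T ≤ r}.Finite) : ExponentiallyGeneric s Set.univ := by
  have h : frequency s Set.univ = fun _ => 1 := by
    funext r
    rw [frequency, Set.inter_univ, div_self]
    rw [Nat.cast_ne_zero]
    exact (Set.ncard_pos (hfin r)).2 ⟨fun _ => 1, by simp [h0]⟩ |>.ne'
  rw [ExponentiallyGeneric, h]
  exact ⟨tendsto_const_nhds, 1, 1 / 2, by norm_num, by norm_num, fun r => by simp⟩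

theorem finite_norm_le {X : Type} [Fintype X] [DecidableEq X] (r : ℕ) :
    {g : FreeGroup X | g.norm ≤ r}.Finite := by
  refine Set.Finite.of_finite_image (f := FreeGroup.toWord) ?_ FreeGroup.toWord_injective.injOn
  refine (List.finite_length_le (X × Bool) r).subset ?_
  rintro _ ⟨g, hg, rfl⟩
  exact hg

theorem finite_forall_norm_le {X ι : Type} [Fintype X] [DecidableEq X] [Fintype ι] (r : ℕ) :
    {T : ι → FreeGroup X | ∀ i, (T i).norm ≤ r}.Finite := by
  have := Set.Finite.pi (fun _ : ι => finite_norm_le (X := X) r)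
  refine this.subset fun T hT => ?_
  simpa [Set.mem_pi] using hT

theorem mainTheorem12 (X : Type) [Fintype X] [DecidableEq X] :
    (∃ (M : Turing.TM2ComputableAux (AAGSymbol X) (X × Bool)) (C : ℕ),
      ∀ (m n : ℕ) (p : AAGInstance X m n),
        HaltsWithin M p.publicData p.key (C * p.size ^ 2)) ∧
    (∀ m n : ℕ, ∃ S : Set (Fin m ⊕ Fin n → FreeGroup X),
      ExponentiallyGeneric totalLength S ∧ ExponentiallyGeneric maxLength S ∧
      ∃ (M : Turing.TM2ComputableAux (AAGSymbol X) (X × Bool)) (C : ℕ),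
        (∀ (p : AAGInstance X m n) (w : GroupWord X), HaltsWith M p.publicData w → w = p.key) ∧
        ∀ p : AAGInstance X m n, p.generators ∈ S →
          HaltsWithin M p.publicData p.key (C * p.size)) := by
  obtain ⟨D, hD⟩ := exists_haltsWithin_aagMachine X
  -- One machine serves both statements; for fixed `m` and `n` the factor `m + n + 1` is part of the
  -- constant, and no input has to be excluded.
  refine ⟨⟨aagMachine X, D, fun m n p => (hD m n p).mono ?_⟩, fun m n => ⟨Set.univ,
    exponentiallyGeneric_univ ?_ fun r => ?_, exponentiallyGeneric_univ ?_ fun r => ?_,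
    aagMachine X, D * (m + n + 1), fun p w hw => ?_, fun p _ => (hD m n p).mono ?_⟩⟩
  · rw [sq]
    exact Nat.mul_le_mul_left _ (Nat.mul_le_mul_right _ p.add_lt_size.le)
  · simp [totalLength]
  · refine (finite_forall_norm_le r).subset fun T hT i => le_trans ?_ hT
    exact Finset.single_le_sum (f := fun i => (T i).norm) (fun _ _ => Nat.zero_le _)
      (Finset.mem_univ i)
  · simp [maxLength]
  · exact (finite_forall_norm_le r).subset fun T hT i =>
      (Finset.le_sup (f := fun i => (T i).norm) (Finset.mem_univ i)).trans hT
  -- The machine halts with the key on every input, so by determinism it has no other output.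
  · obtain ⟨h⟩ := hD m n p
    exact hw.eq ⟨h.toEvalsTo⟩
  · rw [mul_assoc]
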